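/- Let $\omega=e^{2\pi i/3}$, let $\Gamma=4\pi i(\omega\mathbb Z\oplus\omega^2\mathbb Z)$ and $\Gamma_3=\frac13\Gamma$, and let $\Gamma^*=\{k\in\mathbb C:\operatorname{Re}(\gamma\bar k)\in2\pi\mathbb Z\ \text{for all}\ \gamma\in\Gamma\}$ be the dual lattice. Let $U\in C^\infty(\mathbb C;\mathbb C)$ satisfy $$U(z+a)=\bar\omega^{\,a_1+a_2}U(z)\ \text{ for } a=\tfrac{4\pi i}{3}(a_1\omega+a_2\omega^2)\in\Gamma_3,\qquad U(\omega z)=\omega U(z),\qquad \overline{U(\bar z)}=U(z).$$ Let $\zeta_1,\zeta_2\in\mathbb R$ be commensurable, $\frac{\zeta_2}{\zeta_1}=3^j\frac{r_1}{r_2}$ with $j,r_1\in\mathbb Z$, $r_2\in\mathbb N$ and $3\nmid r_1$, $3\nmid r_2$. Put $p=r_2$, $q=0$ if $j>0$, and $p=3^{-j}r_2$, $q=r_1$ if $j\le0$. With $2D_{\bar z}=\frac2i\partial_{\bar z}$ and $\alpha=(\alpha_{12},\alpha_{23})\in\mathbb C^2$ let $$D(\alpha)=\begin{pmatrix}2D_{\bar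 z}&\alpha_{12}U(pz)&0\\ \alpha_{12}U(-pz)&2D_{\bar z}&\alpha_{23}U(p\frac{\zeta_2}{\zeta_1}z)\\0&\alpha_{23}U(-p\frac{\zeta_2}{\zeta_1}z)&2D_{\bar z}\end{pmatrix},\qquad H_k(\alpha)=\begin{pmatrix}0&D(\alpha)^*+\bar k\\D(\alpha)+k&0\end{pmatrix},\quad k\in\mathbb C.$$ Let $L^2_0$ be the space of $u\in L^2_{\rm loc}(\mathbb C;\mathbb C^3\oplus\mathbb C^3)$ such that $\operatorname{diag}(\omega^{p(a_1+a_2)},1,\bar\omega^{q(a_1+a_2)})$, acting on both summands $\mathbb C^3$, maps $u(z+a)$ to $u(z)$ for all $a=\tfrac{4\pi i}{3}(a_1\omega+a_2\omega^2)\in\Gamma_3$, with the $L^2$ norm over a period cell, and regard $H_k(\alpha)$ as an unbounded operator on $L^2_0$ with domain $L^2_0\cap H^1_{\rm loc}$. Let $E_1(k,\alpha)$ be the smallest non-negative element of its spectrum. The parameter $\alpha$ is called magic if $E_1(k,\alpha)=0$ for all $k\in\mathbb C$. Let $\alpha_{12}\neq0$ and $k\in\mathbb C\setminus\Gamma^*$.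 Then $2D_{\bar z}+k$ with domain $H^1(\mathbb C/\Gamma)$ has a bounded inverse $R(k)$ on $L^2(\mathbb C/\Gamma;\mathbb C)$, the Birman–Schwinger operator $$B_k\big(\tfrac{\alpha_{23}}{\alpha_{12}}\big)=R(k)U(-pz)R(k)U(pz)+\Big(\frac{\alpha_{23}}{\alpha_{12}}\Big)^2R(k)U(p\tfrac{\zeta_2}{\zeta_1}z)R(k)U(-p\tfrac{\zeta_2}{\zeta_1}z)$$ is compact on $L^2(\mathbb C/\Gamma;\mathbb C)$, and $$\alpha\ \text{is magic}\quad\Longleftrightarrow\quad\frac1{\alpha_{12}^2}\in\operatorname{Spec}_{L^2(\mathbb C/\Gamma)}B_k\big(\tfrac{\alpha_{23}}{\alpha_{12}}\big).$$ -/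

import Mathlib

open MeasureTheory
open scoped ContDiff ComplexConjugate

noncomputable section

namespace TTG

/-! ### Lattices -/

/-- `ω = exp(2πi/3)`. -/
def omega : ℂ := Complex.exp (2 * Real.pi * Complex.I / 3)

/-- The lattice vector `4πi (ω m + ω² n)`; the lattice `Γ` is the set of these, `m n : ℤ`. -/
def latVec (m n : ℤ) : ℂ := 4 * Real.pi * Complex.I * (omega * m + omega ^ 2 * n)

/-- The vector `(4πi/3) (ω a₁ + ω² a₂)` of the moiré lattice `Γ₃ = Γ/3`. -/
def moireVec (a₁ a₂ : ℤ) : ℂ :=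
  4 * Real.pi * Complex.I / 3 * (omega * a₁ + omega ^ 2 * a₂)

/-- The dual lattice `Γ* = {k : Re (γ * conj k) ∈ 2πℤ for all γ ∈ Γ}`. -/
def dualLattice : Set ℂ :=
  {k | ∀ m n : ℤ, ∃ l : ℤ, (latVec m n * conj k).re = 2 * Real.pi * l}

theorem omega_eq : omega = ⟨-1 / 2, Real.sqrt 3 / 2⟩ := by
  have h : (2 * Real.pi * Complex.I / 3 : ℂ) = ((2 * Real.pi / 3 : ℝ) : ℂ) * Complex.I := by
    push_cast; ring
  have h2 : (2 * Real.pi / 3 : ℝ) = Real.pi - Real.pi / 3 := by ring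
  rw [omega, h, Complex.exp_mul_I, ← Complex.ofReal_cos, ← Complex.ofReal_sin, h2,
    Real.cos_pi_sub, Real.sin_pi_sub, Real.cos_pi_div_three, Real.sin_pi_div_three]
  apply Complex.ext <;> simp <;> norm_num

/-- The two generators `4πiω`, `4πiω²` of `Γ`. -/
def gens : Fin 2 → ℂ := ![latVec 1 0, latVec 0 1]

theorem gens_zero : gens 0 = ⟨-2 * Real.sqrt 3 * Real.pi, -2 * Real.pi⟩ := by
  simp only [gens, latVec, omega_eq, Matrix.cons_val_zero]
  apply Complex.ext <;> simp [pow_two] <;> ring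

theorem gens_one : gens 1 = ⟨2 * Real.sqrt 3 * Real.pi, -2 * Real.pi⟩ := by
  have h3 : Real.sqrt 3 * Real.sqrt 3 = 3 := Real.mul_self_sqrt (by norm_num)
  simp only [gens, latVec, omega_eq, Matrix.cons_val_one]
  apply Complex.ext
  · simp [pow_two]; ring
  · simp [pow_two]; linear_combination (-Real.pi) * h3

theorem gens_linearIndependent : LinearIndependent ℝ gens := by
  rw [Fintype.linearIndependent_iff]
  intro g hg
  rw [Fin.sum_univ_two, gens_zero, gens_one] at hg
  have hre := congrArg Complex.re hg
  have him := congrArg Complex.im hg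
  simp at hre him
  have hpi := Real.pi_pos
  have hs : 0 < Real.sqrt 3 := Real.sqrt_pos.2 (by norm_num)
  have h1 : g 0 = g 1 := by
    have : (Real.sqrt 3 * Real.pi) * (g 1 - g 0) = 0 := by linear_combination hre / 2
    rcases mul_eq_zero.1 this with h | h
    · exact absurd h (by positivity)
    · linarith
  have h2 : g 1 = 0 := by
    have : Real.pi * g 1 = 0 := by rw [h1] at him; linear_combination -him / 4
    rcases mul_eq_zero.1 this with h | h
    · exact absurd h hpi.ne'
    · exact h
  intro i
  fin_cases i
  · simpa [h1] using h2
  · simpa using h2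

/-- The `ℤ`-basis `4πiω, 4πiω²` of `Γ`, as an `ℝ`-basis of `ℂ`. -/
def latBasis : Module.Basis (Fin 2) ℝ ℂ :=
  basisOfLinearIndependentOfCardEqFinrank gens_linearIndependent
    (by simp [Complex.finrank_real_complex])

/-- The half-open fundamental parallelogram `{4πi(ω s + ω² t) : s, t ∈ [0,1)}` of `Γ`. -/
def cell : Set ℂ := ZSpan.fundamentalDomain latBasis

/-- Lebesgue measure on the fundamental cell, i.e. the Haar measure `dA` of `ℂ/Γ`. -/
def cellMeasure : Measure ℂ := volume.restrict cell

/-! ### Function spaces on the torus `ℂ/Γ`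

A function on `ℂ/Γ` (equivalently: a `Γ`-periodic function on `ℂ`) is represented by its
restriction to the fundamental cell. -/

/-- `L²(ℂ/Γ; E)`. -/
abbrev L2 (E : Type) [NormedAddCommGroup E] : Type := Lp E 2 cellMeasure

/-- `ℂ³`, one coordinate for each layer. -/
abbrev C3 : Type := EuclideanSpace ℂ (Fin 3)

/-- `f` is the weak derivative in the direction `v` of `u` on the torus `ℂ/Γ`: integration by
parts holds against all smooth `Γ`-periodic test functions. -/
def HasWeakDeriv {E : Type} [NormedAddCommGroup E] [NormedSpace ℂ E]
    (v : ℂ) (u f : L2 E) : Prop :=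
  ∀ φ : ℂ → ℂ, ContDiff ℝ ∞ φ → (∀ (m n : ℤ) (z : ℂ), φ (z + latVec m n) = φ z) →
    ∫ z, (fderiv ℝ φ z v) • u z ∂cellMeasure = - ∫ z, φ z • f z ∂cellMeasure

/-- `u ∈ H¹(ℂ/Γ; E)` and `2 D_{z̄} u = f`, where
`2 D_{z̄} = (2/i) ∂_{z̄} = -i (∂ₓ + i ∂_y)`. -/
def IsTwoDzbar {E : Type} [NormedAddCommGroup E] [NormedSpace ℂ E] (u f : L2 E) : Prop :=
  ∃ ux uy : L2 E, HasWeakDeriv 1 u ux ∧ HasWeakDeriv Complex.I u uy ∧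
    f = (-Complex.I) • (ux + Complex.I • uy)

/-- `u ∈ H¹(ℂ/Γ; E)` and `2 D_z u = f`, where `2 D_z = -i (∂ₓ - i ∂_y)` is the formal adjoint
of `2 D_{z̄}`. -/
def IsTwoDz {E : Type} [NormedAddCommGroup E] [NormedSpace ℂ E] (u f : L2 E) : Prop :=
  ∃ ux uy : L2 E, HasWeakDeriv 1 u ux ∧ HasWeakDeriv Complex.I u uy ∧
    f = (-Complex.I) • (ux - Complex.I • uy)

/-! ### Unbounded operators and their spectrum

An (unbounded) operator `A` on `E` is given by its graph `A u f`: `u ∈ dom A` and `A u = f`. -/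

/-- The bounded operator `R` is a two-sided inverse of the operator with graph `A`. -/
def IsBoundedInverse {E : Type} [NormedAddCommGroup E] [NormedSpace ℂ E]
    (A : E → E → Prop) (R : E →L[ℂ] E) : Prop :=
  ∀ u f : E, A u f ↔ u = R f

/-- The spectrum of the operator with graph `A`: those `μ` for which `A - μ` has no bounded
two-sided inverse. -/
def spec {E : Type} [NormedAddCommGroup E] [NormedSpace ℂ E] (A : E → E → Prop) : Set ℂ :=
  {μ | ¬ ∃ R : E →L[ℂ] E, IsBoundedInverse (fun u f => A u (f + μ • u)) R}

/-! ### Potentials and angles -/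

/-- A smooth tunnelling potential with its three symmetries. -/
structure Potential where
  toFun : ℂ → ℂ
  smooth : ContDiff ℝ ∞ toFun
  translate : ∀ (a₁ a₂ : ℤ) (z : ℂ),
    toFun (z + moireVec a₁ a₂) = conj omega ^ (a₁ + a₂) * toFun z
  rotate : ∀ z : ℂ, toFun (omega * z) = omega * toFun z
  reflect : ∀ z : ℂ, conj (toFun (conj z)) = toFun z

/-- `p` for `ζ₂/ζ₁ = 3^j r₁/r₂`. -/
def pParam (j : ℤ) (r₂ : ℕ) : ℤ := if 0 < j then r₂ else 3 ^ (-j).toNat * r₂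

/-- `q` for `ζ₂/ζ₁ = 3^j r₁/r₂`. -/
def qParam (j r₁ : ℤ) : ℤ := if 0 < j then 0 else r₁

/-- `z ↦ U(c z)` for real `c`. -/
def Potential.scaled (U : Potential) (c : ℝ) : ℂ → ℂ := fun z => U.toFun (c * z)

theorem Potential.memLp_scaled (U : Potential) (c : ℝ) :
    MemLp (U.scaled c) ⊤ cellMeasure := by
  have hc : Continuous (U.scaled c) :=
    U.smooth.continuous.comp (continuous_const.mul continuous_id)
  have hb : Bornology.IsBounded cell := ZSpan.fundamentalDomain_isBounded latBasis
  obtain ⟨C, hC⟩ := hb.isCompact_closure.exists_bound_of_continuousOn hc.continuousOn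
  refine memLp_top_of_bound hc.aestronglyMeasurable C ?_
  exact (ae_restrict_iff' (ZSpan.fundamentalDomain_measurableSet latBasis)).2
    (Filter.Eventually.of_forall fun z hz => hC z (subset_closure hz))

/-- The off-diagonal potential matrix of `D(α)`, where `s = ζ₂/ζ₁`. -/
def potMatrix (U : Potential) (p : ℤ) (s : ℝ) (α₁₂ α₂₃ : ℂ) (z : ℂ) :
    Matrix (Fin 3) (Fin 3) ℂ :=
  !![0, α₁₂ * U.scaled p z, 0;
     α₁₂ * U.scaled (-p) z, 0, α₂₃ * U.scaled (p * s) z;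
     0, α₂₃ * U.scaled (-(p * s)) z, 0]

/-! ### The chiral Hamiltonian on `L²₀` -/

/-- The three diagonal entries `ω^{p(a₁+a₂)}, 1, ω̄^{q(a₁+a₂)}` of the twisted translation
`ℒ_a u(z) = diag(ω^{p(a₁+a₂)}, 1, ω̄^{q(a₁+a₂)}) u(z + a)`. -/
def twist (p q a₁ a₂ : ℤ) : Fin 3 → ℂ :=
  ![omega ^ (p * (a₁ + a₂)), 1, conj omega ^ (q * (a₁ + a₂))]

/-- `P` holding almost everywhere on the cell holds at `z + a` for almost all `z` of the cell
for which `z + a` lies in the cell. -/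
theorem ae_translate {P : ℂ → Prop} (h : ∀ᵐ z ∂cellMeasure, P z) (a : ℂ) :
    ∀ᵐ z ∂cellMeasure, z + a ∈ cell → P (z + a) := by
  have h1 : ∀ᵐ z : ℂ, z ∈ cell → P z :=
    (ae_restrict_iff' (ZSpan.fundamentalDomain_measurableSet latBasis)).1 h
  exact ae_restrict_of_ae
    ((measurePreserving_add_right (volume : Measure ℂ) a).quasiMeasurePreserving.ae h1)

/-- `L²₀ = {u : ℒ_a u = u for all a ∈ Γ₃}` for `ℂ³`-valued functions. As `ℒ_a` is the ordinary
translation for `a ∈ Γ`, such `u` are `Γ`-periodic, and the condition only has to be tested at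
points `z` and `z + a` that both lie in the fundamental cell of `Γ`, for all `a ∈ Γ₃`. The norm
is that of `L²(ℂ/Γ)`, which is three times the norm of `L²(ℂ/Γ₃)` on this subspace. -/
def L20 (p q : ℤ) : Submodule ℂ (L2 C3) where
  carrier := {u | ∀ a₁ a₂ : ℤ, ∀ᵐ z ∂cellMeasure, z + moireVec a₁ a₂ ∈ cell →
    ∀ i, twist p q a₁ a₂ i * u (z + moireVec a₁ a₂) i = u z i}
  add_mem' := by
    intro u v hu hv a₁ a₂
    filter_upwards [hu a₁ a₂, hv a₁ a₂, Lp.coeFn_add u v,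
      ae_translate (Lp.coeFn_add u v) (moireVec a₁ a₂)] with z h1 h2 h3 h4 hz i
    rw [h3, h4 hz]
    simp only [Pi.add_apply, PiLp.add_apply, mul_add, h1 hz i, h2 hz i]
  zero_mem' := by
    intro a₁ a₂
    have h0 := Lp.coeFn_zero C3 2 cellMeasure
    filter_upwards [h0, ae_translate h0 (moireVec a₁ a₂)] with z h3 h4 hz i
    rw [h3, h4 hz]
    simp
  smul_mem' := by
    intro c u hu a₁ a₂
    filter_upwards [hu a₁ a₂, Lp.coeFn_smul c u,
      ae_translate (Lp.coeFn_smul c u) (moireVec a₁ a₂)] with z h1 h3 h4 hz i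
    rw [h3, h4 hz]
    simp only [Pi.smul_apply, PiLp.smul_apply, smul_eq_mul]
    rw [mul_left_comm, h1 hz i]

/-- Graph of `D(α) + k` on `L²(ℂ/Γ; ℂ³)`, with domain `H¹`:
`f = 2 D_{z̄} u + 𝒱 u + k u`. -/
def IsD (U : Potential) (p : ℤ) (s : ℝ) (α₁₂ α₂₃ k : ℂ) (u f : L2 C3) : Prop :=
  ∃ d : L2 C3, IsTwoDzbar u d ∧ ∀ᵐ z ∂cellMeasure, ∀ i,
    f z i = d z i + (potMatrix U p s α₁₂ α₂₃ z).mulVec (u z).ofLp i + k * u z i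

/-- Graph of `D(α)* + k̄` on `L²(ℂ/Γ; ℂ³)`, with domain `H¹`:
`f = 2 D_z u + 𝒱ᴴ u + k̄ u`. -/
def IsDStar (U : Potential) (p : ℤ) (s : ℝ) (α₁₂ α₂₃ k : ℂ) (u f : L2 C3) : Prop :=
  ∃ d : L2 C3, IsTwoDz u d ∧ ∀ᵐ z ∂cellMeasure, ∀ i,
    f z i = d z i + (potMatrix U p s α₁₂ α₂₃ z).conjTranspose.mulVec (u z).ofLp i
      + conj k * u z i

/-- `L²₀` for `ℂ⁶`-valued functions, `ℂ⁶ = ℂ³ ⊕ ℂ³`. -/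
abbrev L20six (p q : ℤ) : Type := WithLp 2 (L20 p q × L20 p q)

/-- Graph of the Bloch transformed chiral Hamiltonian
`H_k(α) = [[0, D(α)* + k̄], [D(α) + k, 0]]` on `L²₀`. -/
def IsHam (U : Potential) (p q : ℤ) (s : ℝ) (α₁₂ α₂₃ k : ℂ) (w g : L20six p q) : Prop :=
  IsDStar U p s α₁₂ α₂₃ k w.snd g.fst ∧ IsD U p s α₁₂ α₂₃ k w.fst g.snd

/-- `E₁(k, α) = E`: the number `E` is the smallest non-negative point of the spectrum of
`H_k(α)` on `L²₀`. -/
def IsFirstBand (U : Potential) (p q : ℤ) (s : ℝ) (α₁₂ α₂₃ k : ℂ) (E : ℝ) : Prop :=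
  IsLeast {E' : ℝ | 0 ≤ E' ∧ (E' : ℂ) ∈ spec (IsHam U p q s α₁₂ α₂₃ k)} E

/-- `α = (α₁₂, α₂₃)` is magic: `E₁(k, α) = 0` for all `k ∈ ℂ` (a flat band at zero). -/
def IsMagic (U : Potential) (p q : ℤ) (s : ℝ) (α₁₂ α₂₃ : ℂ) : Prop :=
  ∀ k : ℂ, IsFirstBand U p q s α₁₂ α₂₃ k 0

/-! ### The Birman–Schwinger operator on `L²(ℂ/Γ; ℂ)` -/

/-- Multiplication by `U(c z)` on `L²(ℂ/Γ; ℂ)`. -/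
def mulU (U : Potential) (c : ℝ) : L2 ℂ →L[ℂ] L2 ℂ :=
  (ContinuousLinearMap.mul ℂ ℂ).holderL cellMeasure ⊤ 2 2 ((U.memLp_scaled c).toLp)

/-- Graph of `2 D_{z̄} + k` on `L²(ℂ/Γ; ℂ)`, with domain `H¹`. -/
def IsTwoDzbarAdd (k : ℂ) (u f : L2 ℂ) : Prop := IsTwoDzbar u (f - k • u)

open Classical in
/-- `R(k) = (2 D_{z̄} + k)⁻¹` on `L²(ℂ/Γ; ℂ)` (zero if `2 D_{z̄} + k` is not invertible). -/
def R (k : ℂ) : L2 ℂ →L[ℂ] L2 ℂ :=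
  if h : ∃ T : L2 ℂ →L[ℂ] L2 ℂ, IsBoundedInverse (IsTwoDzbarAdd k) T then h.choose else 0

/-- `B_k(t) = R(k) U(-pz) R(k) U(pz) + t² R(k) U(psz) R(k) U(-psz)`, where `s = ζ₂/ζ₁`. -/
def birmanSchwinger (U : Potential) (p : ℤ) (s : ℝ) (k t : ℂ) : L2 ℂ →L[ℂ] L2 ℂ :=
  R k ∘L mulU U (-p) ∘L R k ∘L mulU U p +
    t ^ 2 • (R k ∘L mulU U (p * s) ∘L R k ∘L mulU U (-(p * s)))

end TTG

end

/-! Expanding in the characters of `ℂ/Γ` turns `2 D_{z̄} + k` into multiplication by `dvec n + k`,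
where `dvec` enumerates `Γ*`. For `k ∉ Γ*` the resolvent is thus a compact multiplier `Rf k`, and
`(D(α) + k) u = 0` reads `u + Rv k (V u) = 0`. Rows one and three express the outer components
through the middle one `w`; row two becomes `α₁₂² B_k w = w`. Hence `1/α₁₂²` is in the spectrum of
`B_k` iff `D(α) + k` has a kernel in `L²(ℂ/Γ; ℂ³)` (`exists_inKer_iff_mem_spectrum`).

Magic means that no `H_k` is invertible on `L²₀`. If `D(α) + k` were injective on `L²(ℂ/Γ; ℂ³)`, the
Fredholm alternative would invert both off-diagonal blocks of `H_k` on `L²₀`; so magic gives a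
kernel (`exists_inKer_of_isMagic`).

The converse must pass from one `k ∉ Γ*`, with a kernel element anywhere in `L²(ℂ/Γ; ℂ³)`, to every
`k'`, with a kernel element in `L²₀` (`exists_inKer_of_exists`). The potential respects residues of
frequencies modulo 3, so projecting to a sector and modulating by a character gives an element of
`L²₀` at some `k₀ ∈ k + Γ*`. Rotation gives elements at `ω² k₀` and `ω k₀`, and symmetry protects
one at `0` for every `α` (`exists_inKer_zero`). These four parameters are pairwise distinct modulo
`3Γ*`, the dual lattice of `Γ₃`.

Suppose `D(α) + k'` were injective on `L²₀`; then so is `D(α) + k₁` for a generic `k₁` nearby. Let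
`∑ φ_l u_l = 0` be a relation between kernel elements `u_l` at parameters `K_l`, with `Γ₃`-periodic
`φ_l`. By Leibniz' rule `∑ ((2 D_{z̄} + k₁ - K_l)⁻¹ φ_l) u_l` is in the kernel of `D(α) + k₁`, so it
vanishes: the closed space of relations is invariant under the diagonal resolvent at `k₁`. The
resolvent identity and connectedness extend this to all admissible `k`. The residue at `k = K_l`
isolates the mean of `φ_l` times `u_l`, so that mean is zero; modulating the relation kills every
Fourier coefficient (`KerFam.eq_zero_of_relSub`). Hence there are no relations. But four vectors in
`ℂ³` have vanishing Gram determinant, and the adjugate of a singular Gram matrix supplies bounded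
periodic relations, a contradiction (`KerFam.not_det_eq_zero`). -/

noncomputable section

namespace TTG

open Filter Topology

/-! ### The dual lattice and its characters -/

/-- The vector of the dual lattice `Γ*` with coordinates `n`. -/
def dvec (n : Fin 2 → ℤ) : ℂ :=
  ⟨(n 1 - n 0) / (2 * Real.sqrt 3), -(n 0 + n 1) / 2⟩

theorem dvec_add (m n : Fin 2 → ℤ) : dvec (m + n) = dvec m + dvec n := by
  apply Complex.ext <;> simp [dvec] <;> ring

theorem dvec_neg (n : Fin 2 → ℤ) : dvec (-n) = -dvec n := by
  apply Complex.ext <;> simp [dvec] <;> ring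

theorem dvec_sub (m n : Fin 2 → ℤ) : dvec (m - n) = dvec m - dvec n := by
  rw [sub_eq_add_neg, dvec_add, dvec_neg, sub_eq_add_neg]

theorem dvec_zero : dvec 0 = 0 := by
  apply Complex.ext <;> simp [dvec]

theorem latBasis_apply (i : Fin 2) : latBasis i = gens i := by
  simp [latBasis]

theorem re_gens_mul_conj_dvec (i : Fin 2) (n : Fin 2 → ℤ) :
    (gens i * conj (dvec n)).re = 2 * Real.pi * n i := by
  have h3 : Real.sqrt 3 ≠ 0 := by positivity
  fin_cases i
  · simp [gens_zero, dvec]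
    field_simp
    ring
  · simp [gens_one, dvec]
    field_simp
    ring

/-- Coordinates with respect to the generators of `Γ`. -/
theorem sum_repr (z : ℂ) :
    (latBasis.repr z 0 : ℂ) * gens 0 + (latBasis.repr z 1 : ℂ) * gens 1 = z := by
  conv_rhs => rw [← latBasis.sum_repr z]
  simp [Fin.sum_univ_two, latBasis_apply]

theorem re_mul_conj_dvec (z : ℂ) (n : Fin 2 → ℤ) :
    (z * conj (dvec n)).re = 2 * Real.pi * (n 0 * latBasis.repr z 0 + n 1 * latBasis.repr z 1) := by
  conv_lhs => rw [← sum_repr z]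
  rw [add_mul, Complex.add_re, mul_assoc, mul_assoc, Complex.re_ofReal_mul, Complex.re_ofReal_mul,
    re_gens_mul_conj_dvec, re_gens_mul_conj_dvec]
  ring

theorem latVec_eq (m n : ℤ) : latVec m n = m * gens 0 + n * gens 1 := by
  simp [gens, latVec]; ring

theorem moireVec_eq (m n : ℤ) : moireVec m n = (m * gens 0 + n * gens 1) / 3 := by
  simp [gens, latVec, moireVec]; ring

theorem mem_span_iff {z : ℂ} :
    z ∈ Submodule.span ℤ (Set.range latBasis) ↔ ∃ m n : ℤ, latVec m n = z := by
  rw [Submodule.mem_span_range_iff_exists_fun]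
  constructor
  · rintro ⟨c, rfl⟩
    exact ⟨c 0, c 1, by simp [latVec_eq, Fin.sum_univ_two, latBasis_apply]⟩
  · rintro ⟨m, n, rfl⟩
    exact ⟨![m, n], by simp [latVec_eq, Fin.sum_univ_two, latBasis_apply]⟩

theorem dvec_injective : Function.Injective dvec := by
  intro m n h
  ext i
  have h1 := re_gens_mul_conj_dvec i m
  rw [h, re_gens_mul_conj_dvec i n] at h1
  have := mul_left_cancel₀ (by positivity) h1
  exact_mod_cast this.symm

theorem mem_dualLattice_iff {k : ℂ} : k ∈ dualLattice ↔ ∃ n, dvec n = k := by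
  constructor
  · intro h
    obtain ⟨a, ha⟩ := h 1 0
    obtain ⟨b, hb⟩ := h 0 1
    refine ⟨![a, b], ?_⟩
    have key : ∀ i : Fin 2, (gens i * conj (dvec ![a, b] - k)).re = 0 := by
      intro i
      rw [map_sub, mul_sub, Complex.sub_re, re_gens_mul_conj_dvec]
      fin_cases i
      · simp [latVec_eq] at ha ⊢
        linarith
      · simp [latVec_eq] at hb ⊢
        linarith
    -- The generators span `ℂ` over `ℝ`, so the difference is orthogonal to everything, itself
    -- included.
    have h0 : ∀ z : ℂ, (z * conj (dvec ![a, b] - k)).re = 0 := by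
      intro z
      rw [← sum_repr z, add_mul, Complex.add_re, mul_assoc, mul_assoc, Complex.re_ofReal_mul,
        Complex.re_ofReal_mul, key, key]
      simp
    have h1 := h0 (dvec ![a, b] - k)
    rw [Complex.mul_conj, Complex.ofReal_re, Complex.normSq_eq_zero] at h1
    exact sub_eq_zero.1 h1
  · rintro ⟨n, rfl⟩ a b
    refine ⟨a * n 0 + b * n 1, ?_⟩
    rw [latVec_eq, add_mul, Complex.add_re, mul_assoc, mul_assoc]
    have h0 := re_gens_mul_conj_dvec 0 n
    have h1 := re_gens_mul_conj_dvec 1 n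
    rw [show ((a : ℂ)) = ((a : ℝ) : ℂ) by simp, show ((b : ℂ)) = ((b : ℝ) : ℂ) by simp,
      Complex.re_ofReal_mul, Complex.re_ofReal_mul, h0, h1]
    push_cast
    ring

/-- The rotation by `2π/3` of the dual lattice, in coordinates. -/
def rot (n : Fin 2 → ℤ) : Fin 2 → ℤ := ![-n 0 - n 1, n 0]

theorem dvec_rot (n : Fin 2 → ℤ) : dvec (rot n) = omega * dvec n := by
  have h3 : Real.sqrt 3 * Real.sqrt 3 = 3 := Real.mul_self_sqrt (by norm_num)
  have h30 : Real.sqrt 3 ≠ 0 := by positivity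
  rw [omega_eq]
  apply Complex.ext
  · simp [dvec, rot]
    field_simp
    linear_combination (-(n 0 : ℝ) - n 1) * h3
  · simp [dvec, rot]
    field_simp
    ring

theorem omega_pow_three : omega ^ 3 = 1 := by
  rw [omega, ← Complex.exp_nat_mul]
  convert Complex.exp_two_pi_mul_I using 2
  push_cast
  ring

theorem omega_ne_zero : omega ≠ 0 := Complex.exp_ne_zero _

theorem norm_omega : ‖omega‖ = 1 := by
  have : (2 * Real.pi * Complex.I / 3 : ℂ) = ((2 * Real.pi / 3 : ℝ) : ℂ) * Complex.I := by
    push_cast; ring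
  rw [omega, this, Complex.norm_exp_ofReal_mul_I]

theorem conj_omega : conj omega = omega⁻¹ := by
  rw [Complex.inv_def, Complex.normSq_eq_norm_sq, norm_omega]
  simp

theorem conj_omega_eq_sq : conj omega = omega ^ 2 := by
  rw [conj_omega]
  exact inv_eq_of_mul_eq_one_right (by rw [← omega_pow_three]; ring)

theorem one_add_omega_add_sq : 1 + omega + omega ^ 2 = 0 := by
  rw [← conj_omega_eq_sq, omega_eq]
  apply Complex.ext <;> simp
  norm_num

theorem omega_ne_one : omega ≠ 1 := by
  rw [omega_eq]
  intro h
  have := congrArg Complex.re h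
  norm_num at this

theorem omega_zpow_eq_one_iff (n : ℤ) : omega ^ n = 1 ↔ (3 : ℤ) ∣ n := by
  constructor
  · intro h
    have hp : IsPrimitiveRoot omega 3 := by
      rw [omega]
      have := Complex.isPrimitiveRoot_exp 3 (by norm_num)
      exact_mod_cast this
    exact_mod_cast (hp.zpow_eq_one_iff_dvd n).1 h
  · rintro ⟨m, rfl⟩
    rw [zpow_mul]
    have : omega ^ (3 : ℤ) = 1 := by exact_mod_cast omega_pow_three
    rw [this, one_zpow]

/-- The character `z ↦ exp(i Re(z κ̄))` of `ℂ/Γ`, where `κ = dvec n`. -/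
def ch (n : Fin 2 → ℤ) (z : ℂ) : ℂ := Complex.exp (((z * conj (dvec n)).re : ℝ) * Complex.I)

theorem ch_add_arg (n : Fin 2 → ℤ) (z w : ℂ) : ch n (z + w) = ch n z * ch n w := by
  simp only [ch, ← Complex.exp_add, add_mul, Complex.add_re, Complex.ofReal_add]

theorem ch_add (m n : Fin 2 → ℤ) (z : ℂ) : ch (m + n) z = ch m z * ch n z := by
  simp only [ch, ← Complex.exp_add, dvec_add, map_add, mul_add, Complex.add_re,
    Complex.ofReal_add, add_mul]

theorem ch_zero (z : ℂ) : ch 0 z = 1 := by simp [ch, dvec_zero]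

theorem norm_ch (n : Fin 2 → ℤ) (z : ℂ) : ‖ch n z‖ = 1 := Complex.norm_exp_ofReal_mul_I _

theorem conj_ch (n : Fin 2 → ℤ) (z : ℂ) : conj (ch n z) = ch (-n) z := by
  rw [ch, ch, ← Complex.exp_conj, dvec_neg]
  congr 1
  simp
  ring

theorem ch_latVec (n : Fin 2 → ℤ) (a b : ℤ) : ch n (latVec a b) = 1 := by
  obtain ⟨l, hl⟩ := mem_dualLattice_iff.2 ⟨n, rfl⟩ a b
  rw [ch, hl]
  convert Complex.exp_int_mul_two_pi_mul_I l using 2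
  push_cast
  ring

theorem ch_periodic (n : Fin 2 → ℤ) (a b : ℤ) (z : ℂ) : ch n (z + latVec a b) = ch n z := by
  rw [ch_add_arg, ch_latVec, mul_one]

theorem ch_moireVec (n : Fin 2 → ℤ) (a b : ℤ) :
    ch n (moireVec a b) = omega ^ (a * n 0 + b * n 1) := by
  rw [omega, ← Complex.exp_int_mul, ch, moireVec_eq]
  have h0 := re_gens_mul_conj_dvec 0 n
  have h1 := re_gens_mul_conj_dvec 1 n
  have h : ((a * gens 0 + b * gens 1) / 3 * conj (dvec n)).re
      = 2 * Real.pi / 3 * (a * n 0 + b * n 1) := by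
    rw [show (a * gens 0 + b * gens 1) / 3 * conj (dvec n) =
      ((a / 3 : ℝ) : ℂ) * (gens 0 * conj (dvec n)) + ((b / 3 : ℝ) : ℂ) * (gens 1 * conj (dvec n)) by
        push_cast; ring, Complex.add_re, Complex.re_ofReal_mul, Complex.re_ofReal_mul, h0, h1]
    ring
  rw [h]
  congr 1
  push_cast
  ring

theorem ch_omega_mul (n : Fin 2 → ℤ) (z : ℂ) : ch (rot n) (omega * z) = ch n z := by
  rw [ch, ch, dvec_rot, map_mul, conj_omega]
  have := omega_ne_zero
  rw [show omega * z * (omega⁻¹ * conj (dvec n)) = z * conj (dvec n) by field_simp]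

theorem contDiff_ch (n : Fin 2 → ℤ) : ContDiff ℝ ∞ (ch n) := by
  unfold ch
  have h : ContDiff ℝ ∞ fun z : ℂ => (((z * conj (dvec n)).re : ℝ) : ℂ) :=
    Complex.ofRealCLM.contDiff.comp (Complex.reCLM.contDiff.comp (contDiff_id.mul contDiff_const))
  exact (h.mul contDiff_const).cexp

theorem continuous_ch (n : Fin 2 → ℤ) : Continuous (ch n) := (contDiff_ch n).continuous

theorem fderiv_ch (n : Fin 2 → ℤ) (z v : ℂ) :
    fderiv ℝ (ch n) z v = Complex.I * ((v * conj (dvec n)).re : ℝ) * ch n z := by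
  have h1 : HasFDerivAt (fun z : ℂ => (((z * conj (dvec n)).re : ℝ) : ℂ) * Complex.I)
      (((Complex.I • ((Complex.ofRealCLM ∘L Complex.reCLM) ∘L
        ((conj (dvec n)) • ContinuousLinearMap.id ℝ ℂ))) : ℂ →L[ℝ] ℂ)) z := by
    have := ((Complex.I • ((Complex.ofRealCLM ∘L Complex.reCLM) ∘L
        ((conj (dvec n)) • ContinuousLinearMap.id ℝ ℂ))) : ℂ →L[ℝ] ℂ).hasFDerivAt (x := z)
    convert this using 1
    ext w
    simp [mul_comm]
  have h2 := h1.cexp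
  have h3 : fderiv ℝ (ch n) z = _ := h2.fderiv
  rw [h3]
  simp [ch, mul_comm, mul_left_comm]

/-! ### Integrals of periodic functions over the cell -/

/-- The lattice `Γ` as a subgroup of `ℂ`. -/
abbrev lat : Submodule ℤ ℂ := Submodule.span ℤ (Set.range latBasis)

theorem measurableSet_cell : MeasurableSet cell := ZSpan.fundamentalDomain_measurableSet latBasis

instance : IsFiniteMeasure cellMeasure where
  measure_univ_lt_top := by
    rw [cellMeasure, Measure.restrict_apply_univ]
    exact (ZSpan.fundamentalDomain_isBounded latBasis).measure_lt_top

theorem ae_cell_iff {P : ℂ → Prop} : (∀ᵐ z ∂cellMeasure, P z) ↔ ∀ᵐ z : ℂ, z ∈ cell → P z :=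
  ae_restrict_iff' measurableSet_cell

theorem isFD_cell : IsAddFundamentalDomain lat cell (volume : Measure ℂ) :=
  ZSpan.isAddFundamentalDomain latBasis volume

instance : Countable lat := inferInstanceAs (Countable (Submodule.span ℤ (Set.range latBasis)))

instance : VAddInvariantMeasure lat ℂ (volume : Measure ℂ) :=
  inferInstanceAs (VAddInvariantMeasure lat.toAddSubgroup ℂ volume)

theorem invariant_of_periodic {α : Type*} {f : ℂ → α}
    (hf : ∀ (m n : ℤ) (z : ℂ), f (z + latVec m n) = f z) (g : lat) (x : ℂ) :
    f (g +ᵥ x) = f x := by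
  obtain ⟨m, n, h⟩ := mem_span_iff.1 g.2
  rw [Submodule.vadd_def, vadd_eq_add, add_comm, ← h, hf]

/-- Translations and rotations by `ω` preserve integrals of periodic functions over the cell. -/
structure IsCellSymm (A : ℂ → ℂ) : Prop where
  emb : MeasurableEmbedding A
  pres : MeasurePreserving A volume volume
  equi : ∃ e : lat → lat, Function.Bijective e ∧ ∀ (g : lat) (x : ℂ), A (e g +ᵥ x) = g +ᵥ A x

/-- `A` intertwines the action of `Γ` with itself up to the bijection `e`, so it pulls fundamental
domains back to fundamental domains; periodic integrands do not see the difference. -/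
theorem IsCellSymm.isFD {A : ℂ → ℂ} (hA : IsCellSymm A) :
    IsAddFundamentalDomain lat (A ⁻¹' cell) (volume : Measure ℂ) := by
  obtain ⟨e, he, h⟩ := hA.equi
  exact isFD_cell.preimage_of_equiv hA.pres.quasiMeasurePreserving he fun g x => h g x

theorem IsCellSymm.integral_comp {E : Type*} [NormedAddCommGroup E] [NormedSpace ℝ E]
    {A : ℂ → ℂ} (hA : IsCellSymm A) {f : ℂ → E}
    (hf : ∀ (m n : ℤ) (z : ℂ), f (z + latVec m n) = f z) :
    ∫ z, f (A z) ∂cellMeasure = ∫ z, f z ∂cellMeasure := by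
  have h1 : ∫ z in cell, f (A z) = ∫ z in A ⁻¹' cell, f (A z) := by
    refine isFD_cell.setIntegral_eq hA.isFD fun g x => ?_
    obtain ⟨e, he, h⟩ := hA.equi
    obtain ⟨g', rfl⟩ := he.2 g
    rw [h, invariant_of_periodic hf]
  rw [cellMeasure, h1]
  exact hA.pres.setIntegral_preimage_emb hA.emb f cell

theorem isCellSymm_add (a : ℂ) : IsCellSymm fun z => z + a where
  emb := measurableEmbedding_addRight a
  pres := measurePreserving_add_right volume a
  equi := ⟨id, Function.bijective_id, fun g x => by
    simp only [id, Submodule.vadd_def, vadd_eq_add, add_assoc]⟩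

theorem omega_mul_mem_lat {z : ℂ} (hz : z ∈ lat) : omega * z ∈ lat := by
  obtain ⟨m, n, rfl⟩ := mem_span_iff.1 hz
  refine mem_span_iff.2 ⟨-n, m - n, ?_⟩
  simp only [latVec]
  push_cast
  linear_combination (-(4 * Real.pi * Complex.I * n) : ℂ) *
    (omega * one_add_omega_add_sq)

theorem isCellSymm_omega : IsCellSymm fun z => omega * z where
  emb := (measurableEmbedding_mulLeft₀ omega_ne_zero)
  pres := by
    let L : ℂ ≃ₗᵢ[ℝ] ℂ := rotation ⟨omega, by simp [Submonoid.unitSphere, norm_omega]⟩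
    exact L.measurePreserving
  equi := by
    -- Here `e` is multiplication by `ω² = ω⁻¹`, since `ω (ω² g + x) = g + ω x`.
    refine ⟨fun g => ⟨omega * (omega * g), omega_mul_mem_lat (omega_mul_mem_lat g.2)⟩, ⟨?_, ?_⟩, ?_⟩
    · intro g h hgh
      have := congrArg Subtype.val hgh
      simp only at this
      exact Subtype.ext (mul_left_cancel₀ omega_ne_zero (mul_left_cancel₀ omega_ne_zero this))
    · intro g
      refine ⟨⟨omega * g, omega_mul_mem_lat g.2⟩, Subtype.ext ?_⟩
      change omega * (omega * (omega * (g : ℂ))) = g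
      linear_combination (g : ℂ) * omega_pow_three
    · intro g x
      simp only [Submodule.vadd_def, vadd_eq_add]
      linear_combination (g : ℂ) * omega_pow_three

/-- The representative in the cell of the class of `z` modulo `Γ`. -/
def red (z : ℂ) : ℂ := ZSpan.fract latBasis z

theorem red_mem (z : ℂ) : red z ∈ cell := ZSpan.fract_mem_fundamentalDomain latBasis z

theorem red_eq_self {z : ℂ} (hz : z ∈ cell) : red z = z := ZSpan.fract_eq_self.2 hz

theorem exists_red_eq (z : ℂ) : ∃ m n : ℤ, red z = z + latVec m n := by
  obtain ⟨m, n, h⟩ := mem_span_iff.1 (neg_mem (ZSpan.floor latBasis z).2)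
  exact ⟨m, n, by rw [h, red, ZSpan.fract_apply, sub_eq_add_neg]⟩

theorem red_periodic (m n : ℤ) (z : ℂ) : red (z + latVec m n) = red z :=
  ZSpan.fract_add_ZSpan latBasis z (mem_span_iff.2 ⟨m, n, rfl⟩)

theorem measurable_red : Measurable red := by
  have h : red = fun z => ∑ i, (Int.fract (latBasis.repr z i) : ℝ) • latBasis i := by
    ext1 z
    conv_lhs => rw [← latBasis.sum_repr (red z)]
    simp only [red, ZSpan.repr_fract_apply]
  rw [h]
  refine Finset.measurable_sum _ fun i _ => ?_
  have h1 : Measurable fun z => latBasis.repr z i :=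
    (LinearMap.continuous_of_finiteDimensional
      ((latBasis.coord i : ℂ →ₗ[ℝ] ℝ))).measurable
  exact (measurable_fract.comp h1).smul_const _

/-- `red ∘ A` is the map that `A` induces on the torus. The preimage of `s` is `Γ`-invariant, so it
has the same measure in `cell` as in the fundamental domain `A ⁻¹' cell`. -/
theorem IsCellSymm.measurePreserving_red {A : ℂ → ℂ} (hA : IsCellSymm A) :
    MeasurePreserving (fun z => red (A z)) cellMeasure cellMeasure := by
  have hm : Measurable fun z => red (A z) := measurable_red.comp hA.pres.measurable
  refine ⟨hm, ?_⟩
  ext s hs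
  rw [Measure.map_apply hm hs, cellMeasure, Measure.restrict_apply (hm hs),
    Measure.restrict_apply hs]
  have hP : MeasurableSet (red ⁻¹' s) := measurable_red hs
  have h1 : volume ((fun z => red (A z)) ⁻¹' s ∩ cell)
      = volume ((fun z => red (A z)) ⁻¹' s ∩ A ⁻¹' cell) := by
    refine isFD_cell.measure_set_eq hA.isFD (hm hs) fun g => ?_
    ext x
    simp only [Set.mem_preimage]
    obtain ⟨e, he, h⟩ := hA.equi
    obtain ⟨g', rfl⟩ := he.2 g
    rw [h, invariant_of_periodic red_periodic]
  rw [h1]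
  change volume (A ⁻¹' (red ⁻¹' s ∩ cell)) = _
  rw [hA.pres.measure_preimage (hP.inter measurableSet_cell).nullMeasurableSet]
  congr 1
  ext z
  simp only [Set.mem_inter_iff, Set.mem_preimage, and_congr_left_iff]
  intro hz
  rw [red_eq_self hz]

theorem integrable_of_continuous {E : Type*} [NormedAddCommGroup E] {f : ℂ → E} [SecondCountableTopology E]
    (hf : Continuous f) : Integrable f cellMeasure := by
  have hb : Bornology.IsBounded cell := ZSpan.fundamentalDomain_isBounded latBasis
  exact (hf.continuousOn.integrableOn_compact hb.isCompact_closure).mono_set subset_closure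

/-- The integral of `ψ (z + t v)` over the cell does not depend on `t`; differentiate at `t = 0`
under the integral sign. -/
theorem integral_fderiv_eq_zero {ψ : ℂ → ℂ} (hψ : ContDiff ℝ 1 ψ)
    (hper : ∀ (m n : ℤ) (z : ℂ), ψ (z + latVec m n) = ψ z) (v : ℂ) :
    ∫ z, fderiv ℝ ψ z v ∂cellMeasure = 0 := by
  have hc : Continuous fun z => fderiv ℝ ψ z v :=
    (hψ.continuous_fderiv one_ne_zero).clm_apply continuous_const
  have hb : Bornology.IsBounded cell := ZSpan.fundamentalDomain_isBounded latBasis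
  obtain ⟨C, hC⟩ := ((hb.isCompact_closure.prod (isCompact_Icc (a := (-1 : ℝ)) (b := 1))).image
    (f := fun q : ℂ × ℝ => q.1 + q.2 • v) (by fun_prop)).exists_bound_of_continuousOn hc.continuousOn
  have key := hasDerivAt_integral_of_dominated_loc_of_deriv_le (μ := cellMeasure)
    (F := fun (t : ℝ) z => ψ (z + t • v)) (F' := fun t z => fderiv ℝ ψ (z + t • v) v) (x₀ := 0)
    (s := Metric.ball 0 1) (bound := fun _ => C) (Metric.ball_mem_nhds _ one_pos)
    (Eventually.of_forall fun t => (integrable_of_continuous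
      (hψ.continuous.comp (by fun_prop))).aestronglyMeasurable)
    (integrable_of_continuous (hψ.continuous.comp (by fun_prop)))
    (hc.comp (by fun_prop : Continuous fun z : ℂ => z + (0 : ℝ) • v)).aestronglyMeasurable
    ?_ (integrable_const _) ?_
  · have h2 : (fun t : ℝ => ∫ z, ψ (z + t • v) ∂cellMeasure)
        = fun _ => ∫ z, ψ z ∂cellMeasure := by
      ext1 t
      exact (isCellSymm_add (t • v)).integral_comp hper
    have h3 := key.2
    rw [h2] at h3
    have h4 := h3.unique (hasDerivAt_const (0 : ℝ) _)
    simpa using h4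
  · rw [ae_cell_iff]
    refine Eventually.of_forall fun z hz t ht => hC _ ?_
    refine ⟨(z, t), ⟨subset_closure hz, ?_⟩, rfl⟩
    rw [Metric.mem_ball, dist_zero_right, Real.norm_eq_abs, abs_lt] at ht
    exact ⟨ht.1.le, ht.2.le⟩
  · refine Eventually.of_forall fun z t _ => ?_
    have h1 : HasFDerivAt ψ (fderiv ℝ ψ (z + t • v)) (z + t • v) :=
      (hψ.differentiable one_ne_zero _).hasFDerivAt
    have h2 : HasDerivAt (fun t : ℝ => z + t • v) v t := by
      simpa using ((hasDerivAt_id t).smul_const v).const_add z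
    exact h1.comp_hasDerivAt t h2

section

/-! ### The Fourier basis of `L²(ℂ/Γ)` -/

/-- Differentiating in the direction `dvec n` multiplies the character by `i ‖dvec n‖² ≠ 0`, and
derivatives integrate to zero. -/
theorem integral_ch_eq_zero {n : Fin 2 → ℤ} (hn : n ≠ 0) : ∫ z, ch n z ∂cellMeasure = 0 := by
  have hd : dvec n ≠ 0 := fun h => hn (dvec_injective (h.trans dvec_zero.symm))
  have h := integral_fderiv_eq_zero ((contDiff_ch n).of_le (by exact_mod_cast le_top))
    (ch_periodic n) (dvec n)
  simp_rw [fderiv_ch] at h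
  rw [integral_const_mul] at h
  refine (mul_eq_zero.1 h).resolve_left (mul_ne_zero Complex.I_ne_zero ?_)
  rw [Complex.mul_conj, Complex.ofReal_re, Ne, Complex.ofReal_eq_zero, Complex.normSq_eq_zero]
  exact hd

local instance : MeasureSpace UnitAddCircle := ⟨AddCircle.haarAddCircle⟩

/-- The coordinates of `z` as a point of the standard torus. -/
def toTorus (z : ℂ) : UnitAddTorus (Fin 2) := fun i => (latBasis.repr z i : UnitAddCircle)

/-- The representative in the cell of a point of the standard torus. -/
def ofTorus (t : UnitAddTorus (Fin 2)) : ℂ :=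
  latBasis.equivFun.symm fun i => ((AddCircle.equivIco 1 0 (t i)) : ℝ)

theorem ofTorus_toTorus {z : ℂ} (hz : z ∈ cell) : ofTorus (toTorus z) = z := by
  rw [ofTorus, LinearEquiv.symm_apply_eq]
  ext i
  have h1 := ZSpan.mem_fundamentalDomain latBasis |>.1 hz i
  simp only [toTorus, Module.Basis.equivFun_apply]
  rw [AddCircle.coe_equivIco_mk_apply]
  simp only [div_one, mul_one]
  exact Int.fract_eq_self.2 h1

theorem measurable_ofTorus : Measurable ofTorus := by
  have h1 : Continuous latBasis.equivFun.symm :=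
    LinearMap.continuous_of_finiteDimensional (latBasis.equivFun.symm : (Fin 2 → ℝ) →ₗ[ℝ] ℂ)
  refine h1.measurable.comp (measurable_pi_lambda _ fun i => ?_)
  exact measurable_subtype_coe.comp
    ((AddCircle.measurableEquivIco 1 0).measurable.comp (measurable_pi_apply i))

theorem measurable_toTorus : Measurable toTorus := by
  refine measurable_pi_lambda _ fun i => ?_
  have h1 : Measurable fun z => latBasis.repr z i :=
    (LinearMap.continuous_of_finiteDimensional
      ((latBasis.coord i : ℂ →ₗ[ℝ] ℝ))).measurable
  exact AddCircle.measurable_mk'.comp h1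

theorem map_coe_box : Measure.map (fun (x : Fin 2 → ℝ) => (fun i => x i : UnitAddTorus (Fin 2)))
    (volume.restrict (Set.pi Set.univ fun _ => Set.Ico 0 1)) = volume := by
  have hm : Measurable (fun (x : Fin 2 → ℝ) => (fun i => x i : UnitAddTorus (Fin 2))) :=
    measurable_pi_lambda _ fun i => AddCircle.measurable_mk'.comp (measurable_pi_apply i)
  -- The cell corresponds to half-open boxes `Ico`, the torus formula to `Ioc`; they differ by a
  -- null set.
  have hae : (Set.pi Set.univ fun _ => Set.Ico 0 1 : Set (Fin 2 → ℝ)) =ᵐ[volume]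
      {x : Fin 2 → ℝ | ∀ i, x i ∈ Set.Ioc ((0 : Fin 2 → ℝ) i) ((0 : Fin 2 → ℝ) i + 1)} := by
    have h1 := Measure.univ_pi_Ico_ae_eq_Icc (μ := fun _ : Fin 2 => (volume : Measure ℝ))
      (f := fun _ => 0) (g := fun _ => 1)
    have h2 := Measure.univ_pi_Ioc_ae_eq_Icc (μ := fun _ : Fin 2 => (volume : Measure ℝ))
      (f := fun _ => 0) (g := fun _ => 1)
    have h3 := h1.trans h2.symm
    have h4 : {x : Fin 2 → ℝ | ∀ i, x i ∈ Set.Ioc ((0 : Fin 2 → ℝ) i) ((0 : Fin 2 → ℝ) i + 1)}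
        = Set.pi Set.univ fun _ => Set.Ioc 0 1 := by
      ext x; simp
    rw [h4]
    exact h3
  rw [Measure.restrict_congr_set hae]
  ext s hs
  have h := UnitAddTorus.lintegral_preimage (s.indicator 1) (0 : Fin 2 → ℝ)
  rw [lintegral_indicator_one hs] at h
  rw [h, ← lintegral_indicator_one (μ := Measure.map _ _) hs,
    lintegral_map (measurable_one.indicator hs) hm]

/-- Linear coordinates carry Lebesgue measure to a Haar measure on `ℝ²`. Only finiteness and
positivity of the constant matter, so the Jacobian is never computed. -/
theorem exists_map_toTorus : ∃ c : ENNReal, c ≠ 0 ∧ c ≠ ⊤ ∧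
    Measure.map toTorus cellMeasure = c • volume := by
  let L : ℂ ≃L[ℝ] (Fin 2 → ℝ) := latBasis.equivFun.toContinuousLinearEquiv
  have hL : ∀ z i, L z i = latBasis.repr z i := fun z i => by
    simp [L]
  have hmu : Measure.IsAddHaarMeasure (Measure.map L (volume : Measure ℂ)) :=
    ContinuousLinearEquiv.isAddHaarMeasure_map L volume
  have h1 := Measure.isAddLeftInvariant_eq_smul (Measure.map L (volume : Measure ℂ))
    (volume : Measure (Fin 2 → ℝ))
  set c := Measure.addHaarScalarFactor (Measure.map L (volume : Measure ℂ))
    (volume : Measure (Fin 2 → ℝ)) with hc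
  have hcell : cell = L ⁻¹' (Set.pi Set.univ fun _ => Set.Ico 0 1) := by
    ext z
    simp only [cell, ZSpan.mem_fundamentalDomain, Set.mem_preimage, Set.mem_pi, Set.mem_univ,
      true_imp_iff, hL]
  have hbox : MeasurableSet (Set.pi Set.univ fun _ => Set.Ico 0 1 : Set (Fin 2 → ℝ)) :=
    MeasurableSet.univ_pi fun _ => measurableSet_Ico
  have hmL : Measurable L := L.continuous.measurable
  have h2 : Measure.map L cellMeasure
      = (c : ENNReal) • volume.restrict (Set.pi Set.univ fun _ => Set.Ico 0 1) := by
    rw [cellMeasure, hcell, ← Measure.restrict_map hmL hbox, h1, Measure.restrict_smul]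
    rfl
  have hm : Measurable (fun (x : Fin 2 → ℝ) => (fun i => x i : UnitAddTorus (Fin 2))) :=
    measurable_pi_lambda _ fun i => AddCircle.measurable_mk'.comp (measurable_pi_apply i)
  refine ⟨c, ?_, ENNReal.coe_ne_top, ?_⟩
  · intro h0
    rw [ENNReal.coe_eq_zero] at h0
    exact (Measure.addHaarScalarFactor_pos_of_isAddHaarMeasure _ _).ne' h0
  · have h3 : toTorus = (fun (x : Fin 2 → ℝ) => (fun i => x i : UnitAddTorus (Fin 2))) ∘ L := by
      ext z i
      simp [toTorus, hL]
    rw [h3, ← Measure.map_map hm hmL, h2, Measure.map_smul, map_coe_box]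

theorem ch_eq_mFourier (n : Fin 2 → ℤ) (z : ℂ) : ch n z = UnitAddTorus.mFourier n (toTorus z) := by
  rw [ch, re_mul_conj_dvec]
  simp only [UnitAddTorus.mFourier, toTorus, ContinuousMap.coe_mk, Fin.prod_univ_two,
    fourier_coe_apply, ← Complex.exp_add]
  congr 1
  push_cast
  ring

/-- Completeness of the characters, transported from the Fourier basis of the standard torus through
`ofTorus`. -/
theorem ae_eq_zero_of_integral_ch {f : ℂ → ℂ} (hf : MemLp f 2 cellMeasure)
    (hfm : StronglyMeasurable f) (h : ∀ n, ∫ z, ch n z * f z ∂cellMeasure = 0) :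
    f =ᵐ[cellMeasure] 0 := by
  obtain ⟨c, hc0, hct, hmap⟩ := exists_map_toTorus
  set g : UnitAddTorus (Fin 2) → ℂ := f ∘ ofTorus with hg
  have hgm : StronglyMeasurable g := hfm.comp_measurable measurable_ofTorus
  have hfg : f =ᵐ[cellMeasure] g ∘ toTorus := by
    rw [EventuallyEq, ae_cell_iff]
    refine Eventually.of_forall fun z hz => ?_
    simp [hg, ofTorus_toTorus hz]
  have hgL : MemLp g 2 (volume : Measure (UnitAddTorus (Fin 2))) := by
    have h1 : MemLp g 2 (Measure.map toTorus cellMeasure) := by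
      rw [memLp_map_measure_iff hgm.aestronglyMeasurable measurable_toTorus.aemeasurable]
      exact hf.ae_eq hfg
    rw [hmap] at h1
    have h2 := h1.smul_measure (c := c⁻¹) (ENNReal.inv_ne_top.2 hc0)
    rwa [smul_smul, ENNReal.inv_mul_cancel hc0 hct, one_smul] at h2
  have hcoef : UnitAddTorus.mFourierBasis.repr (hgL.toLp g) = 0 := by
    ext n
    rw [UnitAddTorus.mFourierBasis_repr]
    have h1 : ∫ t, UnitAddTorus.mFourier (-n) t * g t ∂(Measure.map toTorus cellMeasure) = 0 := by
      rw [integral_map measurable_toTorus.aemeasurable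
        (Measurable.aestronglyMeasurable (f := fun t => UnitAddTorus.mFourier (-n) t * g t)
          ((UnitAddTorus.mFourier (-n)).continuous.measurable.mul hgm.measurable)),
        ← h (-n)]
      refine integral_congr_ae ?_
      filter_upwards [hfg] with z hz
      rw [ch_eq_mFourier, hz]
      rfl
    rw [hmap, integral_smul_measure] at h1
    have h2 : c.toReal ≠ 0 := (ENNReal.toReal_pos hc0 hct).ne'
    have h3 := (smul_eq_zero.1 h1).resolve_left h2
    rw [UnitAddTorus.mFourierCoeff, lp.coeFn_zero, Pi.zero_apply, ← h3]
    refine integral_congr_ae ?_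
    filter_upwards [hgL.coeFn_toLp] with t ht
    rw [ht, smul_eq_mul]
  have hg0 : g =ᵐ[volume] 0 := by
    have h1 : hgL.toLp g = 0 := by
      rw [← map_zero UnitAddTorus.mFourierBasis.repr] at hcoef
      exact UnitAddTorus.mFourierBasis.repr.injective hcoef
    have h2 := hgL.coeFn_toLp
    rw [h1] at h2
    exact h2.symm.trans (Lp.coeFn_zero _ _ _)
  have hg1 : g =ᵐ[Measure.map toTorus cellMeasure] 0 := by
    rw [hmap]
    exact Measure.ae_smul_measure hg0 c
  exact hfg.trans (ae_eq_comp measurable_toTorus.aemeasurable hg1)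

/-- The area of the cell. -/
def area : ℝ := cellMeasure.real Set.univ

theorem area_pos : 0 < area := by
  rw [area, cellMeasure, measureReal_restrict_apply_univ]
  exact ENNReal.toReal_pos (ZSpan.measure_fundamentalDomain_ne_zero latBasis)
    (ZSpan.fundamentalDomain_isBounded latBasis).measure_lt_top.ne

theorem memLp_of_continuous {f : ℂ → ℂ} (hf : Continuous f) (q : ENNReal) :
    MemLp f q cellMeasure := by
  have hb : Bornology.IsBounded cell := ZSpan.fundamentalDomain_isBounded latBasis
  obtain ⟨C, hC⟩ := hb.isCompact_closure.exists_bound_of_continuousOn hf.continuousOn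
  refine MemLp.of_bound hf.aestronglyMeasurable C ?_
  exact ae_cell_iff.2 (Filter.Eventually.of_forall fun z hz => hC z (subset_closure hz))

/-- The normalized characters. -/
def chLp (n : Fin 2 → ℤ) : L2 ℂ :=
  ((Real.sqrt area)⁻¹ : ℂ) • (memLp_of_continuous (continuous_ch n) 2).toLp

theorem coeFn_chLp (n : Fin 2 → ℤ) :
    chLp n =ᵐ[cellMeasure] fun z => ((Real.sqrt area)⁻¹ : ℂ) * ch n z := by
  filter_upwards [Lp.coeFn_smul ((Real.sqrt area)⁻¹ : ℂ)
    ((memLp_of_continuous (continuous_ch n) 2).toLp),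
    (memLp_of_continuous (continuous_ch n) 2).coeFn_toLp] with z h1 h2
  rw [chLp, h1, Pi.smul_apply, h2, smul_eq_mul]

theorem inner_chLp (n : Fin 2 → ℤ) (u : L2 ℂ) :
    inner ℂ (chLp n) u = ((Real.sqrt area)⁻¹ : ℂ) * ∫ z, ch (-n) z * u z ∂cellMeasure := by
  rw [L2.inner_def, ← integral_const_mul]
  refine integral_congr_ae ?_
  filter_upwards [coeFn_chLp n] with z hz
  rw [hz, RCLike.inner_apply', map_mul, conj_ch, map_inv₀, Complex.conj_ofReal, mul_assoc]

theorem orthonormal_chLp : Orthonormal ℂ chLp := by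
  rw [orthonormal_iff_ite]
  intro m n
  have h : ∫ z, ch (-m) z * chLp n z ∂cellMeasure
      = ((Real.sqrt area)⁻¹ : ℂ) * ∫ z, ch (n - m) z ∂cellMeasure := by
    rw [← integral_const_mul]
    refine integral_congr_ae ?_
    filter_upwards [coeFn_chLp n] with z hz
    rw [hz, sub_eq_neg_add, ch_add]
    ring
  rw [inner_chLp, h]
  split_ifs with hmn
  · subst hmn
    have ha : (area : ℂ) ≠ 0 := by exact_mod_cast area_pos.ne'
    have hs : (Real.sqrt area : ℂ) * Real.sqrt area = area := by
      exact_mod_cast Real.mul_self_sqrt area_pos.le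
    have hs0 : (Real.sqrt area : ℂ) ≠ 0 := by
      intro h0; rw [h0] at hs; simp at hs; exact ha (by simp [← hs])
    simp only [sub_self, ch_zero, integral_const]
    rw [show cellMeasure.real Set.univ = area from rfl]
    field_simp
    simp [sq, hs]
  · rw [integral_ch_eq_zero (sub_ne_zero.2 (Ne.symm hmn)), mul_zero, mul_zero]

/-- The Fourier basis of `L²(ℂ/Γ)`. -/
def fb : HilbertBasis (Fin 2 → ℤ) ℂ (L2 ℂ) :=
  HilbertBasis.mkOfOrthogonalEqBot orthonormal_chLp (by
    rw [Submodule.eq_bot_iff]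
    intro u hu
    have h1 : ∀ n, ∫ z, ch n z * u z ∂cellMeasure = 0 := by
      intro n
      have h2 := (Submodule.mem_orthogonal _ _).1 hu (chLp (-n))
        (Submodule.subset_span ⟨-n, rfl⟩)
      rw [inner_chLp, neg_neg] at h2
      have hs0 : (Real.sqrt area : ℂ) ≠ 0 := by
        exact_mod_cast (Real.sqrt_pos.2 area_pos).ne'
      exact (mul_eq_zero.1 h2).resolve_left (inv_ne_zero hs0)
    exact Lp.eq_zero_iff_ae_eq_zero.2
      (ae_eq_zero_of_integral_ch (Lp.memLp u) (Lp.stronglyMeasurable u) h1))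

theorem fb_apply (n : Fin 2 → ℤ) : fb n = chLp n := by
  rw [fb, HilbertBasis.coe_mkOfOrthogonalEqBot]

/-- The Fourier coefficients of `u`. -/
def fc (u : L2 ℂ) (n : Fin 2 → ℤ) : ℂ := fb.repr u n

theorem fc_eq_inner (u : L2 ℂ) (n : Fin 2 → ℤ) : fc u n = inner ℂ (fb n) u :=
  fb.repr_apply_apply u n

theorem fc_eq_integral (u : L2 ℂ) (n : Fin 2 → ℤ) :
    fc u n = ((Real.sqrt area)⁻¹ : ℂ) * ∫ z, ch (-n) z * u z ∂cellMeasure := by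
  rw [fc_eq_inner, fb_apply, inner_chLp]

end

/-! ### Fourier coefficients and multipliers -/

theorem fc_ext {u v : L2 ℂ} (h : ∀ n, fc u n = fc v n) : u = v :=
  fb.repr.injective (by ext n; exact h n)

@[simp] theorem fc_add (u v : L2 ℂ) (n) : fc (u + v) n = fc u n + fc v n := by simp [fc]
@[simp] theorem fc_sub (u v : L2 ℂ) (n) : fc (u - v) n = fc u n - fc v n := by simp [fc]
@[simp] theorem fc_neg (u : L2 ℂ) (n) : fc (-u) n = -fc u n := by simp [fc]
@[simp] theorem fc_smul (c : ℂ) (u : L2 ℂ) (n) : fc (c • u) n = c * fc u n := by simp [fc]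
@[simp] theorem fc_zero (n) : fc 0 n = 0 := by simp [fc]

theorem fc_fb (m n : Fin 2 → ℤ) : fc (fb m) n = if n = m then 1 else 0 := by
  classical
  rw [fc, fb.repr_self, lp.single_apply]
  simp [Pi.single_apply]

/-- The `n`-th Fourier coefficient as a bounded functional. -/
def fcL (n : Fin 2 → ℤ) : L2 ℂ →L[ℂ] ℂ := innerSL ℂ (fb n)

theorem fcL_apply (n) (u : L2 ℂ) : fcL n u = fc u n := by
  rw [fc_eq_inner]; rfl

/-- Bounded maps that agree on the Fourier basis are equal. -/
theorem clm_ext {F : Type*} [NormedAddCommGroup F] [NormedSpace ℂ F] {S T : L2 ℂ →L[ℂ] F}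
    (h : ∀ m, S (fb m) = T (fb m)) : S = T := by
  have hd : Dense (Submodule.span ℂ (Set.range fb) : Set (L2 ℂ)) :=
    Submodule.dense_iff_topologicalClosure_eq_top.2 fb.dense_span
  exact ContinuousLinearMap.ext_on hd (by rintro _ ⟨m, rfl⟩; exact h m)

theorem exists_fc_eq (f : L2 ℂ) {a : (Fin 2 → ℤ) → ℂ} {C : ℝ}
    (h : ∀ n, ‖a n‖ ≤ C * ‖fc f n‖) : ∃ u, ∀ n, fc u n = a n := by
  have h1 : Memℓp (fun n => (C : ℂ) * fc f n) 2 := by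
    have := (lp.memℓp (fb.repr f)).const_smul (C : ℂ)
    exact this
  have h2 : Memℓp a 2 := by
    refine h1.mono' (fun n => ?_)
    refine (h n).trans ?_
    rw [norm_mul, Complex.norm_real]
    exact mul_le_mul_of_nonneg_right (le_abs_self C) (norm_nonneg _)
  exact ⟨fb.repr.symm ⟨a, h2⟩, fun n => by rw [fc, LinearIsometryEquiv.apply_symm_apply]⟩

theorem norm_sq_eq_tsum (u : L2 ℂ) : HasSum (fun n => ‖fc u n‖ ^ 2) (‖u‖ ^ 2) := by
  have h := lp.hasSum_norm (p := 2) (by norm_num) (fb.repr u)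
  simpa [fc] using h

theorem norm_le_of_fc_le {u v : L2 ℂ} {C : ℝ} (hC : 0 ≤ C) (h : ∀ n, ‖fc u n‖ ≤ C * ‖fc v n‖) :
    ‖u‖ ≤ C * ‖v‖ := by
  refine le_of_sq_le_sq ?_ (by positivity)
  rw [mul_pow]
  refine hasSum_le (fun n => ?_) (norm_sq_eq_tsum u) ((norm_sq_eq_tsum v).mul_left (C ^ 2))
  rw [← mul_pow]
  exact pow_le_pow_left₀ (norm_nonneg _) (h n) 2

/-- A bounded symbol. -/
def BddSymbol (m : (Fin 2 → ℤ) → ℂ) : Prop := ∃ C : ℝ, ∀ n, ‖m n‖ ≤ C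

theorem exists_mult {m : (Fin 2 → ℤ) → ℂ} {C : ℝ} (hC : ∀ n, ‖m n‖ ≤ C) :
    ∃ T : L2 ℂ →L[ℂ] L2 ℂ, (∀ u n, fc (T u) n = m n * fc u n) ∧ ‖T‖ ≤ C := by
  have h0 : 0 ≤ C := (norm_nonneg _).trans (hC 0)
  have hb : ∀ u n, ‖m n * fc u n‖ ≤ C * ‖fc u n‖ := fun u n => by
    rw [norm_mul]
    exact mul_le_mul_of_nonneg_right (hC n) (norm_nonneg _)
  choose T hT using fun u => exists_fc_eq u (hb u)
  let L : L2 ℂ →ₗ[ℂ] L2 ℂ :=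
    { toFun := T
      map_add' := fun u v => fc_ext fun n => by simp only [hT, fc_add]; ring
      map_smul' := fun c u => fc_ext fun n => by
        simp only [hT, fc_smul, RingHom.id_apply]; ring }
  refine ⟨L.mkContinuous C fun u => ?_, fun u n => hT u n, L.mkContinuous_norm_le h0 _⟩
  exact norm_le_of_fc_le h0 fun n => (congrArg norm (hT u n)).le.trans (hb u n)

open Classical in
/-- The Fourier multiplier with symbol `m` (zero if `m` is unbounded). -/
def mult (m : (Fin 2 → ℤ) → ℂ) : L2 ℂ →L[ℂ] L2 ℂ :=
  if h : BddSymbol m then (exists_mult h.choose_spec).choose else 0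

theorem fc_mult {m : (Fin 2 → ℤ) → ℂ} (hm : BddSymbol m) (u : L2 ℂ) (n) :
    fc (mult m u) n = m n * fc u n := by
  rw [mult, dif_pos hm]
  exact (exists_mult hm.choose_spec).choose_spec.1 u n

theorem bddSymbol_of_tendsto {m : (Fin 2 → ℤ) → ℂ} (hm : Tendsto m cofinite (𝓝 0)) :
    BddSymbol m := by
  have h1 : ∀ᶠ n in cofinite, ‖m n‖ < 1 := by
    have := (tendsto_zero_iff_norm_tendsto_zero.1 hm).eventually (gt_mem_nhds one_pos)
    exact this
  have hf : {n | ¬ ‖m n‖ < 1}.Finite := h1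
  obtain ⟨C, hC⟩ := (hf.image fun n => ‖m n‖).bddAbove
  refine ⟨max 1 C, fun n => ?_⟩
  by_cases hn : ‖m n‖ < 1
  · exact hn.le.trans (le_max_left _ _)
  · exact (hC ⟨n, hn, rfl⟩).trans (le_max_right _ _)

/-- The finite-rank truncations converge in norm, because the symbol is small outside a finite set.
-/
theorem isCompactOperator_mult {m : (Fin 2 → ℤ) → ℂ} (hm : Tendsto m cofinite (𝓝 0)) :
    IsCompactOperator (mult m) := by
  classical
  let F : Finset (Fin 2 → ℤ) → L2 ℂ →L[ℂ] L2 ℂ := fun s => ∑ n ∈ s, m n •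
    (fcL n).smulRight (fb n)
  have hFc : ∀ s u n, fc (F s u) n = if n ∈ s then m n * fc u n else 0 := by
    intro s u n
    rw [← fcL_apply]
    simp only [F, sum_apply, map_sum, smul_apply,
      ContinuousLinearMap.smulRight_apply, map_smul, fcL_apply, fc_fb, smul_eq_mul]
    split_ifs with h
    · rw [Finset.sum_eq_single n]
      · simp
      · intro b _ hb; simp [Ne.symm hb]
      · exact fun h' => absurd h h'
    · refine Finset.sum_eq_zero fun b hb => ?_
      have : n ≠ b := fun e => h (e ▸ hb)
      simp [this]
  have ht : Tendsto F atTop (𝓝 (mult m)) := by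
    rw [Metric.tendsto_nhds]
    intro ε hε
    have hf : {n | ¬ ‖m n‖ < ε / 2}.Finite :=
      (tendsto_zero_iff_norm_tendsto_zero.1 hm).eventually (gt_mem_nhds (half_pos hε))
    filter_upwards [eventually_ge_atTop hf.toFinset] with s hs
    rw [dist_eq_norm]
    refine lt_of_le_of_lt ?_ (half_lt_self hε)
    refine ContinuousLinearMap.opNorm_le_bound _ (half_pos hε).le fun u =>
      norm_le_of_fc_le (half_pos hε).le fun n => ?_
    rw [sub_apply, fc_sub, hFc, fc_mult (bddSymbol_of_tendsto hm)]
    split_ifs with h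
    · rw [sub_self, norm_zero]; positivity
    · rw [zero_sub, norm_neg, norm_mul]
      refine mul_le_mul_of_nonneg_right ?_ (norm_nonneg _)
      by_contra h'
      exact h (hs (hf.mem_toFinset.2 fun h'' => h' h''.le))
  refine isCompactOperator_of_tendsto ht (Eventually.of_forall fun s => ?_)
  have : ∀ s : Finset (Fin 2 → ℤ), IsCompactOperator (F s) := by
    intro s
    induction s using Finset.induction_on with
    | empty =>
      have h0 : F ∅ = 0 := by simp [F]
      rw [h0]
      exact isCompactOperator_zero
    | insert n s hn ih =>
      have h0 : F (insert n s) = m n • (fcL n).smulRight (fb n) + F s := by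
        simp [F, Finset.sum_insert hn]
      rw [h0]
      refine IsCompactOperator.add ?_ ih
      refine IsCompactOperator.smul ?_ (m n)
      have h1 : IsCompactOperator (fcL n) := isCompactOperator_of_locallyCompactSpace_dom (fcL n)
      exact h1.clm_comp ((ContinuousLinearMap.id ℂ ℂ).smulRight (fb n))
  exact this s

/-! ### The resolvent of `2 D_{z̄}` -/

theorem norm_dvec_ge (n : Fin 2 → ℤ) : ‖n‖ ≤ 4 * Real.sqrt 3 * ‖dvec n‖ := by
  have h3 : 1 ≤ Real.sqrt 3 := Real.one_le_sqrt.2 (by norm_num)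
  have hre := Complex.abs_re_le_norm (dvec n)
  have him := Complex.abs_im_le_norm (dvec n)
  have e1 : (n 1 - n 0 : ℝ) = 2 * Real.sqrt 3 * (dvec n).re := by
    simp only [dvec]; field_simp
  have e2 : (n 0 + n 1 : ℝ) = -2 * (dvec n).im := by
    simp only [dvec]; ring
  set D := ‖dvec n‖
  have hD : 0 ≤ D := norm_nonneg _
  have b1 : |(n 1 - n 0 : ℝ)| ≤ 2 * Real.sqrt 3 * D := by
    rw [e1, abs_mul, abs_of_pos (by positivity)]
    gcongr
  have b2 : |(n 0 + n 1 : ℝ)| ≤ 2 * Real.sqrt 3 * D := by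
    rw [e2, abs_mul, abs_neg, abs_two]
    nlinarith [abs_nonneg (dvec n).im]
  rw [abs_le] at b1 b2
  refine (pi_norm_le_iff_of_nonneg (by positivity)).2 fun i => ?_
  rw [Int.norm_eq_abs, abs_le]
  fin_cases i <;> simp <;> constructor <;> linarith [b1.1, b1.2, b2.1, b2.2]

theorem tendsto_norm_dvec : Tendsto (fun n => ‖dvec n‖) cofinite atTop := by
  have h1 : Tendsto (fun n : Fin 2 → ℤ => ‖n‖) cofinite atTop := by
    have := tendsto_norm_cocompact_atTop (E := Fin 2 → ℤ)
    rwa [cocompact_eq_cofinite] at this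
  have h2 : Tendsto (fun n : Fin 2 → ℤ => (4 * Real.sqrt 3)⁻¹ * ‖n‖) cofinite atTop :=
    h1.const_mul_atTop (by positivity)
  refine tendsto_atTop_mono (fun n => ?_) h2
  rw [inv_mul_le_iff₀ (by positivity)]
  exact norm_dvec_ge n

theorem tendsto_norm_dvec_add (k : ℂ) : Tendsto (fun n => ‖dvec n + k‖) cofinite atTop := by
  refine tendsto_atTop_mono (fun n => ?_)
    (tendsto_atTop_add_const_right _ (-‖k‖) tendsto_norm_dvec)
  have := norm_sub_le (dvec n + k) k
  rw [add_sub_cancel_right] at this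
  linarith

/-- The symbol of `(2 D_{z̄} + k)⁻¹`. -/
def rsym (k : ℂ) (n : Fin 2 → ℤ) : ℂ := (dvec n + k)⁻¹

theorem tendsto_rsym (k : ℂ) : Tendsto (rsym k) cofinite (𝓝 0) := by
  rw [tendsto_zero_iff_norm_tendsto_zero]
  simp only [rsym, norm_inv]
  exact (tendsto_norm_dvec_add k).inv_tendsto_atTop

/-- The Fourier multiplier inverting `2 D_{z̄} + k` off its kernel. -/
def Rf (k : ℂ) : L2 ℂ →L[ℂ] L2 ℂ := mult (rsym k)

theorem fc_Rf (k : ℂ) (u : L2 ℂ) (n) : fc (Rf k u) n = (dvec n + k)⁻¹ * fc u n :=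
  fc_mult (bddSymbol_of_tendsto (tendsto_rsym k)) u n

theorem isCompactOperator_Rf (k : ℂ) : IsCompactOperator (Rf k) :=
  isCompactOperator_mult (tendsto_rsym k)

theorem dvec_add_ne_zero {k : ℂ} (hk : k ∉ dualLattice) (n) : dvec n + k ≠ 0 := fun h =>
  hk (mem_dualLattice_iff.2 ⟨-n, by rw [dvec_neg]; exact neg_eq_of_add_eq_zero_right h⟩)

/-! ### Weak derivatives and Fourier coefficients -/

/-- The Fourier coefficients of a continuous function. -/
def fcc (φ : ℂ → ℂ) (n : Fin 2 → ℤ) : ℂ :=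
  ((Real.sqrt area)⁻¹ : ℂ) * ∫ z, ch (-n) z * φ z ∂cellMeasure

theorem fc_toLp {φ : ℂ → ℂ} (hφ : MemLp φ 2 cellMeasure) (n) : fc (hφ.toLp) n = fcc φ n := by
  rw [fc_eq_integral, fcc]
  congr 1
  refine integral_congr_ae ?_
  filter_upwards [hφ.coeFn_toLp] with z hz
  rw [hz]

theorem fcc_fderiv {φ : ℂ → ℂ} (hφ : ContDiff ℝ 1 φ)
    (hper : ∀ (m n : ℤ) (z : ℂ), φ (z + latVec m n) = φ z) (v : ℂ) (n) :
    fcc (fun z => fderiv ℝ φ z v) n = Complex.I * ((v * conj (dvec n)).re : ℝ) * fcc φ n := by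
  have hch : ContDiff ℝ 1 (ch (-n)) := (contDiff_ch (-n)).of_le (by exact_mod_cast le_top)
  have h := integral_fderiv_eq_zero (hch.mul hφ)
    (fun a b z => by simp only [ch_periodic, hper]) v
  have hf : ∀ z, fderiv ℝ (fun z => ch (-n) z * φ z) z v = ch (-n) z * fderiv ℝ φ z v
      - Complex.I * ((v * conj (dvec n)).re : ℝ) * (ch (-n) z * φ z) := by
    intro z
    rw [fderiv_fun_mul (hch.differentiable one_ne_zero z) (hφ.differentiable one_ne_zero z)]
    simp only [add_apply, smul_apply, smul_eq_mul,
      fderiv_ch, dvec_neg, map_neg, mul_neg, Complex.neg_re, Complex.ofReal_neg]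
    ring
  simp_rw [hf] at h
  have hc : Continuous fun z => fderiv ℝ φ z v :=
    (hφ.continuous_fderiv one_ne_zero).clm_apply continuous_const
  have i1 : Integrable (fun z => ch (-n) z * fderiv ℝ φ z v) cellMeasure :=
    integrable_of_continuous ((continuous_ch _).mul hc)
  have i2 : Integrable (fun z => ch (-n) z * φ z) cellMeasure :=
    integrable_of_continuous ((continuous_ch _).mul hφ.continuous)
  rw [integral_sub i1 (i2.const_mul _),
    integral_const_mul, sub_eq_zero] at h
  rw [fcc, fcc, h]
  ring

/-- Parseval's identity for `conj φ` and `u`; the conjugation turns the index `n` into `-n`. -/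
theorem hasSum_integral_mul {φ : ℂ → ℂ} (hφ : Continuous φ) (u : L2 ℂ) :
    HasSum (fun n => fcc φ (-n) * fc u n) (∫ z, φ z * u z ∂cellMeasure) := by
  have hc : Continuous fun z => conj (φ z) := Complex.continuous_conj.comp hφ
  have h := fb.hasSum_inner_mul_inner ((memLp_of_continuous hc 2).toLp) u
  have e1 : (∫ z, φ z * u z ∂cellMeasure) = inner ℂ ((memLp_of_continuous hc 2).toLp) u := by
    rw [L2.inner_def]
    refine integral_congr_ae ?_
    filter_upwards [(memLp_of_continuous hc 2).coeFn_toLp] with z hz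
    rw [hz, RCLike.inner_apply', Complex.conj_conj]
  rw [e1]
  refine h.congr_fun fun n => ?_
  · rw [← fc_eq_inner, ← inner_conj_symm, ← fc_eq_inner, fc_toLp, fcc, fcc, map_mul,
      ← integral_conj]
    simp only [map_mul, Complex.conj_conj, conj_ch, neg_neg, map_inv₀, Complex.conj_ofReal]

/-- Characters are admissible test functions, which gives one direction. For the other, Parseval's
identity reduces a general test function to its Fourier coefficients. -/
theorem hasWeakDeriv_iff {v : ℂ} {u f : L2 ℂ} :
    HasWeakDeriv v u f ↔ ∀ n, fc f n = Complex.I * ((v * conj (dvec n)).re : ℝ) * fc u n := by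
  constructor
  · intro h n
    have h1 := h (ch (-n)) (contDiff_ch _) (ch_periodic _)
    simp only [fderiv_ch, smul_eq_mul, dvec_neg, map_neg, mul_neg, Complex.neg_re,
      Complex.ofReal_neg, neg_mul, integral_neg, neg_inj] at h1
    rw [fc_eq_integral, fc_eq_integral, ← h1]
    simp only [mul_assoc]
    rw [integral_const_mul, integral_const_mul]
    ring
  · intro h φ hφ hper
    have h1 : ContDiff ℝ 1 φ := hφ.of_le (by exact_mod_cast le_top)
    have hc : Continuous fun z => fderiv ℝ φ z v :=
      (h1.continuous_fderiv one_ne_zero).clm_apply continuous_const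
    simp only [smul_eq_mul]
    rw [← (hasSum_integral_mul hc u).tsum_eq, ← (hasSum_integral_mul h1.continuous f).tsum_eq,
      ← tsum_neg]
    refine tsum_congr fun n => ?_
    rw [fcc_fderiv h1 hper, h, dvec_neg]
    simp only [map_neg, mul_neg, Complex.neg_re, Complex.ofReal_neg]
    ring

/-- Ellipticity: the symbols of both partial derivatives are bounded by `‖dvec n‖`, so square
summability of `dvec n * fc u n` already puts `u` in `H¹`. Only the modulus enters, so `2 D_z` is
covered as well. -/
theorem exists_hasWeakDeriv {u f : L2 ℂ} (h : ∀ n, ‖fc f n‖ = ‖dvec n‖ * ‖fc u n‖) :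
    (∃ ux, HasWeakDeriv 1 u ux) ∧ ∃ uy, HasWeakDeriv Complex.I u uy := by
  constructor
  · obtain ⟨w, hw⟩ := exists_fc_eq f (C := 1) (a := fun n =>
      Complex.I * ((1 * conj (dvec n)).re : ℝ) * fc u n) (fun n => by
        rw [one_mul, h, norm_mul, norm_mul, Complex.norm_I, one_mul, Complex.norm_real, one_mul]
        refine mul_le_mul_of_nonneg_right ?_ (norm_nonneg _)
        simpa using Complex.abs_re_le_norm (dvec n))
    exact ⟨w, hasWeakDeriv_iff.2 hw⟩
  · obtain ⟨w, hw⟩ := exists_fc_eq f (C := 1) (a := fun n =>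
      Complex.I * ((Complex.I * conj (dvec n)).re : ℝ) * fc u n) (fun n => by
        rw [one_mul, h, norm_mul, norm_mul, Complex.norm_I, one_mul, Complex.norm_real]
        refine mul_le_mul_of_nonneg_right ?_ (norm_nonneg _)
        simpa using Complex.abs_im_le_norm (dvec n))
    exact ⟨w, hasWeakDeriv_iff.2 hw⟩

theorem dvec_eq_re_im (n) : -Complex.I * (Complex.I * ((1 * conj (dvec n)).re : ℝ)
    + Complex.I * (Complex.I * ((Complex.I * conj (dvec n)).re : ℝ))) = dvec n := by
  apply Complex.ext <;> simp

theorem conj_dvec_eq_re_im (n) : -Complex.I * (Complex.I * ((1 * conj (dvec n)).re : ℝ)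
    - Complex.I * (Complex.I * ((Complex.I * conj (dvec n)).re : ℝ))) = conj (dvec n) := by
  apply Complex.ext <;> simp

theorem isTwoDzbar_iff {u f : L2 ℂ} : IsTwoDzbar u f ↔ ∀ n, fc f n = dvec n * fc u n := by
  constructor
  · rintro ⟨ux, uy, hx, hy, rfl⟩ n
    rw [← dvec_eq_re_im]
    simp only [fc_smul, fc_add, hasWeakDeriv_iff.1 hx n, hasWeakDeriv_iff.1 hy n]
    ring
  · intro h
    obtain ⟨⟨ux, hx⟩, uy, hy⟩ := exists_hasWeakDeriv (u := u) (f := f) fun n => by rw [h, norm_mul]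
    refine ⟨ux, uy, hx, hy, fc_ext fun n => ?_⟩
    rw [h, ← dvec_eq_re_im]
    simp only [fc_smul, fc_add, hasWeakDeriv_iff.1 hx n, hasWeakDeriv_iff.1 hy n]
    ring

theorem isTwoDz_iff {u f : L2 ℂ} : IsTwoDz u f ↔ ∀ n, fc f n = conj (dvec n) * fc u n := by
  constructor
  · rintro ⟨ux, uy, hx, hy, rfl⟩ n
    rw [← conj_dvec_eq_re_im]
    simp only [fc_smul, fc_sub, hasWeakDeriv_iff.1 hx n, hasWeakDeriv_iff.1 hy n]
    ring
  · intro h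
    obtain ⟨⟨ux, hx⟩, uy, hy⟩ := exists_hasWeakDeriv (u := u) (f := f) fun n => by
      rw [h, norm_mul, RCLike.norm_conj]
    refine ⟨ux, uy, hx, hy, fc_ext fun n => ?_⟩
    rw [h, ← conj_dvec_eq_re_im]
    simp only [fc_smul, fc_sub, hasWeakDeriv_iff.1 hx n, hasWeakDeriv_iff.1 hy n]
    ring

theorem isBoundedInverse_Rf {k : ℂ} (hk : k ∉ dualLattice) :
    IsBoundedInverse (IsTwoDzbarAdd k) (Rf k) := by
  intro u f
  rw [IsTwoDzbarAdd, isTwoDzbar_iff]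
  constructor
  · intro h
    refine fc_ext fun n => ?_
    have h1 := h n
    rw [fc_sub, fc_smul] at h1
    rw [fc_Rf, eq_inv_mul_iff_mul_eq₀ (dvec_add_ne_zero hk n)]
    linear_combination -h1
  · rintro rfl n
    have := dvec_add_ne_zero hk n
    rw [fc_sub, fc_smul, fc_Rf]
    field_simp
    ring

theorem R_eq_Rf {k : ℂ} (hk : k ∉ dualLattice) : R k = Rf k := by
  have h : ∃ T : L2 ℂ →L[ℂ] L2 ℂ, IsBoundedInverse (IsTwoDzbarAdd k) T :=
    ⟨_, isBoundedInverse_Rf hk⟩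
  rw [R, dif_pos h]
  ext1 f
  exact ((isBoundedInverse_Rf hk _ f).1 ((h.choose_spec _ f).2 rfl))

/-! ### Multiplication by bounded functions -/

/-- `L^∞(ℂ/Γ)`. -/
abbrev Linf : Type := Lp ℂ ⊤ cellMeasure

/-- Multiplication by a bounded function on `L²(ℂ/Γ)`. -/
def mulInf (g : Linf) : L2 ℂ →L[ℂ] L2 ℂ :=
  (ContinuousLinearMap.mul ℂ ℂ).holderL cellMeasure ⊤ 2 2 g

theorem coeFn_mulInf (g : Linf) (u : L2 ℂ) :
    mulInf g u =ᵐ[cellMeasure] fun z => g z * u z :=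
  (ContinuousLinearMap.mul ℂ ℂ).coeFn_holder (r := 2) g u

/-- A continuous function as an element of `L^∞(ℂ/Γ)`. -/
def ofCont {φ : ℂ → ℂ} (hφ : Continuous φ) : Linf := (memLp_of_continuous hφ ⊤).toLp

theorem coeFn_ofCont {φ : ℂ → ℂ} (hφ : Continuous φ) : ofCont hφ =ᵐ[cellMeasure] φ :=
  MemLp.coeFn_toLp _

theorem coeFn_mul_ofCont {φ : ℂ → ℂ} (hφ : Continuous φ) (u : L2 ℂ) :
    mulInf (ofCont hφ) u =ᵐ[cellMeasure] fun z => φ z * u z := by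
  filter_upwards [coeFn_mulInf (ofCont hφ) u, coeFn_ofCont hφ] with z h1 h2
  rw [h1, h2]

/-- The Fourier coefficients of a bounded function. -/
def fcm (g : Linf) (n : Fin 2 → ℤ) : ℂ := fc (mulInf g (fb 0)) n

theorem fc_mulInf_fb (g : Linf) (m n : Fin 2 → ℤ) : fc (mulInf g (fb m)) n = fcm g (n - m) := by
  rw [fcm, fc_eq_integral, fc_eq_integral]
  congr 1
  refine integral_congr_ae ?_
  filter_upwards [coeFn_mulInf g (fb m), coeFn_mulInf g (fb 0), coeFn_chLp m, coeFn_chLp 0] with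
    z h1 h2 h3 h4
  rw [h1, h2, fb_apply, fb_apply, h3, h4, neg_sub, sub_eq_add_neg, ch_add, ch_zero]
  ring

theorem fcm_ofCont {φ : ℂ → ℂ} (hφ : Continuous φ) (n : Fin 2 → ℤ) :
    fcm (ofCont hφ) n = ((Real.sqrt area)⁻¹ : ℂ) * fcc φ n := by
  rw [fcm, fc_eq_integral, fcc]
  congr 1
  rw [← integral_const_mul]
  refine integral_congr_ae ?_
  filter_upwards [coeFn_mul_ofCont hφ (fb 0), coeFn_chLp 0] with z h1 h2
  rw [h1, fb_apply, h2, ch_zero]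
  ring

theorem fc_mul_ch (m n : Fin 2 → ℤ) (u : L2 ℂ) :
    fc (mulInf (ofCont (continuous_ch m)) u) n = fc u (n - m) := by
  rw [fc_eq_integral, fc_eq_integral]
  congr 1
  refine integral_congr_ae ?_
  filter_upwards [coeFn_mul_ofCont (continuous_ch m) u] with z h1
  rw [h1, ← mul_assoc, ← ch_add]
  congr 2
  abel

theorem Rf_fb (κ : ℂ) (m : Fin 2 → ℤ) : Rf κ (fb m) = (dvec m + κ)⁻¹ • fb m := by
  refine fc_ext fun n => ?_
  rw [fc_Rf, fc_smul, fc_fb]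
  split_ifs with h
  · rw [h]
  · simp

/-- Leibniz' rule: if `(2 D_{z̄} + a) g = g'` with `g, g'` bounded and `(2 D_{z̄} + κ) f = φ`, then
`(2 D_{z̄} + κ + a) (g f) = g φ + g' f`. -/
theorem leibniz {g g' : Linf} {a κ : ℂ} (hκ : κ ∉ dualLattice)
    (h : ∀ n, (dvec n + a) * fcm g n = fcm g' n) (φ : L2 ℂ) (n : Fin 2 → ℤ) :
    (dvec n + (κ + a)) * fc (mulInf g (Rf κ φ)) n
      = fc (mulInf g φ) n + fc (mulInf g' (Rf κ φ)) n := by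
  -- On the basis vector `fb m` this is the splitting `dvec n + κ + a = (dvec m + κ) + (dvec (n - m)
  -- + a)`; density then covers arbitrary `φ`.
  have key : (dvec n + (κ + a)) • (fcL n ∘L mulInf g ∘L Rf κ)
      = fcL n ∘L mulInf g + fcL n ∘L mulInf g' ∘L Rf κ := by
    refine clm_ext fun m => ?_
    have hm := dvec_add_ne_zero hκ m
    have h1 := h (n - m)
    simp only [add_apply, smul_apply, ContinuousLinearMap.comp_apply, Rf_fb, map_smul, fcL_apply,
      fc_mulInf_fb, smul_eq_mul, ← h1]
    rw [dvec_sub]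
    field_simp
    ring
  have := DFunLike.congr_fun key φ
  simpa only [add_apply, smul_apply, ContinuousLinearMap.comp_apply, fcL_apply, smul_eq_mul]
    using this

open Classical in
/-- The Fourier projection onto the modes in `P`. -/
def modeProj (P : (Fin 2 → ℤ) → Prop) : L2 ℂ →L[ℂ] L2 ℂ := mult fun n => if P n then 1 else 0

open Classical in
theorem fc_modeProj (P : (Fin 2 → ℤ) → Prop) (u : L2 ℂ) (n : Fin 2 → ℤ) :
    fc (modeProj P u) n = if P n then fc u n else 0 := by
  rw [modeProj, fc_mult ⟨1, fun n => by split_ifs <;> simp⟩]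
  split_ifs <;> simp

/-- Multiplication by `g` has the matrix `fcm g (n - m)`; the hypothesis says that its nonzero
entries link modes in `Q` only to modes in `P`, and the others only to the others. -/
theorem modeProj_mulInf {P Q : (Fin 2 → ℤ) → Prop} {g : Linf}
    (h : ∀ n m, fcm g (n - m) ≠ 0 → (P n ↔ Q m)) (u : L2 ℂ) :
    modeProj P (mulInf g u) = mulInf g (modeProj Q u) := by
  have key : modeProj P ∘L mulInf g = mulInf g ∘L modeProj Q := by
    classical
    refine clm_ext fun m => fc_ext fun n => ?_
    have hQ : modeProj Q (fb m) = (if Q m then (1 : ℂ) else 0) • fb m := by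
      refine fc_ext fun n => ?_
      rw [fc_modeProj, fc_smul, fc_fb]
      split_ifs <;> simp_all
    rw [ContinuousLinearMap.comp_apply, ContinuousLinearMap.comp_apply, fc_modeProj, hQ, map_smul,
      fc_smul, fc_mulInf_fb]
    by_cases h0 : fcm g (n - m) = 0
    · simp [h0]
    · simp only [h n m h0]
      split_ifs <;> simp
  exact DFunLike.congr_fun key u

theorem inner_mulInf {g g' : Linf} (h : ∀ᵐ z ∂cellMeasure, g' z = conj (g z)) (u v : L2 ℂ) :
    inner ℂ (mulInf g' u) v = inner ℂ u (mulInf g v) := by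
  rw [L2.inner_def, L2.inner_def]
  refine integral_congr_ae ?_
  filter_upwards [h, coeFn_mulInf g' u, coeFn_mulInf g v] with z h1 h2 h3
  rw [h2, h3, h1, RCLike.inner_apply', RCLike.inner_apply', map_mul, Complex.conj_conj]
  ring

/-! ### Pull-back by symmetries of the cell -/

/-- Pull-back of functions on `ℂ/Γ`. -/
def pull {A : ℂ → ℂ} (hA : IsCellSymm A) : L2 ℂ →L[ℂ] L2 ℂ :=
  (Lp.compMeasurePreservingₗᵢ ℂ _ hA.measurePreserving_red).toContinuousLinearMap

theorem coeFn_pull {A : ℂ → ℂ} (hA : IsCellSymm A) (u : L2 ℂ) :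
    pull hA u =ᵐ[cellMeasure] fun z => u (red (A z)) :=
  Lp.coeFn_compMeasurePreserving u hA.measurePreserving_red

theorem IsCellSymm.integral_mul_pull {A : ℂ → ℂ} (hA : IsCellSymm A) {φ : ℂ → ℂ}
    (hφ : ∀ (m n : ℤ) (z : ℂ), φ (z + latVec m n) = φ z) (u : L2 ℂ) :
    ∫ z, φ (A z) * pull hA u z ∂cellMeasure = ∫ z, φ z * u z ∂cellMeasure := by
  have h1 : ∫ z, φ (A z) * pull hA u z ∂cellMeasure
      = ∫ z, φ (A z) * u (red (A z)) ∂cellMeasure := by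
    refine integral_congr_ae ?_
    filter_upwards [coeFn_pull hA u] with z hz
    rw [hz]
  have h2 : ∫ z, φ z * u (red z) ∂cellMeasure = ∫ z, φ z * u z ∂cellMeasure := by
    refine integral_congr_ae (ae_cell_iff.2 (Eventually.of_forall fun z hz => ?_))
    simp only [red_eq_self hz]
  rw [h1, ← h2]
  exact hA.integral_comp (f := fun z => φ z * u (red z)) fun m n z => by
    rw [hφ, red_periodic]

theorem fc_pull_add (a : ℂ) (u : L2 ℂ) (n : Fin 2 → ℤ) :
    fc (pull (isCellSymm_add a) u) n = ch n a * fc u n := by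
  have h := (isCellSymm_add a).integral_mul_pull (ch_periodic (-n)) u
  simp only [ch_add_arg] at h
  rw [fc_eq_integral, fc_eq_integral, ← h, ← integral_const_mul, ← integral_const_mul,
    ← integral_const_mul]
  refine integral_congr_ae (Eventually.of_forall fun z => ?_)
  have h2 : ch n a * ch (-n) a = 1 := by rw [← ch_add, add_neg_cancel, ch_zero]
  simp only
  linear_combination (-(((Real.sqrt area)⁻¹ : ℂ) * ch (-n) z * pull (isCellSymm_add a) u z)) * h2

/-- Pull-back by the rotation by `2π/3`. -/
def Om : L2 ℂ →L[ℂ] L2 ℂ := pull isCellSymm_omega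

theorem rot_neg (n : Fin 2 → ℤ) : rot (-n) = -rot n := by
  ext i
  fin_cases i <;> simp [rot]
  ring

theorem fc_Om (u : L2 ℂ) (n : Fin 2 → ℤ) : fc (Om u) n = fc u (rot n) := by
  have h := isCellSymm_omega.integral_mul_pull (ch_periodic (rot (-n))) u
  simp only [ch_omega_mul] at h
  rw [fc_eq_integral, fc_eq_integral, ← rot_neg, ← h]
  rfl

/-! ### Fourier coefficients of the potential -/

theorem moireVec_mul (c : ℤ) (a b : ℤ) : (c : ℂ) * moireVec a b = moireVec (c * a) (c * b) := by
  simp only [moireVec]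
  push_cast
  ring

theorem moireVec_three (a b : ℤ) : moireVec (3 * a) (3 * b) = latVec a b := by
  simp only [moireVec, latVec]
  push_cast
  ring

namespace Potential

variable (U : Potential)

theorem contDiff_scaled (c : ℝ) : ContDiff ℝ ∞ (U.scaled c) :=
  U.smooth.comp (contDiff_const.mul contDiff_id)

theorem continuous_scaled (c : ℝ) : Continuous (U.scaled c) := (U.contDiff_scaled c).continuous

theorem scaled_add_moireVec (c : ℤ) (a b : ℤ) (z : ℂ) :
    U.scaled c (z + moireVec a b) = omega ^ (-(c * (a + b))) * U.scaled c z := by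
  simp only [scaled]
  rw [mul_add, Complex.ofReal_intCast, moireVec_mul, U.translate, conj_omega, inv_zpow, zpow_neg,
    mul_add c]

theorem scaled_periodic (c : ℤ) (m n : ℤ) (z : ℂ) :
    U.scaled c (z + latVec m n) = U.scaled c z := by
  rw [← moireVec_three, scaled_add_moireVec, (omega_zpow_eq_one_iff _).2, one_mul]
  exact ⟨-(c * (m + n)), by ring⟩

theorem scaled_omega_mul (c : ℝ) (z : ℂ) : U.scaled c (omega * z) = omega * U.scaled c z := by
  simp only [scaled]
  rw [mul_left_comm, U.rotate]

/-- Translation by a vector of `Γ₃` preserves the integral defining the coefficient but multiplies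
the integrand by a power of `ω`; a nonzero coefficient forces that power to be `1`. -/
theorem fcc_scaled_ne_zero {c : ℤ} {n : Fin 2 → ℤ} (h : fcc (U.scaled c) n ≠ 0) :
    (3 : ℤ) ∣ n 0 + c ∧ (3 : ℤ) ∣ n 1 + c := by
  have key : ∀ a b : ℤ, omega ^ (a * n 0 + b * n 1 + c * (a + b)) = 1 := by
    intro a b
    have h1 := (isCellSymm_add (moireVec a b)).integral_comp
      (f := fun z => ch (-n) z * U.scaled c z) (fun m n z => by
        rw [ch_periodic, scaled_periodic])
    simp only [ch_add_arg, U.scaled_add_moireVec, ch_moireVec] at h1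
    have h2 : ∀ z, ch (-n) z * omega ^ (a * (-n) 0 + b * (-n) 1) *
        (omega ^ (-(c * (a + b))) * U.scaled c z)
        = omega ^ (-(a * n 0 + b * n 1 + c * (a + b))) * (ch (-n) z * U.scaled c z) := by
      intro z
      rw [show -(a * n 0 + b * n 1 + c * (a + b)) = (a * (-n) 0 + b * (-n) 1) + -(c * (a + b)) by
        simp only [Pi.neg_apply]; ring,
        zpow_add₀ omega_ne_zero (a * (-n) 0 + b * (-n) 1)]
      generalize omega ^ (a * (-n) 0 + b * (-n) 1) = x
      generalize omega ^ (-(c * (a + b))) = y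
      ring
    simp_rw [h2] at h1
    rw [integral_const_mul] at h1
    have h3 : ∫ z, ch (-n) z * U.scaled c z ∂cellMeasure ≠ 0 := fun h0 => h (by
      rw [fcc, h0, mul_zero])
    have h4 := mul_right_cancel₀ h3 (h1.trans (one_mul _).symm)
    rw [zpow_neg, inv_eq_one] at h4
    exact h4
  have h0 := (omega_zpow_eq_one_iff _).1 (key 1 0)
  have h1 := (omega_zpow_eq_one_iff _).1 (key 0 1)
  simp only [one_mul, zero_mul, add_zero, zero_add, mul_one] at h0 h1
  exact ⟨h0, h1⟩

theorem Om_mul_scaled (c : ℤ) (u : L2 ℂ) :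
    Om (mulInf (ofCont (U.continuous_scaled c)) u)
      = omega • mulInf (ofCont (U.continuous_scaled c)) (Om u) := by
  have hqmp := isCellSymm_omega.measurePreserving_red.quasiMeasurePreserving
  refine Lp.ext ?_
  filter_upwards [coeFn_pull isCellSymm_omega (mulInf (ofCont (U.continuous_scaled c)) u),
    coeFn_pull isCellSymm_omega u, Lp.coeFn_smul omega
      (mulInf (ofCont (U.continuous_scaled c)) (Om u)),
    coeFn_mul_ofCont (U.continuous_scaled c) (Om u),
    hqmp.ae (coeFn_mul_ofCont (U.continuous_scaled c) u)] with z h1 h2 h3 h4 h5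
  rw [Om] at h3 h4 ⊢
  rw [h1, h3, Pi.smul_apply, h4, h2, h5, smul_eq_mul]
  obtain ⟨m, n, hmn⟩ := exists_red_eq (omega * z)
  have h6 : U.scaled c (red (omega * z)) = omega * U.scaled c z := by
    rw [hmn, scaled_periodic, scaled_omega_mul]
  rw [h6, mul_assoc]

end Potential

/-- Supplies the bounded derivative that `leibniz` asks for, with `a = 0`. -/
theorem exists_twoDzbar_ofCont {φ : ℂ → ℂ} (hφ : ContDiff ℝ 1 φ)
    (hper : ∀ (m n : ℤ) (z : ℂ), φ (z + latVec m n) = φ z) :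
    ∃ g' : Linf, ∀ n, dvec n * fcm (ofCont hφ.continuous) n = fcm g' n := by
  have hc : ∀ v, Continuous fun z => fderiv ℝ φ z v := fun v =>
    (hφ.continuous_fderiv one_ne_zero).clm_apply continuous_const
  have hc' : Continuous fun z => -Complex.I * (fderiv ℝ φ z 1 + Complex.I * fderiv ℝ φ z Complex.I) :=
    continuous_const.mul ((hc 1).add (continuous_const.mul (hc Complex.I)))
  refine ⟨ofCont hc', fun n => ?_⟩
  have h : fcc (fun z => -Complex.I * (fderiv ℝ φ z 1 + Complex.I * fderiv ℝ φ z Complex.I)) n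
      = -Complex.I * (fcc (fun z => fderiv ℝ φ z 1) n
        + Complex.I * fcc (fun z => fderiv ℝ φ z Complex.I) n) := by
    have i1 : ∀ v, Integrable (fun z => ch (-n) z * fderiv ℝ φ z v) cellMeasure := fun v =>
      integrable_of_continuous ((continuous_ch _).mul (hc v))
    have e : ∀ z, ch (-n) z * (-Complex.I * (fderiv ℝ φ z 1 + Complex.I * fderiv ℝ φ z Complex.I))
        = -Complex.I * ((ch (-n) z * fderiv ℝ φ z 1)
          + Complex.I * (ch (-n) z * fderiv ℝ φ z Complex.I)) := fun z => by ring
    simp only [fcc, e]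
    rw [integral_const_mul, integral_add (i1 1) ((i1 Complex.I).const_mul _), integral_const_mul]
    ring
  rw [fcm_ofCont, fcm_ofCont, h, fcc_fderiv hφ hper, fcc_fderiv hφ hper]
  linear_combination (-(((Real.sqrt area)⁻¹ : ℂ) * fcc φ n)) * dvec_eq_re_im n

/-! ### `ℂ³`-valued functions -/

/-- The components of a `ℂ³`-valued function. -/
def cp (i : Fin 3) : L2 C3 →L[ℂ] L2 ℂ :=
  (EuclideanSpace.proj i : C3 →L[ℂ] ℂ).compLpL 2 cellMeasure

/-- The `ℂ³`-valued function with the single component `u` in the place `i`. -/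
def inc (i : Fin 3) : L2 ℂ →L[ℂ] L2 C3 :=
  ((ContinuousLinearMap.id ℂ ℂ).smulRight (EuclideanSpace.single i (1 : ℂ)) :
    ℂ →L[ℂ] C3).compLpL 2 cellMeasure

theorem coeFn_cp (i : Fin 3) (u : L2 C3) : cp i u =ᵐ[cellMeasure] fun z => u z i :=
  ContinuousLinearMap.coeFn_compLpL _ _

theorem coeFn_inc (i : Fin 3) (u : L2 ℂ) :
    inc i u =ᵐ[cellMeasure] fun z => u z • EuclideanSpace.single i (1 : ℂ) :=
  ContinuousLinearMap.coeFn_compLpL _ _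

theorem cp_ext {u v : L2 C3} (h : ∀ i, cp i u = cp i v) : u = v := by
  refine Lp.ext ?_
  have h1 : ∀ᵐ z ∂cellMeasure, ∀ i, cp i u z = u z i := ae_all_iff.2 fun i => coeFn_cp i u
  have h2 : ∀ᵐ z ∂cellMeasure, ∀ i, cp i v z = v z i := ae_all_iff.2 fun i => coeFn_cp i v
  filter_upwards [h1, h2] with z h3 h4
  ext i
  rw [← h3, ← h4, h]

theorem cp_inc (i j : Fin 3) (u : L2 ℂ) : cp i (inc j u) = if i = j then u else 0 := by
  refine Lp.ext ?_
  have h0 := Lp.coeFn_zero ℂ 2 cellMeasure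
  filter_upwards [coeFn_cp i (inc j u), coeFn_inc j u, h0] with z h1 h2 h3
  rw [h1, h2]
  split_ifs with h
  · simp [h]
  · rw [h3]
    simp [h]

theorem inner_inc (i : Fin 3) (a : L2 ℂ) (v : L2 C3) : inner ℂ (inc i a) v = inner ℂ a (cp i v) := by
  rw [L2.inner_def, L2.inner_def]
  refine integral_congr_ae ?_
  filter_upwards [coeFn_inc i a, coeFn_cp i v] with z h1 h2
  rw [h1, h2, inner_smul_left, EuclideanSpace.inner_single_left, RCLike.inner_apply']
  simp

theorem sum_inc_cp (u : L2 C3) : ∑ i, inc i (cp i u) = u := by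
  refine cp_ext fun i => ?_
  simp [map_sum, cp_inc]

theorem cp_sum_inc (f : Fin 3 → L2 ℂ) (i : Fin 3) : cp i (∑ j, inc j (f j)) = f i := by
  simp [map_sum, cp_inc]

theorem inner_eq_sum (u v : L2 C3) : inner ℂ u v = ∑ i, inner ℂ (cp i u) (cp i v) := by
  conv_lhs => rw [← sum_inc_cp u]
  rw [sum_inner]
  simp only [inner_inc]

/-- The Fourier coefficients of a `ℂ³`-valued function. -/
def vc (u : L2 C3) (i : Fin 3) (n : Fin 2 → ℤ) : ℂ := fc (cp i u) n

theorem vc_ext {u v : L2 C3} (h : ∀ i n, vc u i n = vc v i n) : u = v :=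
  cp_ext fun i => fc_ext fun n => h i n

@[simp] theorem vc_add (u v : L2 C3) (i n) : vc (u + v) i n = vc u i n + vc v i n := by simp [vc]
@[simp] theorem vc_sub (u v : L2 C3) (i n) : vc (u - v) i n = vc u i n - vc v i n := by simp [vc]
@[simp] theorem vc_smul (c : ℂ) (u : L2 C3) (i n) : vc (c • u) i n = c * vc u i n := by simp [vc]
@[simp] theorem vc_zero (i n) : vc 0 i n = 0 := by simp [vc]

theorem vc_eq_inner (u : L2 C3) (i n) : vc u i n = inner ℂ (inc i (fb n)) u := by
  rw [vc, fc_eq_inner, inner_inc]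

/-- The operator acting by `T` on each component. -/
def diagOp (T : L2 ℂ →L[ℂ] L2 ℂ) : L2 C3 →L[ℂ] L2 C3 := ∑ i, inc i ∘L T ∘L cp i

theorem cp_diagOp (T : L2 ℂ →L[ℂ] L2 ℂ) (u : L2 C3) (i : Fin 3) :
    cp i (diagOp T u) = T (cp i u) := by
  simp only [diagOp, sum_apply, ContinuousLinearMap.comp_apply]
  exact cp_sum_inc (fun j => T (cp j u)) i

/-- Multiplication by a matrix of bounded functions. -/
def matOp (W : Fin 3 → Fin 3 → Linf) : L2 C3 →L[ℂ] L2 C3 :=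
  ∑ i, inc i ∘L ∑ j, mulInf (W i j) ∘L cp j

theorem cp_matOp (W : Fin 3 → Fin 3 → Linf) (u : L2 C3) (i : Fin 3) :
    cp i (matOp W u) = ∑ j, mulInf (W i j) (cp j u) := by
  simp only [matOp, sum_apply, ContinuousLinearMap.comp_apply]
  exact cp_sum_inc (fun i => ∑ j, mulInf (W i j) (cp j u)) i

theorem coeFn_matOp (W : Fin 3 → Fin 3 → Linf) (u : L2 C3) :
    ∀ᵐ z ∂cellMeasure, ∀ i, matOp W u z i = ∑ j, W i j z * u z j := by
  have h1 : ∀ᵐ z ∂cellMeasure, ∀ i, cp i (matOp W u) z = matOp W u z i :=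
    ae_all_iff.2 fun i => coeFn_cp i _
  have h2 : ∀ᵐ z ∂cellMeasure, ∀ i, cp i u z = u z i := ae_all_iff.2 fun i => coeFn_cp i _
  have h3 : ∀ᵐ z ∂cellMeasure, ∀ i j, mulInf (W i j) (cp j u) z = W i j z * cp j u z :=
    ae_all_iff.2 fun i => ae_all_iff.2 fun j => coeFn_mulInf _ _
  have h4 : ∀ᵐ z ∂cellMeasure, ∀ i, (∑ j, mulInf (W i j) (cp j u) : L2 ℂ) z
      = ∑ j, mulInf (W i j) (cp j u) z := by
    refine ae_all_iff.2 fun i => ?_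
    simp only [Fin.sum_univ_three]
    filter_upwards [Lp.coeFn_add (mulInf (W i 0) (cp 0 u) + mulInf (W i 1) (cp 1 u))
      (mulInf (W i 2) (cp 2 u)), Lp.coeFn_add (mulInf (W i 0) (cp 0 u)) (mulInf (W i 1) (cp 1 u))]
      with z e1 e2
    rw [e1, Pi.add_apply, e2, Pi.add_apply]
  filter_upwards [h1, h2, h3, h4] with z e1 e2 e3 e4 i
  rw [← e1, cp_matOp, e4]
  exact Finset.sum_congr rfl fun j _ => by rw [e3, e2]

theorem adjoint_matOp {W W' : Fin 3 → Fin 3 → Linf}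
    (h : ∀ i j, ∀ᵐ z ∂cellMeasure, W' i j z = conj (W j i z)) :
    matOp W' = ContinuousLinearMap.adjoint (matOp W) := by
  rw [ContinuousLinearMap.eq_adjoint_iff]
  intro u v
  rw [inner_eq_sum, inner_eq_sum]
  simp only [cp_matOp, sum_inner, inner_sum]
  rw [Finset.sum_comm]
  exact Finset.sum_congr rfl fun i _ => Finset.sum_congr rfl fun j _ => inner_mulInf (h j i) _ _

theorem vc_adjoint_diagOp_mult {m : (Fin 2 → ℤ) → ℂ} (hm : BddSymbol m) (u : L2 C3) (i n) :
    vc (ContinuousLinearMap.adjoint (diagOp (mult m)) u) i n = conj (m n) * vc u i n := by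
  have h : diagOp (mult m) (inc i (fb n)) = m n • inc i (fb n) := by
    refine vc_ext fun j l => ?_
    rw [vc, cp_diagOp, fc_mult hm, vc_smul, vc, cp_inc]
    split_ifs
    · rw [fc_fb]
      split_ifs with h
      · rw [h]
      · simp
    · simp
  rw [vc_eq_inner, ContinuousLinearMap.adjoint_inner_right, h, inner_smul_left, ← vc_eq_inner]

theorem integrable_smul_C3 {φ : ℂ → ℂ} (hφ : Continuous φ) (u : L2 C3) :
    Integrable (fun z => φ z • u z) cellMeasure :=
  memLp_one_iff_integrable.1 ((Lp.memLp u).smul (memLp_of_continuous hφ 2))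

theorem hasWeakDeriv_C3_iff {v : ℂ} {u f : L2 C3} :
    HasWeakDeriv v u f ↔ ∀ i, HasWeakDeriv v (cp i u) (cp i f) := by
  have key : ∀ (φ : ℂ → ℂ), Continuous φ → ∀ (w : L2 C3) (i : Fin 3),
      (∫ z, φ z • w z ∂cellMeasure) i = ∫ z, φ z • cp i w z ∂cellMeasure := by
    intro φ hφ w i
    have h := (EuclideanSpace.proj i : C3 →L[ℂ] ℂ).integral_comp_comm (integrable_smul_C3 hφ w)
    refine h.symm.trans (integral_congr_ae ?_)
    filter_upwards [coeFn_cp i w] with z hz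
    rw [hz]
    simp
  have hc : ∀ φ : ℂ → ℂ, ContDiff ℝ ∞ φ → Continuous fun z => fderiv ℝ φ z v := fun φ hφ =>
    (hφ.continuous_fderiv (by simp)).clm_apply continuous_const
  constructor
  · intro h i φ hφ hper
    rw [← key _ (hc φ hφ), h φ hφ hper, ← key _ hφ.continuous]
    rfl
  · intro h φ hφ hper
    ext i
    rw [key _ (hc φ hφ), h i φ hφ hper, ← key _ hφ.continuous]
    rfl

theorem isTwoDzbar_C3_iff {u f : L2 C3} :
    IsTwoDzbar u f ↔ ∀ i n, vc f i n = dvec n * vc u i n := by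
  constructor
  · rintro ⟨ux, uy, hx, hy, rfl⟩ i
    refine isTwoDzbar_iff.1 ⟨cp i ux, cp i uy, hasWeakDeriv_C3_iff.1 hx i,
      hasWeakDeriv_C3_iff.1 hy i, ?_⟩
    simp only [map_smul, map_add]
  · intro h
    choose ux uy hx hy hf using fun i => isTwoDzbar_iff.2 (h i)
    refine ⟨∑ i, inc i (ux i), ∑ i, inc i (uy i), hasWeakDeriv_C3_iff.2 fun i => ?_,
      hasWeakDeriv_C3_iff.2 fun i => ?_, cp_ext fun i => ?_⟩
    · rw [cp_sum_inc]; exact hx i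
    · rw [cp_sum_inc]; exact hy i
    · rw [hf, map_smul, map_add, map_smul, cp_sum_inc, cp_sum_inc]

theorem isTwoDz_C3_iff {u f : L2 C3} :
    IsTwoDz u f ↔ ∀ i n, vc f i n = conj (dvec n) * vc u i n := by
  constructor
  · rintro ⟨ux, uy, hx, hy, rfl⟩ i
    refine isTwoDz_iff.1 ⟨cp i ux, cp i uy, hasWeakDeriv_C3_iff.1 hx i,
      hasWeakDeriv_C3_iff.1 hy i, ?_⟩
    simp only [map_smul, map_sub]
  · intro h
    choose ux uy hx hy hf using fun i => isTwoDz_iff.2 (h i)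
    refine ⟨∑ i, inc i (ux i), ∑ i, inc i (uy i), hasWeakDeriv_C3_iff.2 fun i => ?_,
      hasWeakDeriv_C3_iff.2 fun i => ?_, cp_ext fun i => ?_⟩
    · rw [cp_sum_inc]; exact hx i
    · rw [cp_sum_inc]; exact hy i
    · rw [hf, map_smul, map_sub, map_smul, cp_sum_inc, cp_sum_inc]

/-! ### The potential matrix as an operator -/

/-- The coefficients of the potential matrix. -/
def potCoef (α β : ℂ) : Fin 3 → Fin 3 → ℂ := ![![0, α, 0], ![α, 0, β], ![0, β, 0]]

/-- The scales of the potential matrix, where `t = p ζ₂/ζ₁`. -/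
def potScale (p t : ℤ) : Fin 3 → Fin 3 → ℤ := ![![0, p, 0], ![-p, 0, t], ![0, -t, 0]]

theorem potMatrix_apply (U : Potential) {p t : ℤ} {s : ℝ} (ht : (p : ℝ) * s = t) (α β : ℂ) (z : ℂ)
    (i j : Fin 3) :
    potMatrix U p s α β z i j = potCoef α β i j * U.scaled (potScale p t i j) z := by
  fin_cases i <;> fin_cases j <;> simp [potMatrix, potCoef, potScale, ht]

/-- The entries of the potential matrix. -/
def potEntry (U : Potential) (p t : ℤ) (α β : ℂ) (i j : Fin 3) : Linf :=
  potCoef α β i j • ofCont (U.continuous_scaled (potScale p t i j))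

theorem coeFn_potEntry (U : Potential) (p t : ℤ) (α β : ℂ) :
    ∀ᵐ z ∂cellMeasure, ∀ i j,
      potEntry U p t α β i j z = potCoef α β i j * U.scaled (potScale p t i j) z := by
  refine ae_all_iff.2 fun i => ae_all_iff.2 fun j => ?_
  filter_upwards [Lp.coeFn_smul (potCoef α β i j) (ofCont (U.continuous_scaled (potScale p t i j))),
    coeFn_ofCont (U.continuous_scaled (potScale p t i j))] with z h1 h2
  rw [potEntry, h1, Pi.smul_apply, h2, smul_eq_mul]

/-- Multiplication by the potential matrix. -/
def Vv (U : Potential) (p t : ℤ) (α β : ℂ) : L2 C3 →L[ℂ] L2 C3 := matOp (potEntry U p t α β)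

theorem coeFn_Vv (U : Potential) {p t : ℤ} {s : ℝ} (ht : (p : ℝ) * s = t) (α β : ℂ) (u : L2 C3) :
    ∀ᵐ z ∂cellMeasure, ∀ i,
      Vv U p t α β u z i = (potMatrix U p s α β z).mulVec (u z).ofLp i := by
  filter_upwards [coeFn_matOp (potEntry U p t α β) u, coeFn_potEntry U p t α β] with z h1 h2 i
  rw [Vv, h1, Matrix.mulVec, dotProduct]
  exact Finset.sum_congr rfl fun j _ => by rw [h2, potMatrix_apply U ht]

/-- The adjoint potential matrix. -/
def potEntryStar (U : Potential) (p t : ℤ) (α β : ℂ) (i j : Fin 3) : Linf :=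
  conj (potCoef α β j i) •
    ofCont (Complex.continuous_conj.comp (U.continuous_scaled (potScale p t j i)))

theorem coeFn_potEntryStar (U : Potential) (p t : ℤ) (α β : ℂ) :
    ∀ᵐ z ∂cellMeasure, ∀ i j, potEntryStar U p t α β i j z = conj (potEntry U p t α β j i z) := by
  have h : ∀ᵐ z ∂cellMeasure, ∀ i j, potEntryStar U p t α β i j z
      = conj (potCoef α β j i * U.scaled (potScale p t j i) z) := by
    refine ae_all_iff.2 fun i => ae_all_iff.2 fun j => ?_
    filter_upwards [Lp.coeFn_smul (conj (potCoef α β j i))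
      (ofCont (Complex.continuous_conj.comp (U.continuous_scaled (potScale p t j i)))),
      coeFn_ofCont (Complex.continuous_conj.comp (U.continuous_scaled (potScale p t j i)))]
      with z h1 h2
    rw [potEntryStar, h1, Pi.smul_apply, h2, smul_eq_mul, map_mul]
    rfl
  filter_upwards [h, coeFn_potEntry U p t α β] with z h1 h2 i j
  rw [h1, h2]

theorem adjoint_Vv (U : Potential) (p t : ℤ) (α β : ℂ) :
    matOp (potEntryStar U p t α β) = ContinuousLinearMap.adjoint (Vv U p t α β) :=
  adjoint_matOp fun i j => by
    filter_upwards [coeFn_potEntryStar U p t α β] with z h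
    rw [h]

theorem coeFn_adjoint_Vv (U : Potential) {p t : ℤ} {s : ℝ} (ht : (p : ℝ) * s = t) (α β : ℂ)
    (u : L2 C3) : ∀ᵐ z ∂cellMeasure, ∀ i,
      ContinuousLinearMap.adjoint (Vv U p t α β) u z i
        = (potMatrix U p s α β z).conjTranspose.mulVec (u z).ofLp i := by
  rw [← adjoint_Vv]
  filter_upwards [coeFn_matOp (potEntryStar U p t α β) u, coeFn_potEntry U p t α β,
    coeFn_potEntryStar U p t α β] with z h1 h2 h3 i
  rw [h1, Matrix.mulVec, dotProduct]
  exact Finset.sum_congr rfl fun j _ => by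
    rw [h3, h2, Matrix.conjTranspose_apply, potMatrix_apply U ht]; rfl

theorem ae_eq_add_add_iff {f d w u : L2 C3} {κ : ℂ} {g : ℂ → Fin 3 → ℂ}
    (hg : ∀ᵐ z ∂cellMeasure, ∀ i, w z i = g z i) :
    (∀ᵐ z ∂cellMeasure, ∀ i, f z i = d z i + g z i + κ * u z i) ↔ f = d + w + κ • u := by
  have h0 : ∀ᵐ z ∂cellMeasure, ∀ i, (d + w + κ • u : L2 C3) z i = d z i + g z i + κ * u z i := by
    filter_upwards [hg, Lp.coeFn_add (d + w) (κ • u), Lp.coeFn_add d w, Lp.coeFn_smul κ u]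
      with z h1 h2 h3 h4 i
    rw [h2, Pi.add_apply, h3, h4, Pi.add_apply, Pi.smul_apply, ← h1]
    simp
  constructor
  · intro h
    refine Lp.ext ?_
    filter_upwards [h, h0] with z h1 h2
    ext i
    rw [h1, h2]
  · rintro rfl
    exact h0

theorem isD_iff (U : Potential) {p t : ℤ} {s : ℝ} (ht : (p : ℝ) * s = t) {α β k : ℂ} {u f : L2 C3} :
    IsD U p s α β k u f ↔
      ∀ i n, (dvec n + k) * vc u i n + vc (Vv U p t α β u) i n = vc f i n := by
  simp only [IsD, ae_eq_add_add_iff (coeFn_Vv U ht α β u), isTwoDzbar_C3_iff]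
  constructor
  · rintro ⟨d, hd, rfl⟩ i n
    simp only [vc_add, vc_smul, hd]
    ring
  · intro h
    refine ⟨f - Vv U p t α β u - k • u, fun i n => ?_, by abel⟩
    simp only [vc_sub, vc_smul, ← h]
    ring

theorem isDStar_iff (U : Potential) {p t : ℤ} {s : ℝ} (ht : (p : ℝ) * s = t) {α β k : ℂ}
    {u f : L2 C3} : IsDStar U p s α β k u f ↔ ∀ i n, conj (dvec n + k) * vc u i n
      + vc (ContinuousLinearMap.adjoint (Vv U p t α β) u) i n = vc f i n := by
  simp only [IsDStar, ae_eq_add_add_iff (coeFn_adjoint_Vv U ht α β u), isTwoDz_C3_iff]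
  constructor
  · rintro ⟨d, hd, rfl⟩ i n
    simp only [vc_add, vc_smul, hd, map_add]
    ring
  · intro h
    refine ⟨f - ContinuousLinearMap.adjoint (Vv U p t α β) u - conj k • u, fun i n => ?_, by abel⟩
    simp only [vc_sub, vc_smul, ← h, map_add]
    ring

/-! ### The space `L²₀` in terms of Fourier coefficients -/

/-- The residue classes modulo `3` of the frequencies of the components of functions in `L²₀`. -/
def cls (p q : ℤ) : Fin 3 → ℤ := ![-p, 0, q]

/-- Both coordinates of `n` are congruent to `c` modulo `3`. -/
def InCls (c : ℤ) (n : Fin 2 → ℤ) : Prop := (3 : ℤ) ∣ n 0 - c ∧ (3 : ℤ) ∣ n 1 - c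

theorem twist_eq (p q a b : ℤ) (i : Fin 3) : twist p q a b i = omega ^ (-(cls p q i * (a + b))) := by
  fin_cases i
  · simp [twist, cls]
  · simp [twist, cls]
  · simp [twist, cls, conj_omega]

theorem mem_L20_iff_pull {p q : ℤ} {u : L2 C3} : u ∈ L20 p q ↔ ∀ (a b : ℤ) (i : Fin 3),
    omega ^ (-(cls p q i * (a + b))) • pull (isCellSymm_add (moireVec a b)) (cp i u) = cp i u := by
  have hcp : ∀ᵐ z ∂cellMeasure, ∀ i, cp i u z = u z i := ae_all_iff.2 fun i => coeFn_cp i u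
  have hcp' : ∀ a b : ℤ, ∀ᵐ z ∂cellMeasure, ∀ i,
      cp i u (red (z + moireVec a b)) = u (red (z + moireVec a b)) i := fun a b =>
    (isCellSymm_add (moireVec a b)).measurePreserving_red.quasiMeasurePreserving.ae hcp
  have hL : ∀ a b : ℤ, ∀ᵐ z ∂cellMeasure, ∀ i,
      (omega ^ (-(cls p q i * (a + b))) • pull (isCellSymm_add (moireVec a b)) (cp i u) : L2 ℂ) z
        = omega ^ (-(cls p q i * (a + b))) * u (red (z + moireVec a b)) i := by
    intro a b
    refine ae_all_iff.2 fun i => ?_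
    filter_upwards [Lp.coeFn_smul (omega ^ (-(cls p q i * (a + b))))
      (pull (isCellSymm_add (moireVec a b)) (cp i u)), hcp' a b,
      coeFn_pull (isCellSymm_add (moireVec a b)) (cp i u)] with z h1 h2 h3
    rw [h1, Pi.smul_apply, h3, h2, smul_eq_mul]
  constructor
  · intro hu a b i
    have h1 : ∀ᵐ z ∂cellMeasure, ∀ a b : ℤ, z + moireVec a b ∈ cell →
        ∀ i, twist p q a b i * u (z + moireVec a b) i = u z i :=
      ae_all_iff.2 fun a => ae_all_iff.2 fun b => hu a b
    refine Lp.ext ?_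
    filter_upwards [h1, hcp, hL a b] with z h2 h3 h4
    rw [h4, h3]
    obtain ⟨m, n, hmn⟩ := exists_red_eq (z + moireVec a b)
    -- The definition of `L20` only compares points of the cell. Reducing `z + a` changes `a` by a
    -- vector of `Γ`, which leaves the twist unchanged since `ω³ = 1`.
    have h5 : red (z + moireVec a b) = z + moireVec (a + 3 * m) (b + 3 * n) := by
      rw [hmn, ← moireVec_three]
      simp only [moireVec]
      push_cast
      ring
    have h6 := h2 (a + 3 * m) (b + 3 * n) (h5 ▸ red_mem _) i
    rw [← h5, twist_eq] at h6
    rw [← h6]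
    congr 1
    rw [show -(cls p q i * (a + 3 * m + (b + 3 * n))) = -(cls p q i * (a + b))
      + 3 * -(cls p q i * (m + n)) by ring, zpow_add₀ omega_ne_zero,
      (omega_zpow_eq_one_iff (3 * -(cls p q i * (m + n)))).2 ⟨_, rfl⟩, mul_one]
  · intro h a b
    filter_upwards [hL a b, hcp] with z h1 h2 hz i
    rw [← h2, ← h a b i, h1, twist_eq, red_eq_self hz]

/-- Translation by `moireVec a b` multiplies the mode `n` by `ω ^ (a n₀ + b n₁)`, so the twisted
invariance is a congruence modulo 3, tested on the two generators. -/
theorem mem_L20_iff {p q : ℤ} {u : L2 C3} :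
    u ∈ L20 p q ↔ ∀ i n, vc u i n ≠ 0 → InCls (cls p q i) n := by
  have key : ∀ a b i n, vc u i n ≠ 0 → (fc (omega ^ (-(cls p q i * (a + b))) •
      pull (isCellSymm_add (moireVec a b)) (cp i u)) n = vc u i n ↔
      (3 : ℤ) ∣ a * (n 0 - cls p q i) + b * (n 1 - cls p q i)) := by
    intro a b i n hn
    rw [fc_smul, fc_pull_add, ch_moireVec, ← mul_assoc, ← zpow_add₀ omega_ne_zero,
      ← omega_zpow_eq_one_iff, ← vc, mul_eq_right₀ hn]
    ring_nf
  rw [mem_L20_iff_pull]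
  constructor
  · intro h i n hn
    have h0 := (key 1 0 i n hn).1 (by rw [h]; rfl)
    have h1 := (key 0 1 i n hn).1 (by rw [h]; rfl)
    simp only [one_mul, zero_mul, add_zero, zero_add] at h0 h1
    exact ⟨h0, h1⟩
  · intro h a b i
    refine fc_ext fun n => ?_
    by_cases hn : vc u i n = 0
    · rw [fc_smul, fc_pull_add, ← vc, hn]
      simp
    · exact (key a b i n hn).2 (dvd_add ((h i n hn).1.mul_left _) ((h i n hn).2.mul_left _))

theorem isClosed_L20 (p q : ℤ) : IsClosed (L20 p q : Set (L2 C3)) := by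
  have h : (L20 p q : Set (L2 C3))
      = ⋂ i, ⋂ n, ⋂ (_ : ¬ InCls (cls p q i) n), {u | vc u i n = 0} := by
    ext u
    simp only [SetLike.mem_coe, mem_L20_iff, Set.mem_iInter, Set.mem_ofPred_eq]
    exact forall_congr' fun i => forall_congr' fun n => not_imp_comm
  rw [h]
  refine isClosed_iInter fun i => isClosed_iInter fun n => isClosed_iInter fun _ => ?_
  have hc : Continuous fun u => vc u i n := by
    simp only [vc, ← fcL_apply]
    exact ((fcL n).comp (cp i)).continuous
  exact isClosed_singleton.preimage hc

/-- The projection onto the sector of frequencies congruent to those of `L²₀` shifted by `r`. -/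
def secProj (p q : ℤ) (r : Fin 2 → ℤ) (u : L2 C3) : L2 C3 :=
  ∑ i, inc i (modeProj (fun n => InCls (cls p q i) (n - r)) (cp i u))

theorem cp_secProj (p q : ℤ) (r : Fin 2 → ℤ) (u : L2 C3) (i : Fin 3) :
    cp i (secProj p q r u) = modeProj (fun n => InCls (cls p q i) (n - r)) (cp i u) :=
  cp_sum_inc _ i

open Classical in
theorem vc_secProj (p q : ℤ) (r : Fin 2 → ℤ) (u : L2 C3) (i : Fin 3) (n : Fin 2 → ℤ) :
    vc (secProj p q r u) i n = if InCls (cls p q i) (n - r) then vc u i n else 0 := by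
  rw [vc, cp_secProj, fc_modeProj, vc]

theorem mem_L20_iff_secProj {p q : ℤ} {u : L2 C3} : u ∈ L20 p q ↔ secProj p q 0 u = u := by
  classical
  rw [mem_L20_iff]
  constructor
  · intro h
    refine vc_ext fun i n => ?_
    rw [vc_secProj, sub_zero]
    split_ifs with h1
    · rfl
    · by_contra h2
      exact h1 (h i n (Ne.symm h2))
  · intro h i n hn
    rw [← h, vc_secProj, sub_zero] at hn
    by_contra h1
    simp [h1] at hn

theorem fcm_smul (c : ℂ) (g : Linf) (n : Fin 2 → ℤ) : fcm (c • g) n = c * fcm g n := by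
  rw [fcm, fcm, mulInf, mulInf, map_smul, smul_apply, fc_smul]

/-- The entry `(i, j)` shifts frequencies exactly by the difference of the classes of the
components. For the entries of scale `±t` this is where `t ≡ q` modulo 3 enters. -/
theorem fcm_potEntry_ne_zero (U : Potential) {p q t : ℤ} (htq : (3 : ℤ) ∣ t - q) {α β : ℂ}
    {i j : Fin 3} {n : Fin 2 → ℤ} (h : fcm (potEntry U p t α β i j) n ≠ 0) :
    InCls (cls p q i - cls p q j) n := by
  rw [potEntry, fcm_smul, fcm_ofCont] at h
  have h1 := U.fcc_scaled_ne_zero (right_ne_zero_of_mul (right_ne_zero_of_mul h))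
  have h2 := left_ne_zero_of_mul h
  revert h1 h2
  rw [InCls]
  fin_cases i <;> fin_cases j <;> simp [potCoef, potScale, cls] <;> omega

theorem modeProj_potEntry (U : Potential) {p q t : ℤ} (htq : (3 : ℤ) ∣ t - q) (α β : ℂ)
    (r : Fin 2 → ℤ) (i j : Fin 3) (u : L2 ℂ) :
    modeProj (fun n => InCls (cls p q i) (n - r)) (mulInf (potEntry U p t α β i j) u)
      = mulInf (potEntry U p t α β i j) (modeProj (fun n => InCls (cls p q j) (n - r)) u) := by
  refine modeProj_mulInf (fun n m h => ?_) u
  have h1 := fcm_potEntry_ne_zero U htq h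
  simp only [InCls, Pi.sub_apply] at h1 ⊢
  omega

theorem secProj_Vv (U : Potential) {p q t : ℤ} (htq : (3 : ℤ) ∣ t - q) (α β : ℂ)
    (r : Fin 2 → ℤ) (u : L2 C3) :
    secProj p q r (Vv U p t α β u) = Vv U p t α β (secProj p q r u) := by
  refine cp_ext fun i => ?_
  rw [cp_secProj, Vv, cp_matOp, cp_matOp, map_sum]
  exact Finset.sum_congr rfl fun j _ => by rw [modeProj_potEntry U htq, cp_secProj]

theorem Vv_mem_L20 (U : Potential) {p q t : ℤ} (htq : (3 : ℤ) ∣ t - q) (α β : ℂ) {u : L2 C3}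
    (hu : u ∈ L20 p q) : Vv U p t α β u ∈ L20 p q := by
  rw [mem_L20_iff_secProj] at hu ⊢
  rw [secProj_Vv U htq, hu]

theorem inner_eq_zero_of_vc {u v : L2 C3} (h : ∀ i n, vc u i n = 0 ∨ vc v i n = 0) :
    inner ℂ u v = 0 := by
  rw [inner_eq_sum]
  refine Finset.sum_eq_zero fun i _ => ?_
  rw [← fb.tsum_inner_mul_inner]
  refine (tsum_congr fun n => ?_).trans tsum_zero
  rw [← inner_conj_symm, ← fc_eq_inner, ← fc_eq_inner]
  rcases h i n with h | h
  · rw [vc] at h; rw [h]; simp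
  · rw [vc] at h; rw [h]; simp

/-- A coefficient of the adjoint is the inner product of `u` with the potential applied to a single
mode; for a mode outside the class the two have disjoint Fourier supports. -/
theorem adjoint_Vv_mem_L20 (U : Potential) {p q t : ℤ} (htq : (3 : ℤ) ∣ t - q) (α β : ℂ)
    {u : L2 C3} (hu : u ∈ L20 p q) : ContinuousLinearMap.adjoint (Vv U p t α β) u ∈ L20 p q := by
  rw [mem_L20_iff] at hu ⊢
  intro i n hn
  by_contra h
  refine hn ?_
  rw [vc_eq_inner, ContinuousLinearMap.adjoint_inner_right]
  refine inner_eq_zero_of_vc fun j m => ?_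
  by_contra h1
  rw [not_or] at h1
  have h2 := hu j m h1.2
  have h3 := h1.1
  rw [vc, Vv, cp_matOp] at h3
  simp only [cp_inc, apply_ite, map_zero, Finset.sum_ite_eq', Finset.mem_univ, if_true,
    fc_mulInf_fb] at h3
  have h4 := fcm_potEntry_ne_zero U htq h3
  refine h ?_
  simp only [InCls, Pi.sub_apply] at h2 h4 ⊢
  omega

/-! ### Resolvents of the free operator on `ℂ³`-valued functions -/

/-- The free resolvent on `ℂ³`-valued functions. -/
def Rv (k : ℂ) : L2 C3 →L[ℂ] L2 C3 := diagOp (Rf k)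

theorem vc_Rv (k : ℂ) (u : L2 C3) (i n) : vc (Rv k u) i n = (dvec n + k)⁻¹ * vc u i n := by
  rw [vc, Rv, cp_diagOp, fc_Rf, vc]

theorem vc_adjoint_Rv (k : ℂ) (u : L2 C3) (i n) :
    vc (ContinuousLinearMap.adjoint (Rv k) u) i n = (conj (dvec n + k))⁻¹ * vc u i n := by
  rw [Rv, Rf, vc_adjoint_diagOp_mult (bddSymbol_of_tendsto (tendsto_rsym k)), rsym, map_inv₀]

theorem mem_L20_of_vc_mul {p q : ℤ} {u v : L2 C3} {m : (Fin 2 → ℤ) → ℂ}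
    (h : ∀ i n, vc v i n = m n * vc u i n) (hu : u ∈ L20 p q) : v ∈ L20 p q := by
  rw [mem_L20_iff] at hu ⊢
  exact fun i n hn => hu i n (right_ne_zero_of_mul (h i n ▸ hn))

theorem isCompactOperator_diagOp {T : L2 ℂ →L[ℂ] L2 ℂ} (hT : IsCompactOperator T) :
    IsCompactOperator (diagOp T) := by
  have h : ∀ i, IsCompactOperator (inc i ∘L T ∘L cp i) := fun i =>
    (hT.comp_clm (cp i)).clm_comp (inc i)
  have h2 : diagOp T = (inc 0 ∘L T ∘L cp 0 + inc 1 ∘L T ∘L cp 1) + inc 2 ∘L T ∘L cp 2 := by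
    rw [diagOp, Fin.sum_univ_three]
  rw [h2]
  exact ((h 0).add (h 1)).add (h 2)

theorem isCompactOperator_Rv (k : ℂ) : IsCompactOperator (Rv k) :=
  isCompactOperator_diagOp (isCompactOperator_Rf k)

theorem isCompactOperator_adjoint_Rv (k : ℂ) :
    IsCompactOperator (ContinuousLinearMap.adjoint (Rv k)) := by
  have ht : Tendsto (fun n => conj (rsym k n)) cofinite (𝓝 0) := by
    have := (Complex.continuous_conj.tendsto 0).comp (tendsto_rsym k)
    rwa [map_zero] at this
  have h : ContinuousLinearMap.adjoint (Rv k) = diagOp (mult fun n => conj (rsym k n)) := by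
    ext1 u
    refine vc_ext fun i n => ?_
    rw [vc_adjoint_Rv, vc, vc, cp_diagOp, fc_mult (bddSymbol_of_tendsto ht), rsym, map_inv₀]
  rw [h]
  exact isCompactOperator_diagOp (isCompactOperator_mult ht)

theorem free_eq_iff {k : ℂ} (hk : k ∉ dualLattice) {u f w : L2 C3} :
    (∀ i n, (dvec n + k) * vc u i n + vc w i n = vc f i n) ↔ u + Rv k w = Rv k f := by
  constructor
  · intro h
    refine vc_ext fun i n => ?_
    have := dvec_add_ne_zero hk n
    rw [vc_add, vc_Rv, vc_Rv, ← h]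
    field_simp
  · intro h i n
    have h1 : vc (u + Rv k w) i n = vc (Rv k f) i n := by rw [h]
    have := dvec_add_ne_zero hk n
    rw [vc_add, vc_Rv, vc_Rv] at h1
    field_simp at h1
    rw [mul_comm]
    exact h1

theorem free_star_eq_iff {k : ℂ} (hk : k ∉ dualLattice) {u f w : L2 C3} :
    (∀ i n, conj (dvec n + k) * vc u i n + vc w i n = vc f i n) ↔
      u + ContinuousLinearMap.adjoint (Rv k) w = ContinuousLinearMap.adjoint (Rv k) f := by
  have h0 : ∀ n, conj (dvec n + k) ≠ 0 := fun n => by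
    rw [Ne, map_eq_zero]; exact dvec_add_ne_zero hk n
  constructor
  · intro h
    refine vc_ext fun i n => ?_
    have := h0 n
    rw [vc_add, vc_adjoint_Rv, vc_adjoint_Rv, ← h]
    field_simp
  · intro h i n
    have h1 : vc (u + ContinuousLinearMap.adjoint (Rv k) w) i n
      = vc (ContinuousLinearMap.adjoint (Rv k) f) i n := by rw [h]
    have := h0 n
    rw [vc_add, vc_adjoint_Rv, vc_adjoint_Rv] at h1
    field_simp at h1
    rw [mul_comm]
    exact h1

/-! ### The Fredholm alternative on invariant subspaces -/

/-- Riesz–Schauder theory for the restriction of `K` to `X`: the number `-1` is an eigenvalue, which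
`hinj` excludes, or it lies in the resolvent set. -/
theorem fredholm_on {E : Type*} [NormedAddCommGroup E] [NormedSpace ℂ E] [CompleteSpace E]
    {K : E →L[ℂ] E} (hK : IsCompactOperator K) {X : Submodule ℂ E} (hX : IsClosed (X : Set E))
    (hKX : ∀ x ∈ X, K x ∈ X) (hinj : ∀ x ∈ X, x + K x = 0 → x = 0) :
    ∃ S : X →L[ℂ] X, ∀ x y : X, (x : E) + K x = y ↔ x = S y := by
  have : CompleteSpace X := hX.completeSpace_coe
  let K' : X →L[ℂ] X := (K ∘L X.subtypeL).codRestrict X fun x => hKX x x.2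
  have hK' : IsCompactOperator K' := (hK.comp_clm X.subtypeL).codRestrict (fun x => hKX x x.2) hX
  rcases hK'.hasEigenvalue_or_mem_resolventSet (μ := (-1 : ℂ)) (by simp) with h | h
  · obtain ⟨x, hx⟩ := h.exists_hasEigenvector
    have h1 : K' x = (-1 : ℂ) • x := hx.apply_eq_smul
    have h2 : K x = -(x : E) := by
      have h3 : K x = ((-1 : ℂ) • x : X) := congrArg Subtype.val h1
      simpa using h3
    exact absurd (Subtype.ext (hinj x x.2 (by rw [h2, add_neg_cancel]))) hx.2
  · rw [spectrum.mem_resolventSet_iff] at h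
    obtain ⟨T, hT⟩ := h
    have hTx : ∀ x : X, (T : X →L[ℂ] X) x = -(x + K' x) := fun x => by
      rw [hT]
      simp [sub_eq_add_neg, add_comm]
    have h1 : ∀ x, ((T⁻¹ : (X →L[ℂ] X)ˣ) : X →L[ℂ] X) ((T : X →L[ℂ] X) x) = x := fun x =>
      DFunLike.congr_fun T.inv_mul x
    have h2 : ∀ x, (T : X →L[ℂ] X) (((T⁻¹ : (X →L[ℂ] X)ˣ) : X →L[ℂ] X) x) = x := fun x =>
      DFunLike.congr_fun T.mul_inv x
    refine ⟨-((T⁻¹ : (X →L[ℂ] X)ˣ) : X →L[ℂ] X), fun x y => ?_⟩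
    have h3 : (x : E) + K x = y ↔ x + K' x = y := by
      rw [← Subtype.coe_inj]; rfl
    rw [h3, neg_apply]
    constructor
    · rintro rfl
      rw [← map_neg, ← hTx, h1]
    · intro h
      have := h2 (-y)
      rw [map_neg, ← h, hTx] at this
      exact neg_inj.1 this

/-- Surjectivity of `1 + A V` implies that of `1 + V A`, whose adjoint is `1 + A* V*`; the adjoint
of a surjective operator is injective. -/
theorem adjoint_injective_of_surjective {E : Type*} [NormedAddCommGroup E] [InnerProductSpace ℂ E]
    [CompleteSpace E] {A V : E →L[ℂ] E} (h : ∀ y, ∃ x, x + A (V x) = y) {x : E}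
    (hx : x + ContinuousLinearMap.adjoint A (ContinuousLinearMap.adjoint V x) = 0) : x = 0 := by
  obtain ⟨v, hv⟩ := h (A x)
  -- Since `A (x - V v) = v`, the vector `x - V v` is a preimage of `x` under `1 + V A`.
  have h1 : (x - V v) + V (A (x - V v)) = x := by
    have : A (x - V v) = v := by rw [map_sub, ← hv, add_sub_cancel_right]
    rw [this, sub_add_cancel]
  have h2 : inner ℂ x x = 0 := by
    have h3 : inner ℂ (x + ContinuousLinearMap.adjoint A (ContinuousLinearMap.adjoint V x))
      (x - V v) = 0 := by rw [hx, inner_zero_left]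
    rw [inner_add_left, ContinuousLinearMap.adjoint_inner_left,
      ContinuousLinearMap.adjoint_inner_left, ← inner_add_right, h1] at h3
    exact h3
  exact inner_self_eq_zero.1 h2

/-! ### The kernel of `D(α) + k` and the Birman–Schwinger operator -/

/-- `(D(α) + k) u = 0`, in terms of Fourier coefficients. -/
def InKer (U : Potential) (p t : ℤ) (α β k : ℂ) (u : L2 C3) : Prop :=
  ∀ i n, (dvec n + k) * vc u i n + vc (Vv U p t α β u) i n = 0

theorem inKer_iff (U : Potential) {p t : ℤ} {α β k : ℂ} (hk : k ∉ dualLattice) {u : L2 C3} :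
    InKer U p t α β k u ↔ u + Rv k (Vv U p t α β u) = 0 := by
  have h := free_eq_iff hk (u := u) (f := 0) (w := Vv U p t α β u)
  simp only [vc_zero, map_zero] at h
  exact h

theorem inKer_iff_isD (U : Potential) {p t : ℤ} {s : ℝ} (ht : (p : ℝ) * s = t) {α β k : ℂ}
    {u : L2 C3} : InKer U p t α β k u ↔ IsD U p s α β k u 0 := by
  rw [isD_iff U ht]
  simp only [InKer, vc_zero]

/-- Multiplication by `U(c z)` for integral `c`. -/
def mulZ (U : Potential) (c : ℤ) : L2 ℂ →L[ℂ] L2 ℂ := mulInf (ofCont (U.continuous_scaled c))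

theorem mulU_eq (U : Potential) {c : ℝ} {m : ℤ} (h : c = m) : mulU U c = mulZ U m := by
  subst h; rfl

theorem birmanSchwinger_eq (U : Potential) {p t : ℤ} {s : ℝ} (ht : (p : ℝ) * s = t) {k : ℂ}
    (hk : k ∉ dualLattice) (τ : ℂ) :
    birmanSchwinger U p s k τ = Rf k ∘L mulZ U (-p) ∘L Rf k ∘L mulZ U p +
      τ ^ 2 • (Rf k ∘L mulZ U t ∘L Rf k ∘L mulZ U (-t)) := by
  rw [birmanSchwinger, R_eq_Rf hk, mulU_eq U (m := -p) (by push_cast; rfl), mulU_eq U (m := p) rfl,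
    mulU_eq U ht, mulU_eq U (m := -t) (by rw [ht]; push_cast; rfl)]

theorem isCompactOperator_birmanSchwinger (U : Potential) {p t : ℤ} {s : ℝ} (ht : (p : ℝ) * s = t)
    {k : ℂ} (hk : k ∉ dualLattice) (τ : ℂ) : IsCompactOperator (birmanSchwinger U p s k τ) := by
  rw [birmanSchwinger_eq U ht hk]
  exact ((isCompactOperator_Rf k).comp_clm (mulZ U (-p) ∘L Rf k ∘L mulZ U p)).add
    (((isCompactOperator_Rf k).comp_clm (mulZ U t ∘L Rf k ∘L mulZ U (-t))).smul (τ ^ 2))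

theorem mulInf_smul (c : ℂ) (g : Linf) (u : L2 ℂ) : mulInf (c • g) u = c • mulInf g u := by
  rw [mulInf, mulInf, map_smul, smul_apply]

theorem mulInf_potEntry (U : Potential) (p t : ℤ) (α β : ℂ) (i j : Fin 3) (u : L2 ℂ) :
    mulInf (potEntry U p t α β i j) u
      = potCoef α β i j • mulZ U (potScale p t i j) u := mulInf_smul _ _ _

theorem cp_zero_Vv (U : Potential) (p t : ℤ) (α β : ℂ) (u : L2 C3) :
    cp 0 (Vv U p t α β u) = α • mulZ U p (cp 1 u) := by
  rw [Vv, cp_matOp, Fin.sum_univ_three]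
  simp [mulInf_potEntry, potCoef, potScale]

theorem cp_one_Vv (U : Potential) (p t : ℤ) (α β : ℂ) (u : L2 C3) :
    cp 1 (Vv U p t α β u) = α • mulZ U (-p) (cp 0 u) + β • mulZ U t (cp 2 u) := by
  rw [Vv, cp_matOp, Fin.sum_univ_three]
  simp [mulInf_potEntry, potCoef, potScale]

theorem cp_two_Vv (U : Potential) (p t : ℤ) (α β : ℂ) (u : L2 C3) :
    cp 2 (Vv U p t α β u) = β • mulZ U (-t) (cp 1 u) := by
  rw [Vv, cp_matOp, Fin.sum_univ_three]
  simp [mulInf_potEntry, potCoef, potScale]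

/-- Schur complement: the first and third rows determine the outer components from the middle one,
and the second row is then the eigenvalue equation. By compactness, nonzero spectral points are
eigenvalues. -/
theorem exists_inKer_iff_mem_spectrum (U : Potential) {p t : ℤ} {s : ℝ} (ht : (p : ℝ) * s = t)
    {α β k : ℂ} (hα : α ≠ 0) (hk : k ∉ dualLattice) :
    (∃ u, u ≠ 0 ∧ InKer U p t α β k u) ↔
      1 / α ^ 2 ∈ spectrum ℂ (birmanSchwinger U p s k (β / α)) := by
  have hα2 : α ^ 2 ≠ 0 := pow_ne_zero 2 hα
  rw [← (isCompactOperator_birmanSchwinger U ht hk _).hasEigenvalue_iff_mem_spectrum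
    (one_div_ne_zero hα2)]
  have hB : ∀ w, α ^ 2 • birmanSchwinger U p s k (β / α) w
      = α ^ 2 • Rf k (mulZ U (-p) (Rf k (mulZ U p w)))
        + β ^ 2 • Rf k (mulZ U t (Rf k (mulZ U (-t) w))) := by
    intro w
    rw [birmanSchwinger_eq U ht hk]
    simp only [add_apply, smul_apply, ContinuousLinearMap.comp_apply, smul_add, smul_smul]
    congr 2
    field_simp
  have heq : ∀ w, (α ^ 2 • birmanSchwinger U p s k (β / α) w = w) ↔
      birmanSchwinger U p s k (β / α) w = (1 / α ^ 2) • w := by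
    intro w
    rw [one_div, eq_inv_smul_iff₀ hα2]
  constructor
  · rintro ⟨u, hu0, hu⟩
    rw [inKer_iff U hk] at hu
    have hc : ∀ i, cp i u = -Rf k (cp i (Vv U p t α β u)) := by
      intro i
      have h1 : cp i (u + Rv k (Vv U p t α β u)) = 0 := by rw [hu, map_zero]
      rw [map_add, Rv, cp_diagOp] at h1
      exact eq_neg_of_add_eq_zero_left h1
    have h0 := hc 0
    have h1 := hc 1
    have h2 := hc 2
    rw [cp_zero_Vv, map_smul] at h0
    rw [cp_two_Vv, map_smul] at h2
    rw [cp_one_Vv, h0, h2] at h1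
    refine Module.End.hasEigenvalue_of_hasEigenvector (x := cp 1 u) ⟨?_, ?_⟩
    · rw [Module.End.mem_eigenspace_iff]
      refine (heq _).1 ?_
      rw [hB]
      conv_rhs => rw [h1]
      simp only [map_add, map_neg, map_smul, smul_neg, smul_smul, neg_add, neg_neg, sq]
    · intro h
      refine hu0 (cp_ext fun i => ?_)
      rw [map_zero]
      fin_cases i
      · change cp 0 u = 0
        rw [h0, h]; simp
      · exact h
      · change cp 2 u = 0
        rw [h2, h]; simp
  · intro h
    obtain ⟨w, hw⟩ := h.exists_hasEigenvector
    have hw1 : birmanSchwinger U p s k (β / α) w = (1 / α ^ 2) • w := hw.apply_eq_smul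
    rw [← heq, hB] at hw1
    let f : Fin 3 → L2 ℂ := ![-(α • Rf k (mulZ U p w)), w, -(β • Rf k (mulZ U (-t) w))]
    have hf : ∀ i, cp i (∑ j, inc j (f j)) = f i := cp_sum_inc f
    refine ⟨∑ j, inc j (f j), fun h0 => hw.2 ?_, (inKer_iff U hk).2 (cp_ext fun i => ?_)⟩
    · have h1 := hf 1
      rw [h0, map_zero] at h1
      exact h1.symm
    · rw [map_add, Rv, cp_diagOp, map_zero]
      have f0 : cp 0 (∑ j, inc j (f j)) = -(α • Rf k (mulZ U p w)) := hf 0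
      have f1 : cp 1 (∑ j, inc j (f j)) = w := hf 1
      have f2 : cp 2 (∑ j, inc j (f j)) = -(β • Rf k (mulZ U (-t) w)) := hf 2
      fin_cases i
      · change cp 0 _ + Rf k (cp 0 _) = 0
        rw [cp_zero_Vv, f0, f1, map_smul, neg_add_cancel]
      · change cp 1 _ + Rf k (cp 1 _) = 0
        rw [cp_one_Vv, f0, f1, f2]
        simp only [map_add, map_neg, map_smul, smul_neg, smul_smul, ← sq]
        nth_rewrite 1 [← hw1]
        abel
      · change cp 2 _ + Rf k (cp 2 _) = 0
        rw [cp_two_Vv, f1, f2, map_smul, neg_add_cancel]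

/-! ### Magic parameters and the kernel of `D(α) + k` -/

/-- Zero is a lower bound by definition, so `E₁ = 0` only says that `0` is in the spectrum. -/
theorem isMagic_iff {U : Potential} {p q : ℤ} {s : ℝ} {α β : ℂ} :
    IsMagic U p q s α β ↔
      ∀ k, ¬ ∃ T : L20six p q →L[ℂ] L20six p q, IsBoundedInverse (IsHam U p q s α β k) T := by
  refine forall_congr' fun k => ?_
  have h : (fun u f => IsHam U p q s α β k u (f + (0 : ℂ) • u)) = IsHam U p q s α β k := by
    funext u f
    rw [zero_smul, add_zero]
  constructor
  · rintro ⟨⟨-, h1⟩, -⟩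
    rw [Complex.ofReal_zero] at h1
    change ¬ _ at h1
    rwa [h] at h1
  · intro h1
    refine ⟨⟨le_rfl, ?_⟩, fun E hE => hE.1⟩
    rw [Complex.ofReal_zero]
    change ¬ _
    rwa [h]

theorem isMagic_of_inKer {U : Potential} {p q t : ℤ} {s : ℝ} (ht : (p : ℝ) * s = t) {α β : ℂ}
    (h : ∀ k, ∃ u ∈ L20 p q, u ≠ 0 ∧ InKer U p t α β k u) : IsMagic U p q s α β := by
  rw [isMagic_iff]
  rintro k ⟨T, hT⟩
  obtain ⟨u, hu, hu0, hk⟩ := h k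
  have h0 : IsDStar U p s α β k 0 0 := by
    rw [isDStar_iff U ht]
    simp
  have h1 : WithLp.toLp 2 ((⟨u, hu⟩ : L20 p q), (0 : L20 p q)) = T 0 :=
    (hT _ _).1 ⟨h0, (inKer_iff_isD U ht).1 hk⟩
  rw [map_zero] at h1
  have h2 : (⟨u, hu⟩ : L20 p q) = 0 := congrArg WithLp.fst h1
  exact hu0 (congrArg Subtype.val h2)

/-- By contraposition: if `D(α) + k` is injective, `1 + Rv k V` and its counterpart for the adjoint
are invertible on `L²₀`, and the two inverses assemble into an inverse of `H_k`. -/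
theorem exists_inKer_of_isMagic {U : Potential} {p q t : ℤ} {s : ℝ} (ht : (p : ℝ) * s = t)
    (htq : (3 : ℤ) ∣ t - q) {α β : ℂ} (h : IsMagic U p q s α β) {k : ℂ} (hk : k ∉ dualLattice) :
    ∃ u, u ≠ 0 ∧ InKer U p t α β k u := by
  by_contra hcon
  push Not at hcon
  rw [isMagic_iff] at h
  refine h k ?_
  set V := Vv U p t α β with hV
  have hinj : ∀ x, x + Rv k (V x) = 0 → x = 0 := by
    intro x hx
    by_contra h0
    exact hcon x h0 ((inKer_iff U hk).2 hx)
  have hcomp : IsCompactOperator (Rv k ∘L V) := (isCompactOperator_Rv k).comp_clm V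
  have hcomp' : IsCompactOperator
      (ContinuousLinearMap.adjoint (Rv k) ∘L ContinuousLinearMap.adjoint V) :=
    (isCompactOperator_adjoint_Rv k).comp_clm _
  -- Surjectivity is needed on the whole space, because the adjoint is taken in `L2 C3` and not in
  -- `L20`.
  have hsurj : ∀ y, ∃ x, x + Rv k (V x) = y := by
    intro y
    obtain ⟨S, hS⟩ := fredholm_on hcomp (X := ⊤) isClosed_univ (fun _ _ => trivial)
      (fun x _ => hinj x)
    exact ⟨S ⟨y, trivial⟩, (hS _ ⟨y, trivial⟩).2 rfl⟩
  have hR : ∀ x ∈ L20 p q, Rv k x ∈ L20 p q := fun x hx => mem_L20_of_vc_mul (vc_Rv k x) hx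
  have hR' : ∀ x ∈ L20 p q, ContinuousLinearMap.adjoint (Rv k) x ∈ L20 p q := fun x hx =>
    mem_L20_of_vc_mul (vc_adjoint_Rv k x) hx
  obtain ⟨S, hS⟩ := fredholm_on hcomp (isClosed_L20 p q)
    (fun x hx => hR _ (Vv_mem_L20 U htq α β hx)) (fun x _ => hinj x)
  obtain ⟨S', hS'⟩ := fredholm_on hcomp' (isClosed_L20 p q)
    (fun x hx => hR' _ (adjoint_Vv_mem_L20 U htq α β hx))
    (fun x _ hx => adjoint_injective_of_surjective hsurj hx)
  let r : L20 p q →L[ℂ] L20 p q :=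
    (Rv k ∘L (L20 p q).subtypeL).codRestrict (L20 p q) fun x => hR x x.2
  let r' : L20 p q →L[ℂ] L20 p q :=
    (ContinuousLinearMap.adjoint (Rv k) ∘L (L20 p q).subtypeL).codRestrict (L20 p q)
      fun x => hR' x x.2
  let e := WithLp.prodContinuousLinearEquiv 2 ℂ (L20 p q) (L20 p q)
  refine ⟨(e.symm : _ →L[ℂ] L20six p q) ∘L
    ((S ∘L r ∘L ContinuousLinearMap.snd ℂ _ _).prod (S' ∘L r' ∘L ContinuousLinearMap.fst ℂ _ _)) ∘L
      (e : L20six p q →L[ℂ] _), fun w g => ?_⟩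
  have h1 : IsD U p s α β k w.fst g.snd ↔ w.fst = S (r g.snd) := by
    rw [isD_iff U ht, free_eq_iff hk]
    exact hS w.fst (r g.snd)
  have h2 : IsDStar U p s α β k w.snd g.fst ↔ w.snd = S' (r' g.fst) := by
    rw [isDStar_iff U ht, free_star_eq_iff hk]
    exact hS' w.snd (r' g.fst)
  rw [IsHam, h1, h2]
  constructor
  · rintro ⟨a, b⟩
    refine e.injective ?_
    change (w.fst, w.snd) = (S (r g.snd), S' (r' g.fst))
    rw [← a, ← b]
  · rintro rfl
    exact ⟨rfl, rfl⟩

/-! ### Sectors and rotations -/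

theorem mulInf_comm (g h : Linf) (u : L2 ℂ) : mulInf g (mulInf h u) = mulInf h (mulInf g u) := by
  refine Lp.ext ?_
  filter_upwards [coeFn_mulInf g (mulInf h u), coeFn_mulInf h (mulInf g u), coeFn_mulInf g u,
    coeFn_mulInf h u] with z h1 h2 h3 h4
  rw [h1, h2, h3, h4]
  ring

theorem cp_Vv (U : Potential) (p t : ℤ) (α β : ℂ) (u : L2 C3) (i : Fin 3) :
    cp i (Vv U p t α β u) = ∑ j, mulInf (potEntry U p t α β i j) (cp j u) := cp_matOp _ _ _

theorem add_dvec_not_mem {k : ℂ} (hk : k ∉ dualLattice) (r : Fin 2 → ℤ) :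
    k + dvec r ∉ dualLattice := by
  rw [mem_dualLattice_iff] at hk ⊢
  rintro ⟨n, hn⟩
  exact hk ⟨n - r, by rw [dvec_sub, hn, add_sub_cancel_right]⟩

/-- The potential commutes with the sector projections, so a nonzero sector of `u` is again in the
kernel. Multiplying it by a character moves its frequencies into those of `L²₀` and shifts `k` by a
vector of `Γ*`. -/
theorem exists_mem_L20_inKer {U : Potential} {p q t : ℤ} (htq : (3 : ℤ) ∣ t - q) {α β k : ℂ}
    {u : L2 C3} (hu0 : u ≠ 0) (hu : InKer U p t α β k u) :
    ∃ r, ∃ v ∈ L20 p q, v ≠ 0 ∧ InKer U p t α β (k + dvec r) v := by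
  classical
  obtain ⟨i₀, n₀, h0⟩ : ∃ i n, vc u i n ≠ 0 := by
    by_contra h
    push Not at h
    exact hu0 (vc_ext fun i n => by rw [h, vc_zero])
  -- With this shift the sector contains the mode `n₀` of the component `i₀`, so the projection is
  -- nonzero.
  let r : Fin 2 → ℤ := fun j => n₀ j - cls p q i₀
  set w := secProj p q r u with hw
  let c := ofCont (continuous_ch (-r))
  have hv : ∀ i n, vc (diagOp (mulInf c) w) i n = vc w i (n + r) := by
    intro i n
    rw [vc, cp_diagOp, fc_mul_ch, sub_neg_eq_add, vc]
  have hVv : ∀ i n, vc (Vv U p t α β (diagOp (mulInf c) w)) i n = vc (Vv U p t α β w) i (n + r) := by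
    intro i n
    have h1 : Vv U p t α β (diagOp (mulInf c) w) = diagOp (mulInf c) (Vv U p t α β w) := by
      refine cp_ext fun i => ?_
      rw [cp_Vv, cp_diagOp, cp_Vv, map_sum]
      exact Finset.sum_congr rfl fun j _ => by rw [cp_diagOp, mulInf_comm]
    rw [h1, vc, cp_diagOp, fc_mul_ch, sub_neg_eq_add, vc]
  refine ⟨r, diagOp (mulInf c) w, mem_L20_iff.2 fun i n hn => ?_, fun h => ?_, fun i n => ?_⟩
  · rw [hv, hw, vc_secProj, add_sub_cancel_right] at hn
    by_contra h
    simp [h] at hn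
  · have h1 := hv i₀ (n₀ - r)
    rw [h, vc_zero, sub_add_cancel, hw, vc_secProj, if_pos] at h1
    · exact h0 h1.symm
    · constructor <;> simp [r]
  · rw [hv, hVv, hw, ← secProj_Vv U htq, vc_secProj, vc_secProj]
    split_ifs
    · have := hu i (n + r)
      rw [dvec_add] at this
      linear_combination this
    · ring

/-- Pull-back of `ℂ³`-valued functions by the rotation. -/
def OmV : L2 C3 →L[ℂ] L2 C3 := diagOp Om

theorem vc_OmV (u : L2 C3) (i n) : vc (OmV u) i n = vc u i (rot n) := by
  rw [vc, OmV, cp_diagOp, fc_Om, vc]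

theorem OmV_Vv (U : Potential) (p t : ℤ) (α β : ℂ) (u : L2 C3) :
    OmV (Vv U p t α β u) = omega • Vv U p t α β (OmV u) := by
  refine cp_ext fun i => ?_
  rw [OmV, cp_diagOp, map_smul, cp_Vv, cp_Vv, map_sum, Finset.smul_sum]
  refine Finset.sum_congr rfl fun j _ => ?_
  rw [cp_diagOp, mulInf_potEntry, mulInf_potEntry, map_smul, mulZ, U.Om_mul_scaled, smul_comm]

theorem rot_rot_rot (n : Fin 2 → ℤ) : rot (rot (rot n)) = n := by
  ext i
  fin_cases i
  · simp [rot]; ring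
  · simp [rot]

theorem OmV_ne_zero {u : L2 C3} (hu : u ≠ 0) : OmV u ≠ 0 := by
  intro h
  refine hu (vc_ext fun i n => ?_)
  have h1 := vc_OmV u i (rot (rot n))
  rw [h, rot_rot_rot] at h1
  rw [← h1, vc_zero, vc_zero]

theorem OmV_mem_L20 {p q : ℤ} {u : L2 C3} (hu : u ∈ L20 p q) : OmV u ∈ L20 p q := by
  rw [mem_L20_iff] at hu ⊢
  intro i n hn
  rw [vc_OmV] at hn
  have h := hu i _ hn
  simp only [InCls, rot, Matrix.cons_val_zero, Matrix.cons_val_one] at h ⊢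
  omega

/-- Under pull-back by the rotation both `2 D_{z̄}` and the potential acquire the factor `ω`;
dividing by it turns `k` into `ω⁻¹ k = ω² k`. -/
theorem inKer_OmV {U : Potential} {p t : ℤ} {α β k : ℂ} {u : L2 C3}
    (hu : InKer U p t α β k u) : InKer U p t α β (omega ^ 2 * k) (OmV u) := by
  intro i n
  have h1 := hu i (rot n)
  have h2 : vc (OmV (Vv U p t α β u)) i n = vc (Vv U p t α β u) i (rot n) := vc_OmV _ _ _
  rw [OmV_Vv, vc_smul] at h2
  rw [← h2, dvec_rot] at h1
  rw [vc_OmV]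
  linear_combination omega ^ 2 * h1 - (dvec n * vc u i (rot n) + vc (Vv U p t α β (OmV u)) i n) *
    omega_pow_three

/-- For all parameters, `D(α)` has a nonzero kernel on `L²₀`. -/
theorem exists_inKer_zero (U : Potential) {p q t : ℤ} (htq : (3 : ℤ) ∣ t - q) (α β : ℂ) :
    ∃ u ∈ L20 p q, u ≠ 0 ∧ InKer U p t α β 0 u := by
  let X : Submodule ℂ (L2 C3) := L20 p q ⊓ LinearMap.ker ((OmV - 1 : L2 C3 →L[ℂ] L2 C3)).toLinearMap
  have hmem : ∀ u, u ∈ X ↔ u ∈ L20 p q ∧ OmV u = u := by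
    intro u
    simp [X, sub_eq_zero]
  have hX : IsClosed (X : Set (L2 C3)) :=
    (isClosed_L20 p q).inter (OmV - 1 : L2 C3 →L[ℂ] L2 C3).isClosed_ker
  have hVrot : ∀ u ∈ X, ∀ i n, vc (Vv U p t α β u) i (rot n) = omega * vc (Vv U p t α β u) i n := by
    intro u hu i n
    rw [← vc_OmV, OmV_Vv, ((hmem u).1 hu).2, vc_smul]
  -- Frequency `0` is fixed by the rotation, so this coefficient equals `ω` times itself.
  have hV0 : ∀ u ∈ X, ∀ i, vc (Vv U p t α β u) i 0 = 0 := by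
    intro u hu i
    have h := hVrot u hu i 0
    rw [show rot 0 = 0 by ext i; fin_cases i <;> simp [rot]] at h
    have h1 : (1 - omega) * vc (Vv U p t α β u) i 0 = 0 := by linear_combination h
    exact (mul_eq_zero.1 h1).resolve_left (sub_ne_zero.2 omega_ne_one.symm)
  have hKX : ∀ u ∈ X, (Rv 0 ∘L Vv U p t α β) u ∈ X := by
    intro u hu
    rw [hmem]
    refine ⟨mem_L20_of_vc_mul (vc_Rv 0 _) (Vv_mem_L20 U htq α β ((hmem u).1 hu).1),
      vc_ext fun i n => ?_⟩
    rw [vc_OmV, ContinuousLinearMap.comp_apply, vc_Rv, vc_Rv, hVrot u hu, dvec_rot]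
    have := omega_ne_zero
    simp only [add_zero, mul_inv]
    field_simp
  have hcomp : IsCompactOperator (Rv 0 ∘L Vv U p t α β) := (isCompactOperator_Rv 0).comp_clm _
  -- Since `0⁻¹ = 0`, `Rv 0` drops the mode `n = 0` and inverts `2 D_{z̄}` on all others; by `hV0`
  -- the kernel equation at `n = 0` holds automatically.
  have hker : ∀ u ∈ X, (∀ i n, n ≠ 0 → vc (u + Rv 0 (Vv U p t α β u)) i n = 0) →
      InKer U p t α β 0 u := by
    intro u hu h i n
    by_cases hn : n = 0
    · rw [hn, dvec_zero, hV0 u hu]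
      ring
    · have hd : dvec n ≠ 0 := fun h => hn (dvec_injective (h.trans dvec_zero.symm))
      have h1 := h i n hn
      rw [vc_add, vc_Rv, add_zero] at h1
      rw [add_zero]
      field_simp at h1
      linear_combination h1
  -- A failure of injectivity is itself a kernel element. Otherwise solve `u + Rv 0 (V u) = e` with
  -- `e` constant in the middle component; `e` is rotation invariant, lies in `L²₀` and is
  -- annihilated by `2 D_{z̄}`.
  by_cases hinj : ∀ x ∈ X, x + (Rv 0 ∘L Vv U p t α β) x = 0 → x = 0
  · obtain ⟨S, hS⟩ := fredholm_on hcomp hX hKX hinj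
    have he : ∀ i n, vc (inc 1 (fb 0)) i n = if i = 1 ∧ n = 0 then 1 else 0 := by
      intro i n
      rw [vc, cp_inc]
      by_cases hi : i = 1 <;> simp [hi, fc_fb]
    have heX : inc 1 (fb 0) ∈ X := by
      rw [hmem]
      refine ⟨mem_L20_iff.2 fun i n hn => ?_, vc_ext fun i n => ?_⟩
      · rw [he] at hn
        obtain ⟨rfl, rfl⟩ : i = 1 ∧ n = 0 := by
          by_contra h
          simp [h] at hn
        simp [InCls, cls]
      · rw [vc_OmV, he, he]
        have : rot n = 0 ↔ n = 0 := by
          constructor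
          · intro h
            rw [← rot_rot_rot n, h]
            ext i; fin_cases i <;> simp [rot]
          · rintro rfl
            ext i; fin_cases i <;> simp [rot]
        simp only [this]
    have h1 := (hS (S ⟨_, heX⟩) ⟨_, heX⟩).2 rfl
    refine ⟨S ⟨_, heX⟩, ((hmem _).1 (S ⟨_, heX⟩).2).1, fun h0 => ?_,
      hker _ (S ⟨_, heX⟩).2 fun i n hn => ?_⟩
    · rw [h0, map_zero, add_zero] at h1
      have h3 : (0 : L2 C3) = inc 1 (fb 0) := h1
      have h2 := he 1 0
      rw [← h3] at h2
      simp at h2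
    · have h2 : (S ⟨_, heX⟩ : L2 C3) + Rv 0 (Vv U p t α β (S ⟨_, heX⟩ : L2 C3)) = inc 1 (fb 0) := h1
      rw [h2, he, if_neg fun h => hn h.2]
  · push Not at hinj
    obtain ⟨x, hx, hx1, hx0⟩ := hinj
    refine ⟨x, ((hmem x).1 hx).1, hx0, hker x hx fun i n _ => ?_⟩
    have h2 : x + Rv 0 (Vv U p t α β x) = 0 := hx1
    rw [h2, vc_zero]

/-! ### Stability of injectivity -/

theorem countable_dualLattice : dualLattice.Countable := by
  have h : dualLattice = Set.range dvec := by
    ext k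
    rw [mem_dualLattice_iff, Set.mem_range]
  rw [h]
  exact Set.countable_range _

theorem exists_not_mem_dualLattice : ∃ k, k ∉ dualLattice :=
  (countable_dualLattice.dense_compl ℝ).nonempty

/-- A kernel vector at `k` satisfies `u = S ((k₁ - k) A u)`, with `S` the inverse at `k₁`; close to
`k₁` the right side is a strict contraction. -/
theorem eventually_injective_of_compact {E : Type*} [NormedAddCommGroup E] [NormedSpace ℂ E]
    [CompleteSpace E] {A V : E →L[ℂ] E} (hA : IsCompactOperator A) {X : Submodule ℂ E}
    (hX : IsClosed (X : Set E)) (hAX : ∀ x ∈ X, A x ∈ X) (hVX : ∀ x ∈ X, V x ∈ X) {κ k₁ : ℂ}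
    (h : ∀ u ∈ X, u + A (V u + (k₁ - κ) • u) = 0 → u = 0) :
    ∀ᶠ k in 𝓝 k₁, ∀ u ∈ X, u + A (V u + (k - κ) • u) = 0 → u = 0 := by
  obtain ⟨S, hS⟩ := fredholm_on (K := A ∘L (V + (k₁ - κ) • 1)) (hA.comp_clm _) hX
    (fun x hx => hAX _ (X.add_mem (hVX x hx) (X.smul_mem _ hx))) h
  have hlim : Tendsto (fun k => ‖S‖ * (‖k₁ - k‖ * ‖A‖)) (𝓝 k₁) (𝓝 0) := by
    have hc : Continuous fun k => ‖S‖ * (‖k₁ - k‖ * ‖A‖) := by fun_prop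
    simpa using hc.tendsto k₁
  filter_upwards [hlim.eventually (gt_mem_nhds one_pos)] with k hk u hu hku
  have hy : (k₁ - k) • A u ∈ X := X.smul_mem _ (hAX u hu)
  have h1 : (⟨u, hu⟩ : X) = S ⟨_, hy⟩ := by
    rw [← hS]
    change u + A (V u + (k₁ - κ) • u) = (k₁ - k) • A u
    rw [map_add, map_smul] at hku ⊢
    have h2 : u + (A (V u) + (k₁ - κ) • A u)
        = (u + (A (V u) + (k - κ) • A u)) + (k₁ - k) • A u := by
      module
    rw [h2, hku, zero_add]
  have h2 : ‖u‖ ≤ ‖S‖ * (‖k₁ - k‖ * ‖A‖) * ‖u‖ := by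
    calc ‖u‖ = ‖(⟨u, hu⟩ : X)‖ := rfl
      _ = ‖S ⟨_, hy⟩‖ := by rw [← h1]
      _ ≤ ‖S‖ * ‖(k₁ - k) • A u‖ := S.le_opNorm _
      _ ≤ ‖S‖ * (‖k₁ - k‖ * (‖A‖ * ‖u‖)) := by
        rw [norm_smul]
        gcongr
        exact A.le_opNorm u
      _ = _ := by ring
  by_contra hu0
  have h3 : 0 < ‖u‖ := norm_pos_iff.2 hu0
  nlinarith

theorem eventually_injective (U : Potential) {p q t : ℤ} (htq : (3 : ℤ) ∣ t - q) {α β k₁ : ℂ}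
    (h : ∀ u ∈ L20 p q, InKer U p t α β k₁ u → u = 0) :
    ∀ᶠ k in 𝓝 k₁, ∀ u ∈ L20 p q, InKer U p t α β k u → u = 0 := by
  -- An auxiliary base point, since `k₁` itself may lie in `Γ*`.
  obtain ⟨κ, hκ⟩ := exists_not_mem_dualLattice
  have hiff : ∀ k u, InKer U p t α β k u ↔ u + Rv κ (Vv U p t α β u + (k - κ) • u) = 0 := by
    intro k u
    have h1 := free_eq_iff hκ (u := u) (f := 0) (w := Vv U p t α β u + (k - κ) • u)
    simp only [vc_zero, map_zero] at h1
    refine Iff.trans ?_ h1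
    refine forall_congr' fun i => forall_congr' fun n => ?_
    rw [vc_add, vc_smul]
    constructor <;> intro h <;> linear_combination h
  simp only [hiff] at h ⊢
  exact eventually_injective_of_compact (isCompactOperator_Rv κ) (isClosed_L20 p q)
    (fun x hx => mem_L20_of_vc_mul (vc_Rv κ x) hx) (fun x hx => Vv_mem_L20 U htq α β hx) h

/-! ### Boundedness of kernel elements -/

/-- Comparison with the lattice sum of `‖n‖⁻⁴`, which converges in dimension two. -/
theorem summable_norm_dvec_add {k : ℂ} : Summable fun n => (‖dvec n + k‖ ^ 4)⁻¹ := by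
  have h1 : Summable fun n : Fin 2 → ℤ => ‖n‖ ^ (-(4 : ℝ)) :=
    EisensteinSeries.summable_one_div_norm_rpow (by norm_num)
  refine Summable.of_norm_bounded_eventually (h1.mul_left ((8 * Real.sqrt 3) ^ 4)) ?_
  -- Beyond this radius `‖dvec n‖ ≤ 2 ‖dvec n + k‖`, which doubles the constant `4 √3` of
  -- `norm_dvec_ge`.
  have h2 := tendsto_norm_dvec.eventually (eventually_ge_atTop (2 * ‖k‖ + 1))
  filter_upwards [h2] with n hn
  have h3 := norm_dvec_ge n
  have h4 : ‖dvec n‖ ≤ ‖dvec n + k‖ + ‖k‖ := by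
    simpa using norm_sub_le (dvec n + k) k
  have h5 : ‖n‖ ≤ 8 * Real.sqrt 3 * ‖dvec n + k‖ := by
    have : 4 * Real.sqrt 3 * ‖dvec n‖ ≤ 4 * Real.sqrt 3 * (2 * ‖dvec n + k‖) := by
      gcongr
      linarith
    linarith
  have h6 : 0 < ‖dvec n + k‖ := by linarith [norm_nonneg k]
  have h7 : 0 < ‖n‖ := by
    rw [norm_pos_iff]
    rintro rfl
    rw [dvec_zero, norm_zero] at hn
    linarith [norm_nonneg k]
  rw [Real.norm_of_nonneg (by positivity), Real.rpow_neg h7.le,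
    show (4 : ℝ) = ((4 : ℕ) : ℝ) by norm_num, Real.rpow_natCast, ← div_eq_mul_inv,
    inv_le_comm₀ (by positivity) (by positivity), inv_div, div_le_iff₀ (by positivity)]
  calc ‖n‖ ^ 4 ≤ (8 * Real.sqrt 3 * ‖dvec n + k‖) ^ 4 := by gcongr
    _ = _ := by ring

theorem norm_ofCont_ch_le (n : Fin 2 → ℤ) : ‖ofCont (continuous_ch n)‖ ≤ 1 := by
  have h := Lp.norm_le_of_ae_bound (p := ⊤) (f := ofCont (continuous_ch n)) zero_le_one (by
    filter_upwards [coeFn_ofCont (continuous_ch n)] with z hz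
    rw [hz, norm_ch])
  simpa using h

theorem mul_ch_fb_zero (n : Fin 2 → ℤ) : mulInf (ofCont (continuous_ch n)) (fb 0) = fb n := by
  refine fc_ext fun m => ?_
  rw [fc_mul_ch, fc_fb, fc_fb]
  simp only [sub_eq_zero]

/-- The Fourier series converges absolutely in `L^∞`. As `fb 0` is constant, `mulInf g (fb 0) = u`
says that `u` is the bounded function `g` up to normalization. -/
theorem exists_bounded_of_summable {u : L2 ℂ} (hu : Summable fun n => ‖fc u n‖) :
    ∃ g : Linf, mulInf g (fb 0) = u := by
  have h1 : Summable fun n => fc u n • ofCont (continuous_ch n) := by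
    refine Summable.of_norm_bounded hu fun n => ?_
    rw [norm_smul]
    exact mul_le_of_le_one_right (norm_nonneg _) (norm_ofCont_ch_le n)
  let L : Linf →L[ℂ] L2 ℂ :=
    ((ContinuousLinearMap.mul ℂ ℂ).holderL cellMeasure ⊤ 2 2).flip (fb 0)
  have hL : ∀ g, L g = mulInf g (fb 0) := fun g => rfl
  refine ⟨∑' n, fc u n • ofCont (continuous_ch n), ?_⟩
  · rw [← hL]
    have h2 := h1.hasSum.mapL L
    simp only [map_smul] at h2
    simp only [hL, mul_ch_fb_zero] at h2
    exact h2.unique (fb.hasSum_repr u)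

/-- Two resolvents give the square-summable weight `‖dvec n + k‖⁻²`, whose product with the `ℓ²`
coefficients of `χ` is summable. -/
theorem exists_bounded_of_Rf_Rf (k : ℂ) (χ : L2 ℂ) :
    ∃ g : Linf, mulInf g (fb 0) = Rf k (Rf k χ) := by
  refine exists_bounded_of_summable ?_
  refine Summable.of_norm_bounded ((summable_norm_dvec_add (k := k)).add
    (norm_sq_eq_tsum χ).summable) fun n => ?_
  rw [fc_Rf, fc_Rf, norm_norm, norm_mul, norm_mul, norm_inv]
  have h : (‖dvec n + k‖ ^ 4)⁻¹ = (‖dvec n + k‖⁻¹ * ‖dvec n + k‖⁻¹) ^ 2 := by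
    rw [← mul_inv, inv_pow]; ring
  rw [h, ← mul_assoc]
  nlinarith [sq_nonneg (‖dvec n + k‖⁻¹ * ‖dvec n + k‖⁻¹ - ‖fc χ n‖),
    sq_nonneg (‖dvec n + k‖⁻¹ * ‖dvec n + k‖⁻¹), sq_nonneg ‖fc χ n‖]

theorem exists_dzbar_potEntry (U : Potential) (p t : ℤ) (α β : ℂ) (i j : Fin 3) :
    ∃ g' : Linf, ∀ n, (dvec n + 0) * fcm (potEntry U p t α β i j) n = fcm g' n := by
  obtain ⟨g', hg'⟩ := exists_twoDzbar_ofCont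
    ((U.contDiff_scaled (potScale p t i j)).of_le (by exact_mod_cast le_top))
    (U.scaled_periodic (potScale p t i j))
  refine ⟨potCoef α β i j • g', fun n => ?_⟩
  rw [potEntry, fcm_smul, fcm_smul, ← hg']
  ring

theorem fc_sum {ι : Type*} (s : Finset ι) (f : ι → L2 ℂ) (n) :
    fc (∑ i ∈ s, f i) n = ∑ i ∈ s, fc (f i) n := by
  simp only [← fcL_apply, map_sum]

theorem eq_Rf_iff {κ : ℂ} (hκ : κ ∉ dualLattice) {u φ : L2 ℂ} :
    u = Rf κ φ ↔ ∀ n, (dvec n + κ) * fc u n = fc φ n := by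
  constructor
  · rintro rfl n
    rw [fc_Rf, mul_inv_cancel_left₀ (dvec_add_ne_zero hκ n)]
  · intro h
    refine fc_ext fun n => ?_
    rw [fc_Rf, ← h, inv_mul_cancel_left₀ (dvec_add_ne_zero hκ n)]

/-- Elements of the kernel of `D(α) + k` are bounded. -/
theorem InKer.exists_bounded {U : Potential} {p t : ℤ} {α β k : ℂ} {u : L2 C3}
    (hu : InKer U p t α β k u) : ∃ h : Fin 3 → Linf, ∀ i, mulInf (h i) (fb 0) = cp i u := by
  obtain ⟨κ, hκ⟩ := exists_not_mem_dualLattice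
  choose g' hg' using exists_dzbar_potEntry U p t α β
  let φ : Fin 3 → L2 ℂ := fun i => -cp i (Vv U p t α β u) + (κ - k) • cp i u
  have h1 : ∀ i, cp i u = Rf κ (φ i) := by
    intro i
    rw [eq_Rf_iff hκ]
    intro n
    have := hu i n
    simp only [φ, fc_add, fc_neg, fc_smul]
    simp only [vc] at this
    linear_combination this
  -- Bootstrap: the potential is smooth and `cp j u` is in the range of `Rf κ`, so by Leibniz' rule
  -- `V u` is too. Thus `u` gains a second resolvent.
  have h2 : ∀ i, ∃ ψ, cp i (Vv U p t α β u) = Rf κ ψ := by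
    intro i
    refine ⟨∑ j, (mulInf (potEntry U p t α β i j) (φ j) + mulInf (g' i j) (cp j u)), ?_⟩
    rw [eq_Rf_iff hκ]
    intro n
    rw [cp_Vv, fc_sum, fc_sum, Finset.mul_sum]
    refine Finset.sum_congr rfl fun j _ => ?_
    have := leibniz hκ (hg' i j) (φ j) n
    rw [← h1, add_zero] at this
    rw [this, fc_add]
  choose ψ hψ using h2
  have h3 : ∀ i, ∃ g : Linf, mulInf g (fb 0) = cp i u := by
    intro i
    obtain ⟨g, hg⟩ := exists_bounded_of_Rf_Rf κ (-ψ i + (κ - k) • φ i)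
    refine ⟨g, ?_⟩
    rw [hg, h1 i]
    congr 1
    rw [map_add, map_neg, map_smul, ← hψ, ← h1]
  choose h hh using h3
  exact ⟨h, hh⟩

/-! ### Relations between kernel elements -/

theorem exists_mulInf_mulInf (g h : Linf) :
    ∃ gh : Linf, ∀ u, mulInf gh u = mulInf g (mulInf h u) := by
  refine ⟨(ContinuousLinearMap.mul ℂ ℂ).holder ⊤ g h, fun u => Lp.ext ?_⟩
  filter_upwards [coeFn_mulInf ((ContinuousLinearMap.mul ℂ ℂ).holder ⊤ g h) u,
    (ContinuousLinearMap.mul ℂ ℂ).coeFn_holder (r := ⊤) g h, coeFn_mulInf g (mulInf h u),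
    coeFn_mulInf h u] with z h1 h2 h3 h4
  rw [h1, h2, h3, h4]
  exact mul_assoc _ _ _

/-! ### Resolvent identities, invariant subspaces and residues -/

theorem Rf_resolvent {κ κ' : ℂ} (hκ : κ ∉ dualLattice) (hκ' : κ' ∉ dualLattice) (φ : L2 ℂ) :
    Rf κ' φ = Rf κ φ - (κ' - κ) • Rf κ (Rf κ' φ) := by
  refine fc_ext fun n => ?_
  have h1 := dvec_add_ne_zero hκ n
  have h2 := dvec_add_ne_zero hκ' n
  simp only [fc_sub, fc_smul, fc_Rf]
  field_simp
  ring

/-- Invariance of a closed subspace passes from one resolvent to another. -/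
theorem mapsTo_of_resolvent {E : Type*} [NormedAddCommGroup E] [NormedSpace ℂ E]
    {M : Submodule ℂ E} (hM : IsClosed (M : Set E)) {A B : E →L[ℂ] E} {c : ℂ}
    (hAB : ∀ x, B x = A x - c • A (B x)) (hc : ‖c‖ * ‖A‖ ≤ 1 / 2) (hA : ∀ x ∈ M, A x ∈ M) :
    ∀ x ∈ M, B x ∈ M := by
  intro x hx
  by_contra hB
  have hpos : 0 < Metric.infDist (B x) M :=
    (hM.notMem_iff_infDist_pos ⟨0, M.zero_mem⟩).1 hB
  -- Pick `m ∈ M` within twice the distance from `B x` to `M`. The point `A x - c A m` of `M` is at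
  -- most half as far from `B x` as `m`, hence closer than the distance itself.
  obtain ⟨m, hm, hlt⟩ := (Metric.infDist_lt_iff (s := (M : Set E)) ⟨0, M.zero_mem⟩).1
    (show Metric.infDist (B x) M < 2 * Metric.infDist (B x) M by linarith)
  have h1 : A x - c • A m ∈ M := M.sub_mem (hA x hx) (M.smul_mem c (hA m hm))
  have h2 : Metric.infDist (B x) M ≤ dist (B x) (A x - c • A m) := Metric.infDist_le_dist_of_mem h1
  have h3 : B x - (A x - c • A m) = c • A (m - B x) := by
    rw [map_sub, smul_sub]
    nth_rewrite 1 [hAB x]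
    abel
  have h4 : dist (B x) (A x - c • A m) ≤ 1 / 2 * dist (B x) m := by
    rw [dist_eq_norm, h3, norm_smul, dist_comm, dist_eq_norm]
    calc ‖c‖ * ‖A (m - B x)‖ ≤ ‖c‖ * (‖A‖ * ‖m - B x‖) := by gcongr; exact A.le_opNorm _
      _ = ‖c‖ * ‖A‖ * ‖m - B x‖ := by ring
      _ ≤ _ := by gcongr
  linarith

theorem mapsTo_iff_of_resolvent {E : Type*} [NormedAddCommGroup E] [NormedSpace ℂ E]
    {M : Submodule ℂ E} (hM : IsClosed (M : Set E)) {A B : E →L[ℂ] E} {c : ℂ}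
    (hAB : ∀ x, B x = A x - c • A (B x)) (hBA : ∀ x, A x = B x - (-c) • B (A x))
    (hc : ‖c‖ * ‖A‖ ≤ 1 / 4) : (∀ x ∈ M, A x ∈ M) ↔ ∀ x ∈ M, B x ∈ M := by
  -- Bounding `B` by `2 ‖A‖` lets the roles be exchanged; this is why `1 / 4` is assumed instead of
  -- `1 / 2`.
  have hB : ‖B‖ ≤ 2 * ‖A‖ := by
    have h1 : B = A - c • (A ∘L B) := by ext x; exact hAB x
    have h2 : ‖B‖ ≤ ‖A‖ + ‖c‖ * (‖A‖ * ‖B‖) := by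
      calc ‖B‖ = ‖A - c • (A ∘L B)‖ := by rw [← h1]
        _ ≤ ‖A‖ + ‖c • (A ∘L B)‖ := norm_sub_le _ _
        _ ≤ ‖A‖ + ‖c‖ * (‖A‖ * ‖B‖) := by
          rw [norm_smul]
          gcongr
          exact A.opNorm_comp_le B
    nlinarith [norm_nonneg B, norm_nonneg A]
  refine ⟨mapsTo_of_resolvent hM hAB (by linarith), mapsTo_of_resolvent hM hBA ?_⟩
  rw [norm_neg]
  nlinarith [norm_nonneg c]

/-- Only finitely many `n` have `‖dvec n + κ‖ < 1`. -/
theorem exists_pos_le_norm_dvec_add (κ : ℂ) :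
    ∃ c > 0, ∀ n, dvec n + κ ≠ 0 → c ≤ ‖dvec n + κ‖ := by
  have h1 := (tendsto_norm_dvec_add κ).eventually (eventually_ge_atTop 1)
  rw [eventually_cofinite] at h1
  have h2 : ∀ᶠ c : ℝ in 𝓝[>] 0, ∀ n ∈ {n | ¬1 ≤ ‖dvec n + κ‖}, dvec n + κ ≠ 0 → c ≤ ‖dvec n + κ‖ := by
    refine (eventually_all_finite h1).2 fun n _ => ?_
    by_cases hn : dvec n + κ = 0
    · exact Eventually.of_forall fun c h => absurd hn h
    · filter_upwards [nhdsWithin_le_nhds (eventually_le_nhds (norm_pos_iff.2 hn))] with c hc _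
      exact hc
  have h3 : ∀ᶠ c : ℝ in 𝓝[>] 0, c ≤ 1 := nhdsWithin_le_nhds (eventually_le_nhds one_pos)
  obtain ⟨c, ⟨hc, hc1⟩, hc0⟩ := ((h2.and h3).and self_mem_nhdsWithin).exists
  refine ⟨c, hc0, fun n hn => ?_⟩
  by_cases hn1 : 1 ≤ ‖dvec n + κ‖
  · exact hc1.trans hn1
  · exact hc n hn1 hn

/-- The residue of the resolvent. -/
theorem tendsto_smul_Rf (κ k₀ : ℂ) {φ ψ : L2 ℂ}
    (h0 : ∀ n, dvec n + (k₀ - κ) = 0 → fc ψ n = fc φ n)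
    (h1 : ∀ n, dvec n + (k₀ - κ) ≠ 0 → fc ψ n = 0) :
    Tendsto (fun k => (k - k₀) • Rf (k - κ) φ) (𝓝[≠] k₀) (𝓝 ψ) := by
  obtain ⟨c, hc, hcn⟩ := exists_pos_le_norm_dvec_add (k₀ - κ)
  rw [tendsto_iff_norm_sub_tendsto_zero]
  have hlim : Tendsto (fun k => ‖k - k₀‖ * (2 / c) * ‖φ‖) (𝓝[≠] k₀) (𝓝 0) := by
    have : Continuous fun k => ‖k - k₀‖ * (2 / c) * ‖φ‖ := by fun_prop
    simpa using (this.tendsto k₀).mono_left nhdsWithin_le_nhds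
  have hsmall : ∀ᶠ k in 𝓝[≠] k₀, ‖k - k₀‖ < c / 2 := by
    have : Continuous fun k => ‖k - k₀‖ := by fun_prop
    exact ((this.tendsto k₀).mono_left nhdsWithin_le_nhds).eventually
      (gt_mem_nhds (by simpa using half_pos hc))
  refine squeeze_zero' (Eventually.of_forall fun k => norm_nonneg _) ?_ hlim
  filter_upwards [hsmall, self_mem_nhdsWithin] with k hk hne
  refine norm_le_of_fc_le (by positivity) fun n => ?_
  rw [fc_sub, fc_smul, fc_Rf]
  have hk0 : k - k₀ ≠ 0 := sub_ne_zero.2 hne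
  -- Modes at the pole are reproduced exactly; on the others the denominators stay at least `c / 2`,
  -- uniformly in `n`.
  by_cases hn : dvec n + (k₀ - κ) = 0
  · rw [h0 n hn, show dvec n + (k - κ) = k - k₀ by linear_combination hn,
      mul_inv_cancel_left₀ hk0, sub_self, norm_zero]
    positivity
  · rw [h1 n hn, sub_zero, norm_mul, norm_mul, norm_inv, ← mul_assoc]
    have h2 := hcn n hn
    have h3 : ‖dvec n + (k₀ - κ)‖ ≤ ‖dvec n + (k - κ)‖ + ‖k - k₀‖ := by
      refine le_trans (le_of_eq ?_) (norm_sub_le _ _)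
      congr 1
      ring
    have h4 : c / 2 ≤ ‖dvec n + (k - κ)‖ := by linarith
    gcongr
    rw [inv_le_comm₀ (by linarith) (by positivity), inv_div]
    exact h4

/-- A family of kernel elements of `D(α) + K l` in `L²₀`, given by bounded functions, whose
parameters `K l` are pairwise distinct modulo the dual lattice of `Γ₃`. -/
structure KerFam (U : Potential) (p q t : ℤ) (α β : ℂ) {N : ℕ} (K : Fin N → ℂ)
    (u : Fin N → L2 C3) (h : Fin N → Fin 3 → Linf) : Prop where
  bdd : ∀ l i, mulInf (h l i) (fb 0) = cp i (u l)
  mem : ∀ l, u l ∈ L20 p q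
  ne_zero : ∀ l, u l ≠ 0
  ker : ∀ l, InKer U p t α β (K l) (u l)
  dist : ∀ l l', l ≠ l' → ∀ n, InCls 0 n → K l - K l' ≠ dvec n

/-- The `Γ₃`-periodic coefficient vectors of linear relations. -/
def relSub {N : ℕ} (h : Fin N → Fin 3 → Linf) : Submodule ℂ (Fin N → L2 ℂ) :=
  (⨅ l, LinearMap.ker ((modeProj fun n => ¬ InCls 0 n) ∘L
    (ContinuousLinearMap.proj l : (Fin N → L2 ℂ) →L[ℂ] L2 ℂ)).toLinearMap) ⊓
  ⨅ i, LinearMap.ker (∑ l, mulInf (h l i) ∘L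
    (ContinuousLinearMap.proj l : (Fin N → L2 ℂ) →L[ℂ] L2 ℂ)).toLinearMap

theorem mem_relSub {N : ℕ} {h : Fin N → Fin 3 → Linf} {φ : Fin N → L2 ℂ} :
    φ ∈ relSub h ↔ (∀ l n, fc (φ l) n ≠ 0 → InCls 0 n) ∧ ∀ i, ∑ l, mulInf (h l i) (φ l) = 0 := by
  have h1 : ∀ u : L2 ℂ, (modeProj fun n => ¬ InCls 0 n) u = 0 ↔ ∀ n, fc u n ≠ 0 → InCls 0 n := by
    classical
    intro u
    constructor
    · intro h n hn
      by_contra h2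
      have := fc_modeProj (fun n => ¬ InCls 0 n) u n
      rw [h, fc_zero, if_pos h2] at this
      exact hn this.symm
    · intro h
      refine fc_ext fun n => ?_
      rw [fc_modeProj, fc_zero]
      split_ifs with h2
      · rfl
      · exact not_imp_comm.1 (h n) h2
  simp [relSub, Submodule.mem_iInf, h1]

theorem isClosed_relSub {N : ℕ} (h : Fin N → Fin 3 → Linf) :
    IsClosed (relSub h : Set (Fin N → L2 ℂ)) := by
  simp only [relSub, Submodule.coe_inf, Submodule.coe_iInf]
  exact (isClosed_iInter fun l => ContinuousLinearMap.isClosed_ker _).inter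
    (isClosed_iInter fun i => ContinuousLinearMap.isClosed_ker _)

/-- The diagonal resolvent `(2 D_{z̄} + k - K l)⁻¹`. -/
def resDiag {N : ℕ} (K : Fin N → ℂ) (k : ℂ) : (Fin N → L2 ℂ) →L[ℂ] (Fin N → L2 ℂ) :=
  ContinuousLinearMap.pi fun l => Rf (k - K l) ∘L ContinuousLinearMap.proj l

theorem resDiag_apply {N : ℕ} (K : Fin N → ℂ) (k : ℂ) (φ : Fin N → L2 ℂ) (l : Fin N) :
    resDiag K k φ l = Rf (k - K l) (φ l) := rfl

theorem resDiag_resolvent {N : ℕ} {K : Fin N → ℂ} {k k' : ℂ} (hk : ∀ l, k - K l ∉ dualLattice)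
    (hk' : ∀ l, k' - K l ∉ dualLattice) (φ : Fin N → L2 ℂ) :
    resDiag K k' φ = resDiag K k φ - (k' - k) • resDiag K k (resDiag K k' φ) := by
  ext1 l
  have := Rf_resolvent (hk l) (hk' l) (φ l)
  rw [sub_sub_sub_cancel_right] at this
  exact this

/-! ### Absence of periodic relations between kernel elements -/

namespace KerFam

variable {U : Potential} {p q t : ℤ} {α β : ℂ} {N : ℕ} {K : Fin N → ℂ} {u : Fin N → L2 C3}
  {h : Fin N → Fin 3 → Linf}

theorem fcm_eq (H : KerFam U p q t α β K u h) (l i n) : fcm (h l i) n = vc (u l) i n := by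
  rw [fcm, H.bdd, vc]

theorem inCls (H : KerFam U p q t α β K u h) {l i n} (hn : fcm (h l i) n ≠ 0) :
    InCls (cls p q i) n := by
  rw [H.fcm_eq] at hn
  exact mem_L20_iff.1 (H.mem l) i n hn

theorem inCls_mulInf (H : KerFam U p q t α β K u h) {φ : L2 ℂ}
    (hφ : ∀ n, fc φ n ≠ 0 → InCls 0 n) {l i n} (hn : fc (mulInf (h l i) φ) n ≠ 0) :
    InCls (cls p q i) n := by
  classical
  have h1 := modeProj_mulInf (P := fun n => InCls (cls p q i) n) (Q := fun n => InCls 0 n)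
    (g := h l i) (fun n m hnm => by
      have := H.inCls hnm
      simp only [InCls, Pi.sub_apply] at this ⊢
      omega) φ
  have h2 : modeProj (fun n => InCls 0 n) φ = φ := by
    refine fc_ext fun n => ?_
    rw [fc_modeProj]
    split_ifs with h3
    · rfl
    · by_contra h4
      exact h3 (hφ n (Ne.symm h4))
  rw [h2] at h1
  rw [← h1, fc_modeProj] at hn
  by_contra h3
  simp [h3] at hn

/-- The kernel equation reads `(2 D_{z̄} + K l) h = -V h` with a bounded right side, which is the
hypothesis of `leibniz`. -/
theorem exists_dzbar (H : KerFam U p q t α β K u h) (l : Fin N) (i : Fin 3) :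
    ∃ g' : Linf, (∀ n, (dvec n + K l) * fcm (h l i) n = fcm g' n) ∧
      ∀ v, mulInf g' v = -∑ j, mulInf (potEntry U p t α β i j) (mulInf (h l j) v) := by
  choose g hg using fun j => exists_mulInf_mulInf (potEntry U p t α β i j) (h l j)
  have h1 : ∀ v, mulInf (-∑ j, g j) v
      = -∑ j, mulInf (potEntry U p t α β i j) (mulInf (h l j) v) := by
    intro v
    simp only [← hg]
    simp only [mulInf, map_neg, map_sum, neg_apply, sum_apply]
  refine ⟨-∑ j, g j, fun n => ?_, h1⟩
  have h2 := H.ker l i n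
  rw [H.fcm_eq, fcm, h1, fc_neg]
  simp only [H.bdd]
  rw [← cp_Vv]
  exact eq_neg_of_add_eq_zero_left h2

/-- A relation yields a kernel element. -/
theorem resDiag_mem_of_injective (H : KerFam U p q t α β K u h) {k : ℂ}
    (hk : ∀ l, k - K l ∉ dualLattice) (hinj : ∀ v ∈ L20 p q, InKer U p t α β k v → v = 0)
    {φ : Fin N → L2 ℂ} (hφ : φ ∈ relSub h) : resDiag K k φ ∈ relSub h := by
  rw [mem_relSub] at hφ ⊢
  have h0 : ∀ l n, fc (resDiag K k φ l) n ≠ 0 → InCls 0 n := by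
    intro l n hn
    rw [resDiag_apply, fc_Rf] at hn
    exact hφ.1 l n (right_ne_zero_of_mul hn)
  refine ⟨h0, ?_⟩
  set F : Fin 3 → L2 ℂ := fun i => ∑ l, mulInf (h l i) (resDiag K k φ l) with hF
  -- By Leibniz' rule and `(D(α) + K l) u l = 0`, the combination `F` satisfies `(D(α) + k) F = ∑ φ
  -- l u l = 0`, and it lies in `L²₀`.
  have hv : ∑ i, inc i (F i) = 0 := by
    refine hinj _ (mem_L20_iff.2 fun i n hn => ?_) fun i n => ?_
    · rw [vc, cp_sum_inc, hF, fc_sum] at hn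
      obtain ⟨l, -, hl⟩ := Finset.exists_ne_zero_of_sum_ne_zero hn
      exact H.inCls_mulInf (h0 l) hl
    · rw [vc, vc, cp_Vv, cp_sum_inc]
      simp only [cp_sum_inc]
      have h1 : ∀ l, (dvec n + k) * fc (mulInf (h l i) (resDiag K k φ l)) n
          = fc (mulInf (h l i) (φ l)) n
            - fc (∑ j, mulInf (potEntry U p t α β i j) (mulInf (h l j) (resDiag K k φ l))) n := by
        intro l
        obtain ⟨g', hg1, hg2⟩ := H.exists_dzbar l i
        have := leibniz (hk l) hg1 (φ l) n
        rw [sub_add_cancel, hg2, fc_neg] at this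
        rw [resDiag_apply, this, ← sub_eq_add_neg]
      simp only [hF, map_sum]
      rw [fc_sum, Finset.mul_sum, Finset.sum_congr rfl fun l _ => h1 l, Finset.sum_sub_distrib,
        ← fc_sum, hφ.2 i, fc_zero, ← fc_sum, Finset.sum_comm]
      ring
  intro i
  have := congrArg (cp i) hv
  rwa [cp_sum_inc, map_zero] at this

theorem countable_exceptional (K : Fin N → ℂ) : {k | ∃ l, k - K l ∈ dualLattice}.Countable := by
  have : {k | ∃ l, k - K l ∈ dualLattice} = ⋃ l, (fun x => x + K l) '' dualLattice := by
    ext k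
    simp only [Set.mem_ofPred_eq, Set.mem_iUnion, Set.mem_image]
    refine exists_congr fun l => ⟨fun h => ⟨_, h, by ring⟩, ?_⟩
    rintro ⟨x, hx, rfl⟩
    rwa [add_sub_cancel_right]
  rw [this]
  exact Set.countable_iUnion fun l => countable_dualLattice.image _

/-- Invariance of the closed space `relSub h` under `resDiag K k` is locally constant in `k` by the
resolvent identity, and the plane minus a countable set is connected. -/
theorem resDiag_mem (H : KerFam U p q t α β K u h) {k₁ : ℂ}
    (hk₁ : ∀ l, k₁ - K l ∉ dualLattice) (hinj : ∀ v ∈ L20 p q, InKer U p t α β k₁ v → v = 0)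
    {k : ℂ} (hk : ∀ l, k - K l ∉ dualLattice) : ∀ φ ∈ relSub h, resDiag K k φ ∈ relSub h := by
  have hG : IsPreconnected {k | ∃ l, k - K l ∈ dualLattice}ᶜ :=
    ((countable_exceptional K).isConnected_compl_of_one_lt_rank (by simp)).isPreconnected
  have hmem : ∀ k, k ∈ {k | ∃ l, k - K l ∈ dualLattice}ᶜ ↔ ∀ l, k - K l ∉ dualLattice := by
    intro k
    simp
  refine (hG.induction₂ (fun k k' => (∀ φ ∈ relSub h, resDiag K k φ ∈ relSub h) ↔
    ∀ φ ∈ relSub h, resDiag K k' φ ∈ relSub h) ?_ (fun _ _ _ _ _ _ h1 h2 => h1.trans h2)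
    (fun _ _ _ _ h => h.symm) ((hmem k₁).2 hk₁) ((hmem k).2 hk)).1
    fun φ hφ => H.resDiag_mem_of_injective hk₁ hinj hφ
  intro x hx
  have hc : Continuous fun y => ‖y - x‖ * ‖resDiag K x‖ := by fun_prop
  have hs : ∀ᶠ y in 𝓝 x, ‖y - x‖ * ‖resDiag K x‖ < 1 / 4 :=
    (hc.tendsto x).eventually (gt_mem_nhds (by simp))
  filter_upwards [nhdsWithin_le_nhds hs, self_mem_nhdsWithin] with y hy hyG
  rw [hmem] at hx hyG
  refine mapsTo_iff_of_resolvent (isClosed_relSub h) (resDiag_resolvent hx hyG) (fun φ => ?_) hy.le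
  rw [neg_sub]
  exact resDiag_resolvent hyG hx φ

/-- Multiply the resolved relation by `k - K l₀` and let `k → K l₀`: what survives is the zero mode
of `φ l₀` times `u l₀`, and `u l₀ ≠ 0`. -/
theorem fc_zero_of_relSub (H : KerFam U p q t α β K u h) {k₁ : ℂ}
    (hk₁ : ∀ l, k₁ - K l ∉ dualLattice) (hinj : ∀ v ∈ L20 p q, InKer U p t α β k₁ v → v = 0)
    {φ : Fin N → L2 ℂ} (hφ : φ ∈ relSub h) (l₀ : Fin N) : fc (φ l₀) 0 = 0 := by
  have hφ' := mem_relSub.1 hφ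
  let G := {k | ∃ l, k - K l ∈ dualLattice}ᶜ
  have hmem : ∀ k, k ∈ G ↔ ∀ l, k - K l ∉ dualLattice := by
    intro k
    simp [G]
  have : (𝓝[G] (K l₀)).NeBot := by
    rw [← mem_closure_iff_nhdsWithin_neBot]
    exact (countable_exceptional K).dense_compl ℝ _
  have hle : 𝓝[G] (K l₀) ≤ 𝓝[≠] (K l₀) := by
    refine nhdsWithin_mono _ fun k hk => ?_
    rintro rfl
    refine (hmem _).1 hk l₀ ?_
    rw [sub_self, mem_dualLattice_iff]
    exact ⟨0, dvec_zero⟩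
  let ψ : Fin N → L2 ℂ := fun l => if l = l₀ then fc (φ l₀) 0 • fb 0 else 0
  have hψ : ∀ l, Tendsto (fun k => (k - K l₀) • Rf (k - K l) (φ l)) (𝓝[G] (K l₀)) (𝓝 (ψ l)) := by
    intro l
    refine (tendsto_smul_Rf _ _ (fun n hn => ?_) fun n hn => ?_).mono_left hle
    · by_cases hl : l = l₀
      · subst hl
        rw [sub_self, add_zero] at hn
        obtain rfl : n = 0 := dvec_injective (hn.trans dvec_zero.symm)
        simp [ψ, fc_fb]
      · simp only [ψ, if_neg hl, fc_zero]
        by_contra h1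
        -- A pole of another component would sit at a frequency of `φ l`, hence in `3Γ*`, where the
        -- parameters differ.
        exact H.dist l l₀ hl n (hφ'.1 l n (Ne.symm h1)) (by linear_combination -hn)
    · by_cases hl : l = l₀
      · subst hl
        have : n ≠ 0 := by
          rintro rfl
          simp [dvec_zero] at hn
        simp [ψ, fc_fb, this]
      · simp only [ψ, if_neg hl, fc_zero]
  have h1 : ∀ i, mulInf (h l₀ i) (fc (φ l₀) 0 • fb 0) = 0 := by
    intro i
    have h2 : Tendsto (fun k => ∑ l, mulInf (h l i) ((k - K l₀) • Rf (k - K l) (φ l)))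
        (𝓝[G] (K l₀)) (𝓝 (∑ l, mulInf (h l i) (ψ l))) :=
      tendsto_finsetSum _ fun l _ => ((mulInf (h l i)).continuous.tendsto _).comp (hψ l)
    have h3 : ∑ l, mulInf (h l i) (ψ l) = mulInf (h l₀ i) (fc (φ l₀) 0 • fb 0) := by
      rw [Finset.sum_eq_single l₀]
      · simp [ψ]
      · intro l _ hl
        simp [ψ, hl]
      · simp
    rw [← h3]
    refine tendsto_nhds_unique h2 (tendsto_const_nhds.congr' ?_)
    filter_upwards [self_mem_nhdsWithin] with k hk
    have h4 := (mem_relSub.1 (H.resDiag_mem hk₁ hinj ((hmem k).1 hk) φ hφ)).2 i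
    simp only [map_smul]
    rw [← Finset.smul_sum]
    simp only [resDiag_apply] at h4
    rw [h4, smul_zero]
  by_contra h2
  refine H.ne_zero l₀ (cp_ext fun i => ?_)
  have h3 := h1 i
  rw [map_smul, H.bdd] at h3
  rw [map_zero]
  exact (smul_eq_zero.1 h3).resolve_left h2

/-- There are no relations with bounded coefficients when `D(α) + k₁` is injective. -/
theorem eq_zero_of_relSub (H : KerFam U p q t α β K u h) {k₁ : ℂ}
    (hk₁ : ∀ l, k₁ - K l ∉ dualLattice) (hinj : ∀ v ∈ L20 p q, InKer U p t α β k₁ v → v = 0)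
    {φ : Fin N → L2 ℂ} (hφ : φ ∈ relSub h) (l : Fin N) : φ l = 0 := by
  have hφ' := mem_relSub.1 hφ
  refine fc_ext fun n => ?_
  rw [fc_zero]
  by_contra hn
  have hcls := hφ'.1 l n hn
  -- Since `n` is divisible by 3, the character is `Γ₃`-periodic, so modulation preserves relations
  -- and moves the mode `n` to `0`.
  have h1 : (fun l => mulInf (ofCont (continuous_ch (-n))) (φ l)) ∈ relSub h := by
    rw [mem_relSub]
    refine ⟨fun l m hm => ?_, fun i => ?_⟩
    · rw [fc_mul_ch, sub_neg_eq_add] at hm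
      have := hφ'.1 l _ hm
      simp only [InCls, Pi.add_apply] at this hcls ⊢
      omega
    · simp only [mulInf_comm _ (ofCont (continuous_ch (-n)))]
      rw [← map_sum, hφ'.2, map_zero]
  have h2 := H.fc_zero_of_relSub hk₁ hinj h1 l
  simp only [fc_mul_ch, zero_sub, neg_neg] at h2
  exact hn h2

end KerFam

section

open Filter Topology Matrix
open scoped ComplexOrder

/-! ### Gram determinants -/

/-- The Gram matrix of a family of vectors in `ℂ³`. -/
def gramMat {N : ℕ} (a : Fin N → Fin 3 → ℂ) : Matrix (Fin N) (Fin N) ℂ := ((of a)ᵀ)ᴴ * (of a)ᵀ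

theorem gramMat_apply {N : ℕ} (a : Fin N → Fin 3 → ℂ) (l l' : Fin N) :
    gramMat a l l' = ∑ i, conj (a l i) * a l' i := rfl

theorem continuous_gramMat {N : ℕ} : Continuous (gramMat (N := N)) := by
  refine continuous_matrix fun l l' => ?_
  simp only [gramMat_apply]
  fun_prop

/-- The Gram matrix `A* A` has the rank of `A`, a matrix with three rows. -/
theorem det_gramMat_eq_zero {N : ℕ} (hN : 3 < N) (a : Fin N → Fin 3 → ℂ) :
    (gramMat a).det = 0 := by
  by_contra h
  have h1 := rank_of_isUnit _ ((isUnit_iff_isUnit_det _).2 (isUnit_iff_ne_zero.2 h))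
  rw [gramMat, rank_conjTranspose_mul_self, Fintype.card_fin] at h1
  have h2 := rank_le_card_height (of a)ᵀ
  rw [h1, Fintype.card_fin] at h2
  omega

/-- The last column of the adjugate of the Gram matrix. -/
def gramCol {N : ℕ} (a : Fin (N + 1) → Fin 3 → ℂ) (l : Fin (N + 1)) : ℂ :=
  (gramMat a).adjugate l (Fin.last N)

theorem continuous_gramCol {N : ℕ} (l : Fin (N + 1)) :
    Continuous fun a : Fin (N + 1) → Fin 3 → ℂ => gramCol a l :=
  continuous_gramMat.matrix_adjugate.matrix_elem l (Fin.last N)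

theorem gramCol_last {N : ℕ} (a : Fin (N + 1) → Fin 3 → ℂ) :
    gramCol a (Fin.last N) = (gramMat fun l => a l.castSucc).det := by
  rw [gramCol, adjugate_fin_succ_eq_det_submatrix, ← two_mul, pow_mul, neg_one_sq, one_pow, one_mul,
    Fin.succAbove_last]
  rfl

/-- When `det G = 0`, `G * adjugate G = 0`; for `G = A* A` the kernel of `G` is that of `A`, so the
adjugate column is a linear relation. -/
theorem sum_gramCol_mul {N : ℕ} {a : Fin (N + 1) → Fin 3 → ℂ} (h : (gramMat a).det = 0)
    (i : Fin 3) : ∑ l, a l i * gramCol a l = 0 := by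
  have h1 : gramMat a *ᵥ gramCol a = 0 := by
    ext l
    have h2 := congrFun (congrFun (mul_adjugate (gramMat a)) l) (Fin.last N)
    rw [h, zero_smul] at h2
    exact h2
  rw [gramMat, conjTranspose_mul_self_mulVec_eq_zero] at h1
  exact congrFun h1 i

/-- A diagonal unitary leaves inner products unchanged. This makes the coefficients `Γ₃`-periodic
although the vectors are only twisted-periodic. -/
theorem gramCol_congr {N : ℕ} {a b : Fin (N + 1) → Fin 3 → ℂ} {c : Fin 3 → ℂ}
    (hc : ∀ i, ‖c i‖ = 1) (h : ∀ l i, c i * a l i = b l i) : gramCol a = gramCol b := by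
  have h1 : gramMat a = gramMat b := by
    ext l l'
    rw [gramMat_apply, gramMat_apply]
    refine Finset.sum_congr rfl fun i _ => ?_
    rw [← h, ← h, map_mul]
    have h2 : conj (c i) * c i = 1 := by
      rw [mul_comm, Complex.mul_conj, Complex.normSq_eq_norm_sq, hc]
      simp
    linear_combination (-(conj (a l i) * a l' i)) * h2
  ext l
  rw [gramCol, gramCol, h1]

/-! ### Bounded relations from Gram determinants -/

theorem ae_norm_Linf_le (g : Linf) : ∀ᵐ z ∂cellMeasure, ‖g z‖ ≤ ‖g‖ := by
  filter_upwards [ae_le_eLpNormEssSup (f := g) (μ := cellMeasure)] with z hz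
  rw [Lp.norm_def, eLpNorm_exponent_top, ← toReal_enorm]
  refine ENNReal.toReal_mono ?_ hz
  rw [← eLpNorm_exponent_top]
  exact Lp.eLpNorm_ne_top g

theorem memLp_comp_bounded {N : ℕ} (h : Fin N → Fin 3 → Linf) {F : (Fin N → Fin 3 → ℂ) → ℂ}
    (hF : Continuous F) : MemLp (fun z => F fun l i => h l i z) 2 cellMeasure := by
  have h1 : IsCompact (Metric.closedBall (0 : Fin N → Fin 3 → ℂ) ‖h‖) := isCompact_closedBall _ _
  obtain ⟨C, hC⟩ := h1.exists_bound_of_continuousOn hF.continuousOn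
  refine MemLp.of_bound (hF.comp_aestronglyMeasurable
    (aemeasurable_pi_lambda _ fun l => aemeasurable_pi_lambda _ fun i =>
      (Lp.aestronglyMeasurable (h l i)).aemeasurable).aestronglyMeasurable) C ?_
  filter_upwards [ae_all_iff.2 fun l => ae_all_iff.2 fun i => ae_norm_Linf_le (h l i)] with z hz
  refine hC _ (mem_closedBall_zero_iff.2 ?_)
  refine (pi_norm_le_iff_of_nonneg (norm_nonneg _)).2 fun l =>
    (pi_norm_le_iff_of_nonneg (norm_nonneg _)).2 fun i => (hz l i).trans ?_
  exact (norm_le_pi_norm (h l) i).trans (norm_le_pi_norm h l)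

theorem fc_inCls_of_pull {u : L2 ℂ} (h : ∀ a b : ℤ, pull (isCellSymm_add (moireVec a b)) u = u)
    {n : Fin 2 → ℤ} (hn : fc u n ≠ 0) : InCls 0 n := by
  have key : ∀ a b : ℤ, (3 : ℤ) ∣ a * n 0 + b * n 1 := by
    intro a b
    have h1 := fc_pull_add (moireVec a b) u n
    rw [h, ch_moireVec, eq_comm, mul_eq_right₀ hn, omega_zpow_eq_one_iff] at h1
    exact h1
  have h0 := key 1 0
  have h1 := key 0 1
  simp only [one_mul, zero_mul, add_zero, zero_add] at h0 h1
  exact ⟨by rwa [sub_zero], by rwa [sub_zero]⟩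

namespace KerFam

variable {U : Potential} {p q t : ℤ} {α β : ℂ}

theorem castSucc {N : ℕ} {K : Fin (N + 1) → ℂ} {u : Fin (N + 1) → L2 C3}
    {h : Fin (N + 1) → Fin 3 → Linf} (H : KerFam U p q t α β K u h) :
    KerFam U p q t α β (fun l => K l.castSucc) (fun l => u l.castSucc) fun l => h l.castSucc where
  bdd _ := H.bdd _
  mem _ := H.mem _
  ne_zero _ := H.ne_zero _
  ker _ := H.ker _
  dist _ _ hl := H.dist _ _ fun h => hl (Fin.castSucc_injective _ h)

theorem ae_translate {N : ℕ} {K : Fin N → ℂ} {u : Fin N → L2 C3} {h : Fin N → Fin 3 → Linf}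
    (H : KerFam U p q t α β K u h) (a b : ℤ) : ∀ᵐ z ∂cellMeasure, ∀ l i,
      omega ^ (-(cls p q i * (a + b))) * h l i (red (z + moireVec a b)) = h l i z := by
  refine ae_all_iff.2 fun l => ae_all_iff.2 fun i => ?_
  have hA := isCellSymm_add (moireVec a b)
  have hcoe : ∀ᵐ z ∂cellMeasure, cp i (u l) z = h l i z * ((Real.sqrt area)⁻¹ : ℂ) := by
    rw [← H.bdd]
    filter_upwards [coeFn_mulInf (h l i) (fb 0), coeFn_chLp 0] with z h1 h2
    rw [h1, fb_apply, h2, ch_zero]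
    simp
  have h0 : ((Real.sqrt area)⁻¹ : ℂ) ≠ 0 := by
    have := Real.sqrt_pos.2 area_pos
    exact inv_ne_zero (Complex.ofReal_ne_zero.2 this.ne')
  have h1 := mem_L20_iff_pull.1 (H.mem l) a b i
  have h2 : (omega ^ (-(cls p q i * (a + b))) • pull hA (cp i (u l)) : L2 ℂ)
      =ᵐ[cellMeasure] cp i (u l) := by rw [h1]
  filter_upwards [h2, Lp.coeFn_smul (omega ^ (-(cls p q i * (a + b)))) (pull hA (cp i (u l))),
    coeFn_pull hA (cp i (u l)), hcoe,
    hA.measurePreserving_red.quasiMeasurePreserving.ae hcoe] with z h3 h4 h5 h6 h7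
  rw [h4, Pi.smul_apply, h5, h6, h7, smul_eq_mul, ← mul_assoc] at h3
  exact mul_right_cancel₀ h0 h3

/-- The adjugate column is a bounded `Γ₃`-periodic relation, hence zero; its last entry is the Gram
determinant of the family without its last member. -/
theorem det_castSucc_eq_zero {N : ℕ} {K : Fin (N + 1) → ℂ} {u : Fin (N + 1) → L2 C3}
    {h : Fin (N + 1) → Fin 3 → Linf} (H : KerFam U p q t α β K u h) {k₁ : ℂ}
    (hk₁ : ∀ l, k₁ - K l ∉ dualLattice) (hinj : ∀ v ∈ L20 p q, InKer U p t α β k₁ v → v = 0)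
    (hdet : ∀ᵐ z ∂cellMeasure, (gramMat fun l i => h l i z).det = 0) :
    ∀ᵐ z ∂cellMeasure, (gramMat fun l i => h (Fin.castSucc l) i z).det = 0 := by
  let φ : Fin (N + 1) → L2 ℂ := fun l => (memLp_comp_bounded h (continuous_gramCol l)).toLp
  have hφ : ∀ l, ∀ᵐ z ∂cellMeasure, φ l z = gramCol (fun l i => h l i z) l := fun l =>
    MemLp.coeFn_toLp _
  have hmem : φ ∈ relSub h := by
    rw [mem_relSub]
    refine ⟨fun l n hn => fc_inCls_of_pull (fun a b => Lp.ext ?_) hn, fun i => Lp.ext ?_⟩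
    · have hA := isCellSymm_add (moireVec a b)
      filter_upwards [coeFn_pull hA (φ l), hφ l, H.ae_translate a b,
        hA.measurePreserving_red.quasiMeasurePreserving.ae (hφ l)] with z h1 h2 h3 h4
      rw [h1, h2, h4]
      refine congrFun (gramCol_congr (c := fun i => omega ^ (-(cls p q i * (a + b))))
        (fun i => ?_) h3) l
      rw [norm_zpow, norm_omega, _root_.one_zpow]
    · have h1 : ∀ᵐ z ∂cellMeasure, ∀ l, mulInf (h l i) (φ l) z = h l i z * φ l z :=
        ae_all_iff.2 fun l => coeFn_mulInf (h l i) (φ l)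
      filter_upwards [hdet, h1, ae_all_iff.2 hφ, Lp.coeFn_zero ℂ 2 cellMeasure,
        Lp.coeFn_finsetSum Finset.univ fun l => mulInf (h l i) (φ l)] with z h2 h3 h4 h5 h6
      rw [h6, h5, Finset.sum_apply]
      simp only [h3, h4]
      exact sum_gramCol_mul h2 i
  have h0 := H.eq_zero_of_relSub hk₁ hinj hmem (Fin.last N)
  have h1 := hφ (Fin.last N)
  rw [h0] at h1
  filter_upwards [h1, Lp.coeFn_zero ℂ 2 cellMeasure] with z h2 h3
  rw [← gramCol_last fun l i => h l i z, ← h2, h3]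
  rfl

/-- Descent in the size of the family ends at the empty determinant, which is `1`. -/
theorem not_det_eq_zero {k₁ : ℂ} (hinj : ∀ v ∈ L20 p q, InKer U p t α β k₁ v → v = 0) {N : ℕ}
    {K : Fin N → ℂ} {u : Fin N → L2 C3} {h : Fin N → Fin 3 → Linf}
    (H : KerFam U p q t α β K u h) (hk₁ : ∀ l, k₁ - K l ∉ dualLattice) :
    ¬ ∀ᵐ z ∂cellMeasure, (gramMat fun l i => h l i z).det = 0 := by
  induction N with
  | zero =>
    intro h0
    have hne : (ae cellMeasure).NeBot := by
      rw [ae_neBot]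
      intro h1
      have := area_pos
      simp [area, h1] at this
    obtain ⟨z, hz⟩ := h0.exists
    simp at hz
  | succ N ih =>
    intro h0
    exact ih H.castSucc (fun l => hk₁ _) (H.det_castSucc_eq_zero hk₁ hinj h0)

end KerFam

/-! ### Flat bands -/

/-- `Γ*` is a module over `ℤ[ω]`. If `c` divides `3` there and `c k₀ ∈ 3Γ*`, then `3 k₀ ∈ 3Γ*`, that
is `k₀ ∈ Γ*`. -/
theorem int_combination_dvec_ne {k₀ : ℂ} (hk₀ : k₀ ∉ dualLattice) {c : ℂ} (a b : ℤ)
    (hc : (a + b * omega) * c = 3) (n : Fin 2 → ℤ) (hn : InCls 0 n) : c * k₀ ≠ dvec n := by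
  intro h
  obtain ⟨⟨m₀, h0⟩, ⟨m₁, h1⟩⟩ := hn
  let m : Fin 2 → ℤ := ![m₀, m₁]
  have hm : n = m + m + m := by
    ext i
    fin_cases i <;> simp [m] <;> omega
  have hsmul : ∀ (a : ℤ) (n : Fin 2 → ℤ), dvec (a • n) = a * dvec n := by
    intro a n
    have := map_zsmul (AddMonoidHom.mk' dvec dvec_add) a n
    simpa using this
  refine hk₀ (mem_dualLattice_iff.2 ⟨a • m + b • rot m, ?_⟩)
  rw [dvec_add, hsmul, hsmul, dvec_rot]
  rw [hm, dvec_add, dvec_add] at h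
  have h3 : (3 : ℂ) * (a * dvec m + b * (omega * dvec m)) = 3 * k₀ := by
    linear_combination (-(a + b * omega)) * h + k₀ * hc
  exact mul_left_cancel₀ three_ne_zero h3

/-- A kernel element at one parameter outside the dual lattice gives a flat band. -/
theorem exists_inKer_of_exists (U : Potential) {p q t : ℤ} (htq : (3 : ℤ) ∣ t - q) {α β k : ℂ}
    (hk : k ∉ dualLattice) (h : ∃ u, u ≠ 0 ∧ InKer U p t α β k u) (k' : ℂ) :
    ∃ u ∈ L20 p q, u ≠ 0 ∧ InKer U p t α β k' u := by
  by_contra hcon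
  have hinj : ∀ u ∈ L20 p q, InKer U p t α β k' u → u = 0 := by
    intro u hu hker
    by_contra h0
    exact hcon ⟨u, hu, h0, hker⟩
  obtain ⟨u, hu0, hu⟩ := h
  obtain ⟨r, v, hv, hv0, hvk⟩ := exists_mem_L20_inKer (p := p) htq hu0 hu
  obtain ⟨w, hw, hw0, hwk⟩ := exists_inKer_zero U htq α β
  have hk₀ := add_dvec_not_mem hk r
  set k₀ := k + dvec r
  let K : Fin 4 → ℂ := ![0 * k₀, 1 * k₀, omega ^ 2 * k₀, omega * k₀]
  let u : Fin 4 → L2 C3 := ![w, v, OmV v, OmV (OmV v)]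
  have hker : ∀ l, InKer U p t α β (K l) (u l) := by
    intro l
    fin_cases l
    · simpa [K, u] using hwk
    · simpa [K, u] using hvk
    · exact inKer_OmV hvk
    · have h1 := inKer_OmV (inKer_OmV hvk)
      rwa [show omega ^ 2 * (omega ^ 2 * k₀) = omega * k₀ by
        linear_combination omega * k₀ * omega_pow_three] at h1
  choose b hb using fun l => (hker l).exists_bounded
  have hω := one_add_omega_add_sq
  have H : KerFam U p q t α β K u b := by
    refine ⟨hb, fun l => ?_, fun l => ?_, hker, fun l l' hl n hn => ?_⟩
    · fin_cases l
      exacts [hw, hv, OmV_mem_L20 hv, OmV_mem_L20 (OmV_mem_L20 hv)]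
    · fin_cases l
      exacts [hw0, hv0, OmV_ne_zero hv0, OmV_ne_zero (OmV_ne_zero hv0)]
    · let c : Fin 4 → ℂ := ![0, 1, omega ^ 2, omega]
      have hK : K l - K l' = (c l - c l') * k₀ := by
        fin_cases l <;> fin_cases l' <;> simp [K, c] <;> ring
      rw [hK]
      -- Differences of `0, 1, ω², ω` are units of `ℤ[ω]` or units times `1 - ω`, and `1 - ω`
      -- divides `3`.
      have hlt : ∀ l l', l < l' → ∃ a b : ℤ, (a + b * omega) * (c l - c l') = 3 := by
        intro l l' h
        fin_cases l <;> fin_cases l' <;> first | exact absurd h (by decide) | skip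
        · exact ⟨-3, 0, by simp [c]⟩
        · exact ⟨0, -3, by simp [c]; linear_combination 3 * omega_pow_three⟩
        · exact ⟨3, 3, by simp [c]; linear_combination -3 * hω⟩
        · exact ⟨1, -1, by simp [c]; linear_combination omega_pow_three - hω⟩
        · exact ⟨2, 1, by simp [c]; linear_combination -hω⟩
        · exact ⟨1, 2, by simp [c]; linear_combination 2 * omega_pow_three - hω⟩
      have key : ∃ a b : ℤ, (a + b * omega) * (c l - c l') = 3 := by
        rcases lt_or_gt_of_ne hl with h | h
        · exact hlt _ _ h
        · obtain ⟨a, b, hab⟩ := hlt _ _ h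
          exact ⟨-a, -b, by push_cast; linear_combination hab⟩
      obtain ⟨a, b, hab⟩ := key
      exact int_combination_dvec_ne hk₀ a b hab n hn
  -- Injectivity holds on a neighbourhood of `k'`, which meets the complement of the countable
  -- exceptional set.
  obtain ⟨k₁, hinj₁, hk₁⟩ := ((KerFam.countable_exceptional K).dense_compl ℝ).inter_nhds_nonempty
    (eventually_injective U htq hinj)
  refine KerFam.not_det_eq_zero hk₁ H (fun l hl => hinj₁ ⟨l, hl⟩) (Eventually.of_forall fun z => ?_)
  exact det_gramMat_eq_zero (by norm_num) _

end

end TTG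

end

/-! ### Integrality of the scale `p ζ₂/ζ₁` and the conclusion -/

theorem TTG.exists_integral_scale {s : ℝ} {j r₁ : ℤ} {r₂ : ℕ} (hr₂ : ¬ 3 ∣ r₂)
    (hs : s = (3 : ℝ) ^ j * ((r₁ : ℝ) / (r₂ : ℝ))) :
    ∃ t : ℤ, ((TTG.pParam j r₂ : ℤ) : ℝ) * s = t ∧ (3 : ℤ) ∣ t - TTG.qParam j r₁ := by
  have h2 : (r₂ : ℝ) ≠ 0 := by
    rintro h
    rw [Nat.cast_eq_zero] at h
    exact hr₂ (h ▸ dvd_zero 3)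
  by_cases hj : 0 < j
  · lift j to ℕ using hj.le
    -- `p = r₂` clears the denominator, and `3 ∣ 3 ^ j` matches `q = 0`.
    refine ⟨3 ^ j * r₁, ?_, ?_⟩
    · rw [TTG.pParam, if_pos hj, hs, zpow_natCast]
      push_cast
      field_simp
    · rw [TTG.qParam, if_pos hj, sub_zero]
      exact (dvd_pow_self 3 (by omega)).mul_right r₁
  · obtain ⟨m, rfl⟩ : ∃ m : ℕ, j = -(m : ℤ) := ⟨(-j).toNat, by omega⟩
    -- `p` also cancels the negative power of 3, so the scale equals `r₁ = q`.
    refine ⟨r₁, ?_, ?_⟩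
    · rw [TTG.pParam, if_neg hj, hs, neg_neg, Int.toNat_natCast, zpow_neg, zpow_natCast]
      push_cast
      field_simp
    · rw [TTG.qParam, if_neg hj, sub_self]
      exact dvd_zero 3

theorem theorem2 (U : TTG.Potential) (ζ₁ ζ₂ : ℝ) (j r₁ : ℤ) (r₂ : ℕ)
    (hr₁ : ¬ (3 : ℤ) ∣ r₁) (hr₂ : ¬ 3 ∣ r₂)
    (hζ : ζ₂ / ζ₁ = (3 : ℝ) ^ j * ((r₁ : ℝ) / (r₂ : ℝ)))
    (α₁₂ α₂₃ : ℂ) (hα : α₁₂ ≠ 0) (k : ℂ) (hk : k ∉ TTG.dualLattice) :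
    TTG.IsBoundedInverse (TTG.IsTwoDzbarAdd k) (TTG.R k) ∧
    IsCompactOperator
      (TTG.birmanSchwinger U (TTG.pParam j r₂) (ζ₂ / ζ₁) k (α₂₃ / α₁₂)) ∧
    (TTG.IsMagic U (TTG.pParam j r₂) (TTG.qParam j r₁) (ζ₂ / ζ₁) α₁₂ α₂₃ ↔
      1 / α₁₂ ^ 2 ∈
        spectrum ℂ
          (TTG.birmanSchwinger U (TTG.pParam j r₂) (ζ₂ / ζ₁) k (α₂₃ / α₁₂))) := by
  obtain ⟨t, ht, htq⟩ := TTG.exists_integral_scale hr₂ hζ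
  refine ⟨TTG.R_eq_Rf hk ▸ TTG.isBoundedInverse_Rf hk,
    TTG.isCompactOperator_birmanSchwinger U ht hk _, ?_⟩
  rw [← TTG.exists_inKer_iff_mem_spectrum U ht hα hk]
  exact ⟨fun h => TTG.exists_inKer_of_isMagic ht htq h hk,
    fun h => TTG.isMagic_of_inKer ht (TTG.exists_inKer_of_exists U htq hk h)⟩
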